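/- Let $k\in\{1,2,\dots,\infty\}$ and let $\Omega\subset\mathbb R^2$ be a bounded strictly convex domain whose boundary is a simple closed curve of class $C^{k+2}$ with everywhere positive curvature; let $L$ be its perimeter and $\gamma:\mathbb R/L\mathbb Z\to\mathbb R^2$ the counterclockwise arclength parametrization of $\partial\Omega$. Put $H(s,s_1)=-|\gamma(s)-\gamma(s_1)|$. The (lifted) billiard map is $$F(s,r)=(s_1,r_1)\iff s<s_1<s+L,\quad r=-\partial_1H(s,s_1),\quad r_1=\partial_2H(s,s_1),$$ where $r=-\cos\theta\in(-1,1)$ and $\theta\in(0,\pi)$ is the angle between the boundary and the outgoing ray. It induces a map of the annulus $(\mathbb R/L\mathbb Z)\times(-1,1)$, and rotation numbers are computed with this lift, one full turn being $s\mapsto s+L$ (so they lie in $(0,1)$). An essential invariant curve is an invariant simple closed curve in this annulus that is not homotopic to a point. For rationals $\rho_1<\rho_2$, the billiard is called rationally integrable on $[\rho_1,\rho_2]$ if for every rational $\rho\in[\rho_1,\rho_2]$ there is an invariant continuous graph $r=f(s)$ on which the dynamics is conjugate to the rigid rotation with rotation number $\rho$, and whose rays envelop a closed caustic of class $C^k$: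 there is a $C^k$, $L$-periodic $c:\mathbb R\to\mathbb R^2$ such that for every $s$ the point $c(s)$ lies in the open chord from $\gamma(s)$ to the next bounce point $\gamma(s_1)$ and $c'(s)$ is parallel to that chord (singular points $c'(s)=0$ are allowed). Suppose that the billiard has two essential invariant curves $\Gamma_1,\Gamma_2$ on which the dynamics is conjugate to rigid rotations with rational rotation numbers $\rho_1<\rho_2$. Then the billiard is rationally integrable on $[\rho_1,\rho_2]$ if and only if it is $C^0$-integrable between $\Gamma_1$ and $\Gamma_2$, that is, the closed region of the phase annulus between $\Gamma_1$ and $\Gamma_2$ is foliated by (is the disjoint union of) continuous invariant graphs over $\mathbb R/L\mathbb Z$. -/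

import Mathlib

/-- A strictly convex planar billiard table whose boundary is a simple closed curve of class
`C^{k+2}` with everywhere positive curvature, parametrized counterclockwise by arclength. -/
structure ConvexTable (k : ℕ∞) where
  /-- the perimeter -/
  L : ℝ
  L_pos : 0 < L
  /-- the arclength parametrization of the boundary, lifted to the real line -/
  γ : ℝ → EuclideanSpace ℝ (Fin 2)
  contDiff : ContDiff ℝ ((k + 2 : ℕ∞) : WithTop ℕ∞) γ
  periodic : Function.Periodic γ L
  injOn : Set.InjOn γ (Set.Ico 0 L)
  speed : ∀ s, ‖deriv γ s‖ = 1
  curvature_pos : ∀ s,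
    0 < deriv γ s 0 * deriv (deriv γ) s 1 - deriv γ s 1 * deriv (deriv γ) s 0

namespace ConvexTable

variable {k : ℕ∞}

/-- The billiard generating function `H(s, s') = -|γ(s) - γ(s')|`. -/
noncomputable def H (T : ConvexTable k) (s s' : ℝ) : ℝ := -‖T.γ s - T.γ s'‖

/-- The graph of the billiard map, lifted to `ℝ × (-1, 1)`.  The coordinates are `(s, r)`, with `s`
the arclength parameter of the bounce point and `r = -cos θ`, where `θ ∈ (0, π)` is the angle
between the positive tangent at `γ(s)` and the outgoing ray.  The next bounce point is lifted so
that `s < s₁ < s + L`.  Since the two partial derivatives of `H` are the cosines of the angles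
which the chord makes with the boundary (up to sign), this is the law of reflection. -/
def Step (T : ConvexTable k) (z z₁ : ℝ × ℝ) : Prop :=
  z.1 < z₁.1 ∧ z₁.1 < z.1 + T.L ∧
    z.2 = -deriv (fun u => T.H u z₁.1) z.1 ∧ z₁.2 = deriv (fun u => T.H z.1 u) z₁.1

/-- `Γ` is the lift to `ℝ × (-1, 1)` of an essential invariant curve of the billiard map (an
embedded circle in the phase annulus which is not contractible, that is, which winds once around
the annulus) on which the dynamics is conjugate to the rigid rotation with rotation number `ρ`.
Here `h` is a lift of the embedding of the circle `ℝ/ℤ`, and the rotation number is computed with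
the lifted billiard map, one full turn being the translation of `s` by the perimeter. -/
def IsRotationCurve (T : ConvexTable k) (Γ : Set (ℝ × ℝ)) (ρ : ℝ) : Prop :=
  ∃ h : ℝ → ℝ × ℝ, Continuous h ∧ Function.Injective h ∧ Set.range h = Γ ∧
    (∀ t, h (t + 1) = h t + (T.L, 0)) ∧ ∀ t, T.Step (h t) (h (t + ρ))

/-- The graph of `f` over the `s` axis. -/
def graph (f : ℝ → ℝ) : Set (ℝ × ℝ) := {z | z.2 = f z.1}

/-- The (lift of the) graph of `f` is a continuous invariant graph of the billiard map over the
circle `ℝ/Lℤ`. -/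
def IsInvariantGraph (T : ConvexTable k) (f : ℝ → ℝ) : Prop :=
  Continuous f ∧ Function.Periodic f T.L ∧ ∀ s, ∃ s₁, T.Step (s, f s) (s₁, f s₁)

/-- `c` is a closed caustic of class `C^k` for the family of rays given by the graph of `f`: the
ray which leaves the boundary point `γ(s)` in the phase point `(s, f s)` touches `c` at `c(s)`,
which lies strictly inside the table.  As for any envelope, singular points of the curve `c`
(`deriv c s = 0`) are allowed. -/
def IsCaustic (T : ConvexTable k) (f : ℝ → ℝ) (c : ℝ → EuclideanSpace ℝ (Fin 2)) : Prop :=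
  ContDiff ℝ (k : WithTop ℕ∞) c ∧ Function.Periodic c T.L ∧
    ∀ s s₁, T.Step (s, f s) (s₁, f s₁) →
      c s ∈ openSegment ℝ (T.γ s) (T.γ s₁) ∧ ∃ a : ℝ, deriv c s = a • (T.γ s₁ - T.γ s)

/-- Rational integrability on `[ρ₁, ρ₂]`: for every rational `ρ` in this interval there is a smooth
caustic on which the dynamics is conjugate to the rigid rotation with rotation number `ρ`. -/
def RationallyIntegrableOn (T : ConvexTable k) (ρ₁ ρ₂ : ℚ) : Prop :=
  ∀ ρ : ℚ, ρ₁ ≤ ρ → ρ ≤ ρ₂ → ∃ (f : ℝ → ℝ) (c : ℝ → EuclideanSpace ℝ (Fin 2)),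
    T.IsInvariantGraph f ∧ T.IsCaustic f c ∧ T.IsRotationCurve (graph f) (ρ : ℝ)

/-- The closed strip `ℝ × [-1, 1]`, the universal cover of the closed phase annulus. -/
def strip : Set (ℝ × ℝ) := {z | -1 ≤ z.2 ∧ z.2 ≤ 1}

/-- The part of the strip strictly above `Γ`: the points which can be joined to the upper boundary
in the complement of `Γ`. -/
def above (Γ : Set (ℝ × ℝ)) : Set (ℝ × ℝ) := {z | ∃ s : ℝ, JoinedIn (strip \ Γ) z (s, 1)}

/-- The part of the strip strictly below `Γ`. -/
def below (Γ : Set (ℝ × ℝ)) : Set (ℝ × ℝ) := {z | ∃ s : ℝ, JoinedIn (strip \ Γ) z (s, -1)}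

/-- The closed region between the lower curve `Γ₁` and the upper curve `Γ₂`. -/
def between (Γ₁ Γ₂ : Set (ℝ × ℝ)) : Set (ℝ × ℝ) := {z ∈ strip | z ∉ below Γ₁ ∧ z ∉ above Γ₂}

/-- `C⁰`-integrability of the phase space between `Γ₁` and `Γ₂`: this region is foliated by
continuous invariant graphs, that is, it is the disjoint union of such graphs.  (Disjoint continuous
graphs are ordered, so graphs which fill the region depend continuously on the leaf.) -/
def C0IntegrableBetween (T : ConvexTable k) (Γ₁ Γ₂ : Set (ℝ × ℝ)) : Prop :=
  ∃ leaves : Set (ℝ → ℝ),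
    (∀ f ∈ leaves, T.IsInvariantGraph f ∧ graph f ⊆ between Γ₁ Γ₂) ∧
      ∀ z ∈ between Γ₁ Γ₂, ∃! f, f ∈ leaves ∧ z ∈ graph f

end ConvexTable

open Set Filter Topology

/-! ### The tangent angle of a simple closed curve with positive curvature -/

/-! The billiard is an exact twist map. Hopf's turning-tangent argument shows that the table lies
strictly to the left of each of its tangents, so the cosine `A s s'` strictly decreases as `s'` runs
once around the boundary; this twist makes the dynamics on an invariant graph a monotone lift of a
circle homeomorphism.

Let `r = f s` be an invariant graph and `u` a primitive of `f`. By the twist, `H s s' - u s'` has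
its strict minimum at the next bounce, and the minimal value plus `u s` is a constant. Comparing
these constants for two graphs gives the main tool `exists_action`: a function `w` with `w' = f₂ -
f₁` gains at least `κ` at each step of the dynamics of `f₂` and at most `κ` at each step of that of
`f₁`, with equality only where the graphs meet.

From rational integrability to a foliation: graphs are strictly ordered by their rotation numbers
(`lt_of_rot_lt`). At every real `ω` in the interval, the limits of the rational graphs from below
and from above are again invariant graphs, since invariant graphs have a common modulus of
continuity (`of_tendsto`). The two limits coincide. If `ω` is rational, summing the gains of `w`
over a period forces equality with the periodic graph. If `ω` is irrational, an interval where the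
limits differ would have infinitely many disjoint images on the circle, all of the same positive
`w`-mass (`eq_of_le_of_irrational`). Hence every phase point, which cuts the rational graphs into
those below and those above it, lies on the graph of its cut.

From a foliation to rational integrability: over each `s` the intermediate value theorem along the
vertical fibre finds a leaf with a periodic point of the wanted type. Two disjoint leaves cannot
both carry such points, by the gains of `w`, so one leaf serves all `s` and consists of periodic
orbits. Averaging along orbits conjugates its dynamics to a rotation. The graph solves an implicit
equation, nondegenerate by the twist, so it is of class `C^{k+1}`; the envelope of its rays involves
one derivative of the dynamics and is of class `C^k`. -/

theorem HasDerivAt.complex_im {f : ℝ → ℂ} {f' : ℂ} {x : ℝ} (h : HasDerivAt f f' x) :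
    HasDerivAt (fun x => (f x).im) f'.im x :=
  Complex.imCLM.hasFDerivAt.comp_hasDerivAt x h

/-- A continuous real function whose cosine is identically `-1` on an interval is constant. -/
theorem eq_of_cos_eq_neg_one {θ : ℝ → ℝ} {a b : ℝ} (hab : a ≤ b) (hθ : ContinuousOn θ (Icc a b))
    (hc : ∀ x ∈ Icc a b, Real.cos (θ x) = -1) : θ a = θ b := by
  have key : ∀ δ : ℝ, 0 < |δ| → |δ| ≤ Real.pi → ∀ x ∈ Icc a b, θ x ≠ θ a + δ := by
    intro δ h0 h1 x hx hxe
    have h2 := hc x hx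
    have h3 := hc a (left_mem_Icc.2 hab)
    have h4 : Real.sin (θ a) = 0 := by nlinarith [Real.sin_sq_add_cos_sq (θ a)]
    rw [hxe, Real.cos_add, h3, h4] at h2
    have h5 : Real.cos δ = 1 := by linarith
    rw [abs_le] at h1
    have := (Real.cos_eq_one_iff_of_lt_of_lt (by linarith [Real.pi_pos]) (by linarith [Real.pi_pos])).1 h5
    simp [this] at h0
  by_contra hne
  have hpi := Real.pi_pos
  rcases lt_or_gt_of_ne hne with h | h
  · have hv : θ a + min (θ b - θ a) Real.pi ∈ Icc (θ a) (θ b) :=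
      ⟨by have := le_min (sub_pos.2 h).le hpi.le; linarith, by linarith [min_le_left (θ b - θ a) Real.pi]⟩
    obtain ⟨x, hx, hxe⟩ := intermediate_value_Icc hab hθ hv
    have hp : 0 < min (θ b - θ a) Real.pi := lt_min (sub_pos.2 h) hpi
    exact key _ (by rwa [abs_of_pos hp]) (by rw [abs_of_pos hp]; exact min_le_right _ _) x hx hxe
  · have hp : 0 < min (θ a - θ b) Real.pi := lt_min (sub_pos.2 h) hpi
    have hv : θ a + -min (θ a - θ b) Real.pi ∈ Icc (θ b) (θ a) :=
      ⟨by linarith [min_le_left (θ a - θ b) Real.pi], by linarith⟩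
    obtain ⟨x, hx, hxe⟩ := intermediate_value_Icc' hab hθ hv
    exact key _ (by rwa [abs_neg, abs_of_pos hp])
      (by rw [abs_neg, abs_of_pos hp]; exact min_le_right _ _) x hx hxe

/-- A continuous angle which starts on the positive real axis, ends on the negative one and stays in
the closed upper half plane increases by exactly `π`. -/
theorem eq_add_pi_of_sin_nonneg {θ : ℝ → ℝ} {a b : ℝ} (hab : a ≤ b) (hθ : ContinuousOn θ (Icc a b))
    (hs : ∀ x ∈ Icc a b, 0 ≤ Real.sin (θ x)) (ha : Real.cos (θ a) = 1) (hb : Real.cos (θ b) = -1) :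
    θ b = θ a + Real.pi := by
  have hpi := Real.pi_pos
  have h4 : Real.sin (θ a) = 0 := by nlinarith [Real.sin_sq_add_cos_sq (θ a)]
  have hsv : ∀ v, Real.sin (θ a + v) = Real.sin v := by
    intro v; rw [Real.sin_add, ha, h4]; ring
  have hcv : ∀ v, Real.cos (θ a + v) = Real.cos v := by
    intro v; rw [Real.cos_add, ha, h4]; ring
  have h1 : θ b - θ a ≤ Real.pi := by
    by_contra! h
    have hv : θ a + min (θ b - θ a) (3 * Real.pi / 2) ∈ Icc (θ a) (θ b) :=
      ⟨by have : (0 : ℝ) ≤ min (θ b - θ a) (3 * Real.pi / 2) := le_min (by linarith) (by linarith)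
          linarith, by linarith [min_le_left (θ b - θ a) (3 * Real.pi / 2)]⟩
    obtain ⟨x, hx, hxe⟩ := intermediate_value_Icc hab hθ hv
    have := hs x hx
    rw [hxe, hsv] at this
    set m := min (θ b - θ a) (3 * Real.pi / 2) with hm
    have h5 : Real.pi < m := lt_min h (by linarith)
    have h6 : m ≤ 3 * Real.pi / 2 := min_le_right _ _
    have h7 := Real.sin_pos_of_pos_of_lt_pi (x := m - Real.pi) (by linarith) (by linarith)
    rw [Real.sin_sub_pi] at h7
    linarith
  have h2 : 0 ≤ θ b - θ a := by
    by_contra! h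
    have hv : θ a + max (θ b - θ a) (-(Real.pi / 2)) ∈ Icc (θ b) (θ a) :=
      ⟨by linarith [le_max_left (θ b - θ a) (-(Real.pi / 2))], by
        have : max (θ b - θ a) (-(Real.pi / 2)) ≤ 0 := max_le (by linarith) (by linarith)
        linarith⟩
    obtain ⟨x, hx, hxe⟩ := intermediate_value_Icc' hab hθ hv
    have := hs x hx
    rw [hxe, hsv] at this
    set m := max (θ b - θ a) (-(Real.pi / 2)) with hm
    have h5 : m < 0 := max_lt h (by linarith)
    have h6 : -(Real.pi / 2) ≤ m := le_max_right _ _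
    have h7 := Real.sin_neg_of_neg_of_neg_pi_lt h5 (by linarith)
    linarith
  have h3 : Real.cos (θ b - θ a) = Real.cos Real.pi := by
    rw [← hcv, Real.cos_pi]; convert hb using 2; ring
  have := Real.injOn_cos ⟨h2, h1⟩ ⟨hpi.le, le_rfl⟩ h3
  linarith

/-- A smoothed secant of a closed curve: the direction of the chord from `z s` to `z (s + d)`, which
extends continuously to the tangent directions for `d = 0` and `d = L`. -/
noncomputable def secant (τ : ℝ → ℂ) (L : ℝ) (p : ℝ × ℝ) : ℂ :=
  (∫ u in (0 : ℝ)..1, τ (p.1 + u * p.2)) - ∫ u in (0 : ℝ)..1, τ (p.1 + p.2 + u * (L - p.2))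

/-! ### Secant directions and Hopf's turning-tangent argument -/

section secant

variable {z τ ν : ℝ → ℂ} {L : ℝ}

theorem continuous_secant (hτ : Continuous τ) : Continuous (secant τ L) := by
  unfold secant
  refine Continuous.sub ?_ ?_
  · exact intervalIntegral.continuous_parametric_intervalIntegral_of_continuous'
      (f := fun (p : ℝ × ℝ) u => τ (p.1 + u * p.2)) (by fun_prop) 0 1
  · exact intervalIntegral.continuous_parametric_intervalIntegral_of_continuous'
      (f := fun (p : ℝ × ℝ) u => τ (p.1 + p.2 + u * (L - p.2))) (by fun_prop) 0 1

theorem mul_integral_comp_eq_sub (hz : ∀ s, HasDerivAt z (τ s) s) (hτ : Continuous τ) (s d : ℝ) :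
    (d : ℂ) * ∫ u in (0 : ℝ)..1, τ (s + u * d) = z (s + d) - z s := by
  rw [← intervalIntegral.integral_const_mul]
  have := intervalIntegral.integral_eq_sub_of_hasDerivAt (a := 0) (b := 1)
    (f := fun u : ℝ => z (s + u * d)) (f' := fun u => (d : ℂ) * τ (s + u * d))
    (fun u _ => by
      have h1 : HasDerivAt (fun u : ℝ => s + u * d) d u := by
        simpa using ((hasDerivAt_id u).mul_const d).const_add s
      have := (hz (s + u * d)).scomp u h1
      simpa [Function.comp_def] using this)
    (Continuous.intervalIntegrable (by fun_prop) _ _)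
  simpa using this

theorem tangent_periodic (hz : ∀ s, HasDerivAt z (τ s) s) (hper : Function.Periodic z L) :
    Function.Periodic τ L := by
  intro s
  have h1 : HasDerivAt (fun s => z (s + L)) (τ (s + L)) s := (hz (s + L)).comp_add_const s L
  have h2 : (fun s => z (s + L)) = z := funext hper
  rw [h2] at h1
  exact h1.unique (hz s)

/-- The two integrals are the mean velocities over the arc from `s` to `s + d` and over the
complementary arc, whose displacements are opposite. So for `0 < d < L` the secant is a positive
multiple of the chord. -/
theorem mul_secant (hz : ∀ s, HasDerivAt z (τ s) s) (hτ : Continuous τ)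
    (hper : Function.Periodic z L) (s d : ℝ) :
    ((d * (L - d) : ℝ) : ℂ) * secant τ L (s, d) = (L : ℂ) * (z (s + d) - z s) := by
  have h1 := mul_integral_comp_eq_sub hz hτ s d
  have h2 := mul_integral_comp_eq_sub hz hτ (s + d) (L - d)
  rw [show s + d + (L - d) = s + L by ring, hper s] at h2
  simp only [secant]
  push_cast at h2 ⊢
  linear_combination ((L : ℂ) - d) * h1 - (d : ℂ) * h2

theorem secant_zero (hz : ∀ s, HasDerivAt z (τ s) s) (hτ : Continuous τ)
    (hper : Function.Periodic z L) (hL : 0 < L) (s : ℝ) : secant τ L (s, 0) = τ s := by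
  have h2 := mul_integral_comp_eq_sub hz hτ s L
  rw [hper s, sub_self] at h2
  have h3 := (mul_eq_zero.1 h2).resolve_left (by exact_mod_cast hL.ne')
  simp [secant, h3]

/-- Reversing the chord exchanges the two complementary arcs. The case `d = 0` gives the opposite
tangent at the end `d = L`. -/
theorem secant_symm (hz : ∀ s, HasDerivAt z (τ s) s) (hper : Function.Periodic z L) (s d : ℝ) :
    secant τ L (s + d, L - d) = -secant τ L (s, d) := by
  have hp := tangent_periodic hz hper
  simp only [secant]
  rw [neg_sub]
  congr 1
  refine intervalIntegral.integral_congr fun u _ => ?_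
  show τ (s + d + (L - d) + u * (L - (L - d))) = τ (s + u * d)
  rw [show s + d + (L - d) + u * (L - (L - d)) = s + u * d + L by ring, hp]

theorem secant_period (hz : ∀ s, HasDerivAt z (τ s) s) (hτ : Continuous τ)
    (hper : Function.Periodic z L) (hL : 0 < L) (s : ℝ) : secant τ L (s, L) = -τ s := by
  have := secant_symm hz hper s 0
  rwa [secant_zero hz hτ hper hL, add_zero, sub_zero] at this

theorem ne_of_injOn_Ico (hper : Function.Periodic z L) (hL : 0 < L) (hinj : InjOn z (Ico 0 L))
    {s s' : ℝ} (h1 : s < s') (h2 : s' < s + L) : z s ≠ z s' := by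
  intro h
  obtain ⟨n, hn, -⟩ := existsUnique_sub_zsmul_mem_Ico hL s 0
  obtain ⟨m, hm, -⟩ := existsUnique_sub_zsmul_mem_Ico hL s' 0
  rw [zero_add] at hn hm
  have h3 : s - n • L = s' - m • L :=
    hinj hn hm (by rw [hper.sub_zsmul_eq, hper.sub_zsmul_eq]; exact h)
  simp only [zsmul_eq_mul] at h3
  have h4 : s' - s = ((m - n : ℤ) : ℝ) * L := by push_cast; linarith
  have h5 : (0 : ℝ) < ((m - n : ℤ) : ℝ) := by
    by_contra! hc
    nlinarith
  have h6 : ((m - n : ℤ) : ℝ) < 1 := by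
    by_contra! hc
    nlinarith
  have h7 : 0 < m - n := by exact_mod_cast h5
  have h8 : m - n < 1 := by exact_mod_cast h6
  omega

theorem secant_ne_zero (hz : ∀ s, HasDerivAt z (τ s) s) (hτ : Continuous τ)
    (hper : Function.Periodic z L) (hL : 0 < L) (hinj : InjOn z (Ico 0 L)) (hu : ∀ s, ‖τ s‖ = 1)
    {s d : ℝ} (hd : d ∈ Icc 0 L) : secant τ L (s, d) ≠ 0 := by
  have hτ0 : τ s ≠ 0 := norm_ne_zero_iff.1 (by rw [hu]; norm_num)
  rcases hd.1.eq_or_lt with h | h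
  · rw [← h, secant_zero hz hτ hper hL]; exact hτ0
  rcases hd.2.eq_or_lt with h' | h'
  · rw [h', secant_period hz hτ hper hL]; exact neg_ne_zero.2 hτ0
  intro h0
  have h1 := mul_secant hz hτ hper s d
  rw [h0, mul_zero] at h1
  have h2 := (mul_eq_zero.1 h1.symm).resolve_left (by exact_mod_cast hL.ne')
  exact ne_of_injOn_Ico hper hL hinj (lt_add_of_pos_right s h) (by linarith) (sub_eq_zero.1 h2).symm

/-- Continuous angle of the secants. -/
theorem exists_secant_angle (hz : ∀ s, HasDerivAt z (τ s) s) (hτ : Continuous τ)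
    (hper : Function.Periodic z L) (hL : 0 < L) (hinj : InjOn z (Ico 0 L)) (hu : ∀ s, ‖τ s‖ = 1) :
    ∃ ψ : ℝ × ℝ → ℝ, Continuous ψ ∧ ∀ s, ∀ d ∈ Icc 0 L, ∃ ρ : ℝ, 0 < ρ ∧
      secant τ L (s, d) = ρ * Complex.exp (ψ (s, d) * Complex.I) := by
  -- Clamping `d` to `[0, L]` gives a nowhere vanishing map on the whole plane, which is simply
  -- connected, so a continuous logarithm exists.
  let g : ℝ × ℝ → ℂ := fun p => secant τ L (p.1, max 0 (min p.2 L))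
  have hg : Continuous g := (continuous_secant hτ).comp (by fun_prop)
  have hcl : ∀ d : ℝ, max 0 (min d L) ∈ Icc 0 L := fun d =>
    ⟨le_max_left _ _, max_le hL.le (min_le_right _ _)⟩
  have hsc : IsSimplyConnected (univ : Set (ℝ × ℝ)) := by
    have : ContractibleSpace (univ : Set (ℝ × ℝ)) := convex_univ.contractibleSpace univ_nonempty
    exact SimplyConnectedSpace.ofContractible _
  obtain ⟨f, hf, hfe⟩ := Complex.exists_continuousOn_eqOn_exp_comp hsc isOpen_univ
    hg.continuousOn (by
      rintro ⟨p, -, hp⟩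
      exact secant_ne_zero hz hτ hper hL hinj hu (hcl p.2) hp)
  refine ⟨fun p => (f p).im, Complex.continuous_im.comp (continuousOn_univ.1 hf), ?_⟩
  intro s d hd
  refine ⟨Real.exp (f (s, d)).re, Real.exp_pos _, ?_⟩
  have h1 := hfe (mem_univ (s, d))
  simp only [Function.comp_apply, g] at h1
  rw [min_eq_left hd.2, max_eq_right hd.1] at h1
  rw [← h1, Complex.ofReal_exp, ← Complex.exp_add, Complex.re_add_im]

/-- The tangent angle of a simple closed curve which turns to the left somewhere at a lowest point
increases by `2π` along the curve. -/
theorem exists_tangent_angle (hz : ∀ s, HasDerivAt z (τ s) s) (hτ : ∀ s, HasDerivAt τ (ν s) s)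
    (hper : Function.Periodic z L) (hL : 0 < L) (hinj : InjOn z (Ico 0 L)) (hu : ∀ s, ‖τ s‖ = 1)
    (hcurv : ∀ s, 0 < ((starRingEnd ℂ) (τ s) * ν s).im) :
    ∃ φ : ℝ → ℝ, Continuous φ ∧ (∀ s, τ s = Complex.exp (φ s * Complex.I)) ∧
      ∀ s, φ (s + L) = φ s + 2 * Real.pi := by
  have hτc : Continuous τ := continuous_iff_continuousAt.2 fun s => (hτ s).continuousAt
  have hzc : Continuous z := continuous_iff_continuousAt.2 fun s => (hz s).continuousAt
  obtain ⟨ψ, hψ, hE⟩ := exists_secant_angle hz hτc hper hL hinj hu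
  have h0 : ∀ s, τ s = Complex.exp (ψ (s, 0) * Complex.I) := by
    intro s
    obtain ⟨ρ, hρ, h⟩ := hE s 0 ⟨le_rfl, hL.le⟩
    rw [secant_zero hz hτc hper hL] at h
    have h1 := congrArg norm h
    rw [hu, norm_mul, Complex.norm_exp_ofReal_mul_I, mul_one, Complex.norm_real,
      Real.norm_of_nonneg hρ.le] at h1
    rw [h, ← h1]; simp
  have hcos : ∀ s, ∀ d ∈ Icc 0 L, Real.cos (ψ (s + d, L - d) - ψ (s, d)) = -1 := by
    intro s d hd
    obtain ⟨ρ, hρ, h⟩ := hE s d hd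
    obtain ⟨ρ', hρ', h'⟩ := hE (s + d) (L - d) ⟨by linarith [hd.2], by linarith [hd.1]⟩
    rw [secant_symm hz hper, h] at h'
    have h1 : (ρ' : ℂ) * Complex.exp ((ψ (s + d, L - d) - ψ (s, d) : ℝ) * Complex.I) = -ρ := by
      push_cast
      rw [sub_mul, Complex.exp_sub, ← mul_div_assoc, ← h']
      field_simp
    have hn := congrArg norm h1
    rw [norm_mul, Complex.norm_exp_ofReal_mul_I, mul_one, norm_neg, Complex.norm_real,
      Complex.norm_real, Real.norm_of_nonneg hρ.le, Real.norm_of_nonneg hρ'.le] at hn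
    have hr := congrArg Complex.re h1
    rw [Complex.re_ofReal_mul, Complex.exp_ofReal_mul_I_re, Complex.neg_re, Complex.ofReal_re,
      hn] at hr
    have : ρ * (Real.cos (ψ (s + d, L - d) - ψ (s, d)) + 1) = 0 := by linarith
    linarith [(mul_eq_zero.1 this).resolve_left hρ.ne']
  -- The angle between a chord and its reverse is an odd multiple of `π`, hence constant in `d`. Its
  -- values at `d = 0` and `d = L` split the total turning into two equal halves.
  have hflip : ∀ s, ψ (s + L, 0) - ψ (s, L) = ψ (s, L) - ψ (s, 0) := by
    intro s
    have := eq_of_cos_eq_neg_one hL.le (θ := fun d => ψ (s + d, L - d) - ψ (s, d))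
      (by fun_prop) (hcos s)
    simp only [add_zero, sub_zero, sub_self] at this
    exact this.symm
  have hconst : ∀ a b, a ≤ b → ψ (a, L) - ψ (a, 0) = ψ (b, L) - ψ (b, 0) := by
    intro a b hab
    refine eq_of_cos_eq_neg_one hab (θ := fun s => ψ (s, L) - ψ (s, 0)) (by fun_prop) ?_
    intro s _
    have := hcos s 0 ⟨le_rfl, hL.le⟩
    rwa [add_zero, sub_zero] at this
  obtain ⟨s₀, -, hs₀⟩ := isCompact_Icc.exists_isMinOn (nonempty_Icc.2 hL.le)
    (Complex.continuous_im.comp hzc).continuousOn (s := Icc 0 L)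
  have hmin : ∀ s, (z s₀).im ≤ (z s).im := by
    intro s
    obtain ⟨n, hn, -⟩ := existsUnique_sub_zsmul_mem_Ico hL s 0
    rw [zero_add] at hn
    have := hs₀ (Ico_subset_Icc_self hn)
    simpa only [mem_ofPred_eq, Function.comp_apply, hper.sub_zsmul_eq] using this
  have him : ∀ s, HasDerivAt (fun s => (z s).im) (τ s).im s := fun s => (hz s).complex_im
  have him2 : ∀ s, HasDerivAt (fun s => (τ s).im) (ν s).im s := fun s => (hτ s).complex_im
  have him0 : (τ s₀).im = 0 :=
    IsLocalMin.hasDerivAt_eq_zero (f := fun s => (z s).im) (Filter.Eventually.of_forall hmin) (him s₀)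
  -- At a lowest point the tangent is horizontal. If it pointed to the left, positive curvature
  -- would bend the curve below its minimum.
  have hre : (τ s₀).re = 1 := by
    have h1 := hcurv s₀
    have hn : (τ s₀).re ^ 2 = 1 := by
      have := Complex.sq_norm (τ s₀)
      rw [hu, Complex.normSq_apply, him0] at this
      nlinarith
    rcases mul_self_eq_one_iff.1 ((sq _).symm.trans hn) with h | h
    · exact h
    exfalso
    simp only [Complex.mul_im, Complex.conj_re, Complex.conj_im, him0, h] at h1
    have hν : (ν s₀).im < 0 := by linarith
    have hev : ∀ᶠ s in 𝓝[>] s₀, (τ s).im < 0 := by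
      have := (hasDerivAt_iff_tendsto_slope.1 (him2 s₀)).eventually (gt_mem_nhds hν)
      have h' := this.filter_mono (nhdsWithin_mono s₀ (fun x (hx : s₀ < x) => hx.ne'))
      filter_upwards [h', self_mem_nhdsWithin] with s hs hs'
      rw [slope_def_field, him0, sub_zero] at hs
      by_contra! hc
      have := div_nonneg hc (sub_pos.2 hs').le
      linarith
    obtain ⟨b, hb, hb'⟩ := (mem_nhdsGT_iff_exists_Ioc_subset).1 hev
    have hanti : StrictAntiOn (fun s => (z s).im) (Icc s₀ b) := by
      refine strictAntiOn_of_deriv_neg (convex_Icc _ _)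
        (Complex.continuous_im.comp hzc).continuousOn ?_
      intro x hx
      rw [interior_Icc] at hx
      rw [(him x).deriv]
      exact hb' ⟨hx.1, hx.2.le⟩
    have := hanti (left_mem_Icc.2 (le_of_lt hb)) (right_mem_Icc.2 (le_of_lt hb)) hb
    exact absurd (hmin b) (not_le.2 this)
  -- All secants from the lowest point lie in the closed upper half plane, so half of the turning is
  -- exactly `π`.
  have hpi : ψ (s₀, L) = ψ (s₀, 0) + Real.pi := by
    refine eq_add_pi_of_sin_nonneg hL.le (θ := fun d => ψ (s₀, d)) (by fun_prop) ?_ ?_ ?_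
    · intro d hd
      obtain ⟨ρ, hρ, h⟩ := hE s₀ d hd
      have hnn : 0 ≤ (secant τ L (s₀, d)).im := by
        rcases hd.1.eq_or_lt with h' | h'
        · rw [← h', secant_zero hz hτc hper hL, him0]
        rcases hd.2.eq_or_lt with h'' | h''
        · rw [h'', secant_period hz hτc hper hL, Complex.neg_im, him0, neg_zero]
        have h1 := congrArg Complex.im (mul_secant hz hτc hper s₀ d)
        rw [Complex.im_ofReal_mul, Complex.im_ofReal_mul, Complex.sub_im] at h1
        have h2 : 0 < d * (L - d) := mul_pos h' (by linarith)
        have h3 : 0 ≤ d * (L - d) * (secant τ L (s₀, d)).im := by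
          rw [h1]; exact mul_nonneg hL.le (sub_nonneg.2 (hmin _))
        exact nonneg_of_mul_nonneg_right h3 h2
      rw [h, Complex.im_ofReal_mul, Complex.exp_ofReal_mul_I_im] at hnn
      exact nonneg_of_mul_nonneg_right hnn hρ
    · have := congrArg Complex.re (h0 s₀)
      rw [Complex.exp_ofReal_mul_I_re, hre] at this
      exact this.symm
    · obtain ⟨ρ, hρ, h⟩ := hE s₀ L ⟨hL.le, le_rfl⟩
      rw [secant_period hz hτc hper hL] at h
      have h1 := congrArg norm h
      rw [norm_neg, hu, norm_mul, Complex.norm_exp_ofReal_mul_I, mul_one, Complex.norm_real,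
        Real.norm_of_nonneg hρ.le] at h1
      have := congrArg Complex.re h
      rw [← h1, Complex.re_ofReal_mul, Complex.exp_ofReal_mul_I_re, Complex.neg_re, hre] at this
      linarith
  refine ⟨fun s => ψ (s, 0), by fun_prop, h0, ?_⟩
  intro s
  have h1 := hflip s
  have h2 : ψ (s, L) - ψ (s, 0) = Real.pi := by
    have : ψ (s₀, L) - ψ (s₀, 0) = Real.pi := by linarith
    rcases le_total s s₀ with h | h
    · rw [hconst _ _ h, this]
    · rw [← hconst _ _ h, this]
  show ψ (s + L, 0) = ψ (s, 0) + 2 * Real.pi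
  linarith

/-- Near `s` the angle is `φ s` plus the arcsine of a differentiable cross product, so it has a
derivative, the curvature. -/
theorem strictMono_tangent_angle (hτ : ∀ s, HasDerivAt τ (ν s) s)
    (hcurv : ∀ s, 0 < ((starRingEnd ℂ) (τ s) * ν s).im) {φ : ℝ → ℝ} (hφ : Continuous φ)
    (he : ∀ s, τ s = Complex.exp (φ s * Complex.I)) : StrictMono φ := by
  have hsin : ∀ s s', ((starRingEnd ℂ) (τ s) * τ s').im = Real.sin (φ s' - φ s) := by
    intro s s'
    rw [he, he, ← Complex.exp_conj, ← Complex.exp_add]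
    have : (starRingEnd ℂ) (φ s * Complex.I) + φ s' * Complex.I
        = ((φ s' - φ s : ℝ) : ℂ) * Complex.I := by
      simp; ring
    rw [this, Complex.exp_ofReal_mul_I_im]
  have hder : ∀ s, HasDerivAt φ ((starRingEnd ℂ) (τ s) * ν s).im s := by
    intro s
    have h1 : HasDerivAt (fun s' => ((starRingEnd ℂ) (τ s) * τ s').im)
        ((starRingEnd ℂ) (τ s) * ν s).im s :=
      ((hτ s).const_mul ((starRingEnd ℂ) (τ s))).complex_im
    have h2 : HasDerivAt (fun s' => φ s + Real.arcsin ((starRingEnd ℂ) (τ s) * τ s').im)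
        ((starRingEnd ℂ) (τ s) * ν s).im s := by
      have h3 := (Real.hasDerivAt_arcsin (x := ((starRingEnd ℂ) (τ s) * τ s).im)
        (by rw [hsin]; simp) (by rw [hsin]; simp)).comp s h1
      have h4 : ((starRingEnd ℂ) (τ s) * τ s).im = 0 := by rw [hsin]; simp
      simpa [h4, Function.comp_def] using h3.const_add (φ s)
    refine h2.congr_of_eventuallyEq ?_
    have h5 : ∀ᶠ s' in 𝓝 s, φ s' - φ s ∈ Ioo (-(Real.pi / 2)) (Real.pi / 2) := by
      have : Tendsto (fun s' => φ s' - φ s) (𝓝 s) (𝓝 (φ s - φ s)) := (hφ.tendsto s).sub_const _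
      rw [sub_self] at this
      exact this.eventually (Ioo_mem_nhds (by linarith [Real.pi_pos]) (by linarith [Real.pi_pos]))
    filter_upwards [h5] with s' hs'
    rw [hsin, Real.arcsin_sin hs'.1.le hs'.2.le]
    ring
  exact strictMono_of_deriv_pos fun s => by rw [(hder s).deriv]; exact hcurv s

/-- A simple closed curve with positive curvature lies strictly on one side of each tangent. -/
theorem tangent_cross_pos (hz : ∀ s, HasDerivAt z (τ s) s) (hτ : ∀ s, HasDerivAt τ (ν s) s)
    (hper : Function.Periodic z L) (hL : 0 < L) (hinj : InjOn z (Ico 0 L)) (hu : ∀ s, ‖τ s‖ = 1)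
    (hcurv : ∀ s, 0 < ((starRingEnd ℂ) (τ s) * ν s).im) {s s' : ℝ} (h1 : s < s')
    (h2 : s' < s + L) : 0 < ((starRingEnd ℂ) (τ s) * (z s' - z s)).im := by
  obtain ⟨φ, hφ, he, hφL⟩ := exists_tangent_angle hz hτ hper hL hinj hu hcurv
  have hmono := strictMono_tangent_angle hτ hcurv hφ he
  have hpi := Real.pi_pos
  have hsin : ∀ s', ((starRingEnd ℂ) (τ s) * τ s').im = Real.sin (φ s' - φ s) := by
    intro s'
    rw [he, he, ← Complex.exp_conj, ← Complex.exp_add]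
    have : (starRingEnd ℂ) (φ s * Complex.I) + φ s' * Complex.I
        = ((φ s' - φ s : ℝ) : ℂ) * Complex.I := by
      simp; ring
    rw [this, Complex.exp_ofReal_mul_I_im]
  set a : ℝ → ℝ := fun x => ((starRingEnd ℂ) (τ s) * (z x - z s)).im with ha
  have hd : ∀ x, HasDerivAt a (Real.sin (φ x - φ s)) x := by
    intro x
    rw [← hsin]
    exact (((hz x).sub_const (z s)).const_mul ((starRingEnd ℂ) (τ s))).complex_im
  have hac : Continuous a := continuous_iff_continuousAt.2 fun s => (hd s).continuousAt
  -- At `m` the tangent is opposite to the one at `s`. The height `a` over the tangent line rises up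
  -- to `m`, falls afterwards, and vanishes at both ends of the turn.
  obtain ⟨m, hm, hme⟩ : φ s + Real.pi ∈ φ '' Icc s (s + L) :=
    intermediate_value_Icc (by linarith) hφ.continuousOn ⟨by linarith, by rw [hφL]; linarith⟩
  have ha0 : a s = 0 := by simp [ha]
  have haL : a (s + L) = 0 := by simp [ha, hper s]
  show 0 < a s'
  rcases le_total s' m with h | h
  · have hst : StrictMonoOn a (Icc s m) := by
      refine strictMonoOn_of_deriv_pos (convex_Icc _ _) hac.continuousOn ?_
      intro x hx
      rw [interior_Icc] at hx
      rw [(hd x).deriv]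
      have := hmono hx.1
      have := hmono hx.2
      exact Real.sin_pos_of_pos_of_lt_pi (by linarith) (by linarith)
    rw [← ha0]
    exact hst ⟨le_rfl, hm.1⟩ ⟨h1.le, h⟩ h1
  · have hst : StrictAntiOn a (Icc m (s + L)) := by
      refine strictAntiOn_of_deriv_neg (convex_Icc _ _) hac.continuousOn ?_
      intro x hx
      rw [interior_Icc] at hx
      rw [(hd x).deriv]
      have h3 := hmono hx.1
      have h4 := hmono hx.2
      rw [hφL] at h4
      have := Real.sin_pos_of_pos_of_lt_pi (x := φ x - φ s - Real.pi) (by linarith) (by linarith)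
      rw [Real.sin_sub_pi] at this
      linarith
    rw [← haL]
    exact hst ⟨h, h2.le⟩ ⟨hm.2, le_rfl⟩ h2

end secant

namespace ConvexTable

variable {k : ℕ∞} (T : ConvexTable k)

/-! ### Geometry of the table -/

theorem contDiff_deriv : ContDiff ℝ ((k + 1 : ℕ∞) : WithTop ℕ∞) (deriv T.γ) := by
  have h := T.contDiff
  have e : ((k + 2 : ℕ∞) : WithTop ℕ∞) = ((k + 1 : ℕ∞) : WithTop ℕ∞) + 1 := by
    push_cast; rw [add_assoc, one_add_one_eq_two]; rfl
  rw [e] at h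
  exact (contDiff_succ_iff_deriv.1 h).2.2

theorem contDiff_curve : ContDiff ℝ ((k + 1 : ℕ∞) : WithTop ℕ∞) T.γ := by
  refine T.contDiff.of_le ?_
  exact_mod_cast (by gcongr; norm_num : k + 1 ≤ k + 2)

theorem one_le_order : (1 : WithTop ℕ∞) ≤ ((k + 1 : ℕ∞) : WithTop ℕ∞) := by
  exact_mod_cast (le_add_self : (1 : ℕ∞) ≤ k + 1)

theorem order_ne_zero : ((k + 1 : ℕ∞) : WithTop ℕ∞) ≠ 0 := fun h => by
  have := one_le_order (k := k)
  rw [h] at this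
  simp at this

theorem hasDerivAt_curve (s : ℝ) : HasDerivAt T.γ (deriv T.γ s) s :=
  ((T.contDiff_curve.differentiable order_ne_zero) s).hasDerivAt

theorem hasDerivAt_tangent (s : ℝ) : HasDerivAt (deriv T.γ) (deriv (deriv T.γ) s) s :=
  ((T.contDiff_deriv.differentiable order_ne_zero) s).hasDerivAt

/-- The cross product of the tangent at `γ(s)` with the chord from `γ(s)` to `γ(s')`. -/
noncomputable def cr (s s' : ℝ) : ℝ :=
  deriv T.γ s 0 * (T.γ s' 1 - T.γ s 1) - deriv T.γ s 1 * (T.γ s' 0 - T.γ s 0)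

/-- The cosine of the angle between the tangent at `γ(s)` and the chord from `γ(s)` to `γ(s')`. -/
noncomputable def A (s s' : ℝ) : ℝ := inner ℝ (deriv T.γ s) (T.γ s' - T.γ s) / ‖T.γ s' - T.γ s‖

theorem hasDerivAt_coord {f : ℝ → EuclideanSpace ℝ (Fin 2)} {f' : EuclideanSpace ℝ (Fin 2)} {s : ℝ}
    (h : HasDerivAt f f' s) (i : Fin 2) : HasDerivAt (fun s => f s i) (f' i) s :=
  (EuclideanSpace.proj (𝕜 := ℝ) i).hasFDerivAt.comp_hasDerivAt s h

/-- The point of the complex plane with the same coordinates. -/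
def toC (v : EuclideanSpace ℝ (Fin 2)) : ℂ := ⟨v 0, v 1⟩

theorem toC_eq (v : EuclideanSpace ℝ (Fin 2)) : toC v = (v 0 : ℂ) + (v 1 : ℂ) * Complex.I :=
  Complex.mk_eq_add_mul_I _ _

theorem hasDerivAt_toC {f : ℝ → EuclideanSpace ℝ (Fin 2)} {f' : EuclideanSpace ℝ (Fin 2)} {s : ℝ}
    (h : HasDerivAt f f' s) : HasDerivAt (fun s => toC (f s)) (toC f') s := by
  have h0 := (hasDerivAt_coord h 0).ofReal_comp
  have h1 := ((hasDerivAt_coord h 1).ofReal_comp).mul_const Complex.I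
  simp only [toC_eq]
  exact h0.add h1

theorem curve_ne {s s' : ℝ} (h1 : s < s') (h2 : s' < s + T.L) : T.γ s' ≠ T.γ s := by
  have hp : Function.Periodic (fun s => toC (T.γ s)) T.L := fun s => by simp only [T.periodic s]
  have hi : InjOn (fun s => toC (T.γ s)) (Ico 0 T.L) := by
    intro a ha b hb hab
    refine T.injOn ha hb ?_
    simp only [toC, Complex.ext_iff] at hab
    ext i; fin_cases i
    · exact hab.1
    · exact hab.2
  intro h
  exact ne_of_injOn_Ico hp T.L_pos hi h1 h2 (by simp only [h])

theorem cr_pos {s s' : ℝ} (h1 : s < s') (h2 : s' < s + T.L) : 0 < T.cr s s' := by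
  have hp : Function.Periodic (fun s => toC (T.γ s)) T.L := fun s => by simp only [T.periodic s]
  have hi : InjOn (fun s => toC (T.γ s)) (Ico 0 T.L) := by
    intro a ha b hb hab
    refine T.injOn ha hb ?_
    simp only [toC, Complex.ext_iff] at hab
    ext i; fin_cases i
    · exact hab.1
    · exact hab.2
  have := tangent_cross_pos (fun s => hasDerivAt_toC (T.hasDerivAt_curve s))
    (fun s => hasDerivAt_toC (T.hasDerivAt_tangent s)) hp T.L_pos hi ?_ ?_ h1 h2
  · simp only [toC, Complex.mul_im, Complex.conj_re, Complex.conj_im, Complex.sub_re,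
      Complex.sub_im] at this
    unfold cr
    linarith
  · intro s
    have := T.speed s
    rw [EuclideanSpace.norm_eq, Fin.sum_univ_two] at this
    rw [← this, Complex.norm_def, Complex.normSq_apply]
    simp [toC, sq]
  · intro s
    have := T.curvature_pos s
    simp only [toC, Complex.mul_im, Complex.conj_re, Complex.conj_im]
    linarith

theorem tangent_periodic : Function.Periodic (deriv T.γ) T.L := by
  intro s
  have h1 : HasDerivAt (fun s => T.γ (s + T.L)) (deriv T.γ (s + T.L)) s :=
    (T.hasDerivAt_curve (s + T.L)).comp_add_const s T.L
  have h2 : (fun s => T.γ (s + T.L)) = T.γ := funext T.periodic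
  rw [h2] at h1
  exact h1.deriv.symm

theorem cr_add_right (s s' : ℝ) : T.cr s (s' + T.L) = T.cr s s' := by simp only [cr, T.periodic s']

theorem cr_pos' {s s' : ℝ} (h1 : s < s') (h2 : s' < s + T.L) : 0 < T.cr s' s := by
  rw [← T.cr_add_right]
  exact T.cr_pos h2 (by linarith)

theorem A_add_left (s s' : ℝ) : T.A (s + T.L) s' = T.A s s' := by
  simp only [A, T.periodic s, T.tangent_periodic s]

theorem A_add_right (s s' : ℝ) : T.A s (s' + T.L) = T.A s s' := by simp only [A, T.periodic s']

theorem inner_eq (v w : EuclideanSpace ℝ (Fin 2)) : inner ℝ v w = v 0 * w 0 + v 1 * w 1 := by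
  simp [PiLp.inner_apply, Fin.sum_univ_two, mul_comm]

theorem norm_sq_eq (v : EuclideanSpace ℝ (Fin 2)) : ‖v‖ ^ 2 = v 0 * v 0 + v 1 * v 1 := by
  rw [← inner_eq, real_inner_self_eq_norm_sq]

theorem hasDerivAt_norm_sub {f : ℝ → EuclideanSpace ℝ (Fin 2)} {f' : EuclideanSpace ℝ (Fin 2)}
    {s : ℝ} (h : HasDerivAt f f' s) (h0 : f s ≠ 0) :
    HasDerivAt (fun s => ‖f s‖) (inner ℝ f' (f s) / ‖f s‖) s := by
  have h1 := (h.norm_sq).sqrt (pow_ne_zero 2 (norm_ne_zero_iff.2 h0))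
  have h2 : (fun s => ‖f s‖) = fun s => Real.sqrt (‖f s‖ ^ 2) := by
    ext s; rw [Real.sqrt_sq (norm_nonneg _)]
  rw [h2]
  convert h1 using 1
  rw [Real.sqrt_sq (norm_nonneg _), real_inner_comm, mul_div_mul_left _ _ two_ne_zero]

theorem hasDerivAt_H_left {s s' : ℝ} (h : T.γ s' ≠ T.γ s) :
    HasDerivAt (fun u => T.H u s') (T.A s s') s := by
  have h1 := (hasDerivAt_norm_sub ((T.hasDerivAt_curve s).sub_const (T.γ s'))
    (sub_ne_zero.2 h.symm)).neg
  refine h1.congr_deriv ?_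
  rw [A, norm_sub_rev, ← neg_sub (T.γ s') (T.γ s), inner_neg_right, neg_div, neg_neg]

theorem H_symm (s s' : ℝ) : T.H s s' = T.H s' s := by simp only [H, norm_sub_rev]

theorem hasDerivAt_H_right {s s' : ℝ} (h : T.γ s' ≠ T.γ s) :
    HasDerivAt (fun u => T.H s u) (T.A s' s) s' := by
  simp only [T.H_symm s]
  exact T.hasDerivAt_H_left h.symm

theorem H_add (s s' : ℝ) : T.H (s + T.L) (s' + T.L) = T.H s s' := by
  simp only [H, T.periodic s, T.periodic s']

/-- The law of reflection in terms of the angles. -/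
theorem step_iff {s r s₁ r₁ : ℝ} : T.Step (s, r) (s₁, r₁) ↔
    s < s₁ ∧ s₁ < s + T.L ∧ r = -T.A s s₁ ∧ r₁ = T.A s₁ s := by
  unfold Step
  constructor
  · rintro ⟨h1, h2, h3, h4⟩
    have hne := T.curve_ne h1 h2
    rw [(T.hasDerivAt_H_left hne).deriv] at h3
    rw [(T.hasDerivAt_H_right hne).deriv] at h4
    exact ⟨h1, h2, h3, h4⟩
  · rintro ⟨h1, h2, h3, h4⟩
    have hne := T.curve_ne h1 h2
    refine ⟨h1, h2, ?_, ?_⟩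
    · rw [(T.hasDerivAt_H_left hne).deriv]; exact h3
    · rw [(T.hasDerivAt_H_right hne).deriv]; exact h4

/-- With `v` the chord and `a`, `b` the two tangents, the planar identity `|v|²⟨a, b⟩ - ⟨a, v⟩⟨b, v⟩
= (a × v)(b × v)` collapses the quotient rule. The minus sign appears because `cr s' s` uses the
reversed chord. -/
theorem hasDerivAt_A_right {s s' : ℝ} (h : T.γ s' ≠ T.γ s) :
    HasDerivAt (fun u => T.A s u) (-(T.cr s s' * T.cr s' s) / ‖T.γ s' - T.γ s‖ ^ 3) s' := by
  have h0 := sub_ne_zero.2 h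
  have hn : ‖T.γ s' - T.γ s‖ ≠ 0 := norm_ne_zero_iff.2 h0
  have h1 := (T.hasDerivAt_curve s').sub_const (T.γ s)
  have h2 := ((hasDerivAt_const s' (deriv T.γ s)).inner ℝ h1).div (hasDerivAt_norm_sub h1 h0) hn
  refine h2.congr_deriv ?_
  have h3 := norm_sq_eq (T.γ s' - T.γ s)
  simp only [inner_eq, cr, PiLp.sub_apply, inner_zero_left] at h3 ⊢
  field_simp
  rw [h3]
  ring

theorem A_deriv_neg {s s' : ℝ} (h1 : s < s') (h2 : s' < s + T.L) :
    -(T.cr s s' * T.cr s' s) / ‖T.γ s' - T.γ s‖ ^ 3 < 0 := by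
  have hn : 0 < ‖T.γ s' - T.γ s‖ := norm_pos_iff.2 (sub_ne_zero.2 (T.curve_ne h1 h2))
  exact div_neg_of_neg_of_pos (neg_neg_of_pos (mul_pos (T.cr_pos h1 h2) (T.cr_pos' h1 h2)))
    (pow_pos hn 3)

/-- The twist condition. -/
theorem A_strictAntiOn (s : ℝ) : StrictAntiOn (T.A s) (Ioo s (s + T.L)) := by
  have hd : ∀ u ∈ Ioo s (s + T.L), HasDerivAt (fun u => T.A s u)
      (-(T.cr s u * T.cr u s) / ‖T.γ u - T.γ s‖ ^ 3) u :=
    fun u hu => T.hasDerivAt_A_right (T.curve_ne hu.1 hu.2)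
  refine strictAntiOn_of_deriv_neg (convex_Ioo _ _)
    (fun u hu => (hd u hu).continuousAt.continuousWithinAt) ?_
  intro u hu
  rw [interior_Ioo] at hu
  rw [show deriv (T.A s) u = _ from (hd u hu).deriv]
  exact T.A_deriv_neg hu.1 hu.2

theorem A_lt {s a b : ℝ} (h1 : s < a) (h2 : a < b) (h3 : b < s + T.L) : T.A s b < T.A s a :=
  T.A_strictAntiOn s ⟨h1, h2.trans h3⟩ ⟨h1.trans h2, h3⟩ h2

theorem A_lt' {s a b : ℝ} (h1 : s - T.L < a) (h2 : a < b) (h3 : b < s) : T.A s b < T.A s a := by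
  rw [← T.A_add_right s a, ← T.A_add_right s b]
  exact T.A_lt (by linarith) (by linarith) (by linarith)

theorem abs_A_lt_one {s s' : ℝ} (h1 : s < s') (h2 : s' < s + T.L) : |T.A s s'| < 1 := by
  have hn : 0 < ‖T.γ s' - T.γ s‖ := norm_pos_iff.2 (sub_ne_zero.2 (T.curve_ne h1 h2))
  have hc := T.cr_pos h1 h2
  rw [A, abs_div, abs_of_pos hn, div_lt_one hn]
  refine abs_lt_of_sq_lt_sq ?_ hn.le
  have h3 := norm_sq_eq (T.γ s' - T.γ s)
  have h4 := norm_sq_eq (deriv T.γ s)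
  rw [T.speed] at h4
  simp only [inner_eq, cr, PiLp.sub_apply] at h3 h4 hc ⊢
  rw [h3]
  have h5 := pow_pos hc 2
  linear_combination h5 - ((T.γ s' 0 - T.γ s 0) * (T.γ s' 0 - T.γ s 0) + (T.γ s' 1 - T.γ s 1) * (T.γ s' 1 - T.γ s 1)) * h4

theorem contDiffAt_A {p : ℝ × ℝ} (h : T.γ p.2 ≠ T.γ p.1) :
    ContDiffAt ℝ ((k + 1 : ℕ∞) : WithTop ℕ∞) (fun p : ℝ × ℝ => T.A p.1 p.2) p := by
  have h1 : ContDiff ℝ ((k + 1 : ℕ∞) : WithTop ℕ∞) (fun p : ℝ × ℝ => T.γ p.2 - T.γ p.1) :=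
    (T.contDiff_curve.comp contDiff_snd).sub (T.contDiff_curve.comp contDiff_fst)
  have h2 : ContDiff ℝ ((k + 1 : ℕ∞) : WithTop ℕ∞) (fun p : ℝ × ℝ => deriv T.γ p.1) :=
    T.contDiff_deriv.comp contDiff_fst
  exact ((h2.inner ℝ h1).contDiffAt).div (h1.contDiffAt.norm ℝ (sub_ne_zero.2 h))
    (norm_ne_zero_iff.2 (sub_ne_zero.2 h))

theorem continuousAt_A {p : ℝ × ℝ} (h : T.γ p.2 ≠ T.γ p.1) :
    ContinuousAt (fun p : ℝ × ℝ => T.A p.1 p.2) p := (T.contDiffAt_A h).continuousAt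

/-- Composition rule for limits through `A`. -/
theorem tendsto_A {ι : Type*} {l : Filter ι} {a b : ι → ℝ} {s s' : ℝ} (h : T.γ s' ≠ T.γ s)
    (ha : Tendsto a l (𝓝 s)) (hb : Tendsto b l (𝓝 s')) :
    Tendsto (fun i => T.A (a i) (b i)) l (𝓝 (T.A s s')) :=
  Tendsto.comp (g := fun p : ℝ × ℝ => T.A p.1 p.2) (f := fun i => (a i, b i))
    (T.continuousAt_A (p := (s, s')) h) (ha.prodMk_nhds hb)

/-! ### The billiard map -/

/-- The phase points which have an image under the billiard map. -/
def dom : Set (ℝ × ℝ) := {z | ∃ z₁, T.Step z z₁}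

open Classical in
/-- The next bounce point. -/
noncomputable def bounce (z : ℝ × ℝ) : ℝ := if h : ∃ z₁, T.Step z z₁ then h.choose.1 else 0

variable {T}

theorem bounce_spec {z : ℝ × ℝ} (h : z ∈ T.dom) :
    z.1 < T.bounce z ∧ T.bounce z < z.1 + T.L ∧ z.2 = -T.A z.1 (T.bounce z) := by
  obtain ⟨s, r⟩ := z
  have h' : ∃ z₁, T.Step (s, r) z₁ := h
  have h2 := h'.choose_spec
  rw [bounce, dif_pos h']
  have := T.step_iff.1 (show T.Step (s, r) (h'.choose.1, h'.choose.2) from h2)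
  exact ⟨this.1, this.2.1, this.2.2.1⟩

theorem step_of_A {s s₁ : ℝ} (h1 : s < s₁) (h2 : s₁ < s + T.L) :
    T.Step (s, -T.A s s₁) (s₁, T.A s₁ s) := T.step_iff.2 ⟨h1, h2, rfl, rfl⟩

theorem bounce_eq {s s₁ r : ℝ} (h1 : s < s₁) (h2 : s₁ < s + T.L) (h3 : r = -T.A s s₁) :
    T.bounce (s, r) = s₁ := by
  subst h3
  have h : (s, -T.A s s₁) ∈ T.dom := ⟨_, step_of_A h1 h2⟩
  obtain ⟨h4, h5, h6⟩ := bounce_spec h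
  exact (T.A_strictAntiOn s).injOn ⟨h4, h5⟩ ⟨h1, h2⟩ (by simpa using h6.symm)

theorem bounce_eq_of_step {z z₁ : ℝ × ℝ} (h : T.Step z z₁) : T.bounce z = z₁.1 := by
  obtain ⟨s, r⟩ := z
  obtain ⟨s₁, r₁⟩ := z₁
  obtain ⟨h1, h2, h3, -⟩ := T.step_iff.1 h
  exact bounce_eq h1 h2 h3

theorem step_bounce {z : ℝ × ℝ} (h : z ∈ T.dom) :
    T.Step z (T.bounce z, T.A (T.bounce z) z.1) := by
  obtain ⟨h1, h2, h3⟩ := bounce_spec h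
  exact T.step_iff.2 ⟨h1, h2, h3, rfl⟩

theorem step_unique {z z₁ z₂ : ℝ × ℝ} (h1 : T.Step z z₁) (h2 : T.Step z z₂) : z₁ = z₂ := by
  have e := (bounce_eq_of_step h1).symm.trans (bounce_eq_of_step h2)
  obtain ⟨s, r⟩ := z
  obtain ⟨s₁, r₁⟩ := z₁
  obtain ⟨s₂, r₂⟩ := z₂
  have e1 := (T.step_iff.1 h1).2.2.2
  have e2 := (T.step_iff.1 h2).2.2.2
  simp only at e
  subst e
  rw [e1, e2]

theorem mem_dom_iff {s r : ℝ} : (s, r) ∈ T.dom ↔ ∃ s₁ ∈ Ioo s (s + T.L), r = -T.A s s₁ := by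
  constructor
  · intro h
    obtain ⟨h1, h2, h3⟩ := bounce_spec h
    exact ⟨_, ⟨h1, h2⟩, h3⟩
  · rintro ⟨s₁, ⟨h1, h2⟩, rfl⟩
    exact ⟨_, step_of_A h1 h2⟩

/-- Time reversal `r ↦ -r`. The old starting point is lifted to `s + L` so that it lies ahead of
`s₁` by less than one turn. This turns facts about images into facts about preimages. -/
theorem step_reverse {s r s₁ r₁ : ℝ} (h : T.Step (s, r) (s₁, r₁)) :
    T.Step (s₁, -r₁) (s + T.L, -r) := by
  rw [step_iff] at h ⊢
  obtain ⟨h1, h2, h3, h4⟩ := h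
  refine ⟨h2, by linarith, ?_, ?_⟩
  · rw [T.A_add_right, h4]
  · rw [T.A_add_left, h3, neg_neg]

theorem step_add {s r s₁ r₁ : ℝ} (h : T.Step (s, r) (s₁, r₁)) :
    T.Step (s + T.L, r) (s₁ + T.L, r₁) := by
  rw [step_iff] at h ⊢
  obtain ⟨h1, h2, h3, h4⟩ := h
  refine ⟨by linarith, by linarith, ?_, ?_⟩
  · rw [T.A_add_right, T.A_add_left, h3]
  · rw [T.A_add_right, T.A_add_left, h4]

theorem step_unique_left {z z' z₁ : ℝ × ℝ} (h1 : T.Step z z₁) (h2 : T.Step z' z₁) : z = z' := by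
  have h := step_unique (step_reverse h1) (step_reverse h2)
  simp only [Prod.mk.injEq, add_left_inj, neg_inj] at h
  exact Prod.ext h.1 h.2

theorem bounce_lt_bounce {s r r' : ℝ} (h : (s, r) ∈ T.dom) (h' : (s, r') ∈ T.dom) (hr : r < r') :
    T.bounce (s, r) < T.bounce (s, r') := by
  obtain ⟨h1, h2, h3⟩ := bounce_spec h
  obtain ⟨h4, h5, h6⟩ := bounce_spec h'
  by_contra! hc
  have := (T.A_strictAntiOn s).antitoneOn ⟨h4, h5⟩ ⟨h1, h2⟩ hc
  simp only at h3 h6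
  linarith

theorem bounce_le_bounce {s r r' : ℝ} (h : (s, r) ∈ T.dom) (h' : (s, r') ∈ T.dom) (hr : r ≤ r') :
    T.bounce (s, r) ≤ T.bounce (s, r') := by
  rcases hr.eq_or_lt with e | e
  · rw [e]
  · exact (bounce_lt_bounce h h' e).le

/-- Intermediate values of `A s`. This keeps any graph squeezed between two invariant graphs inside
the domain of the map. -/
theorem dom_vertical {s r r' x : ℝ} (h : (s, r) ∈ T.dom) (h' : (s, r') ∈ T.dom)
    (h1 : r ≤ x) (h2 : x ≤ r') : (s, x) ∈ T.dom := by
  obtain ⟨a1, a2, a3⟩ := bounce_spec h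
  obtain ⟨b1, b2, b3⟩ := bounce_spec h'
  have hle := bounce_le_bounce h h' (h1.trans h2)
  have hc : ContinuousOn (fun u => -T.A s u) (Icc (T.bounce (s, r)) (T.bounce (s, r'))) := by
    intro u hu
    exact (T.hasDerivAt_A_right (T.curve_ne (lt_of_lt_of_le a1 hu.1)
      (lt_of_le_of_lt hu.2 b2))).continuousAt.neg.continuousWithinAt
  simp only at a3 b3
  obtain ⟨u, hu, hue⟩ := intermediate_value_Icc hle hc ⟨a3 ▸ h1, b3 ▸ h2⟩
  exact mem_dom_iff.2 ⟨u, ⟨lt_of_lt_of_le a1 hu.1, lt_of_le_of_lt hu.2 b2⟩, hue.symm⟩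

theorem abs_lt_one_of_mem_dom {s r : ℝ} (h : (s, r) ∈ T.dom) : |r| < 1 := by
  obtain ⟨u, hu, rfl⟩ := mem_dom_iff.1 h
  rw [abs_neg]
  exact T.abs_A_lt_one hu.1 hu.2

/-- Near a phase point with an image, there are images near the image. -/
theorem eventually_mem_dom_bounce {z : ℝ × ℝ} (h : z ∈ T.dom) {a b : ℝ} (ha : a < T.bounce z)
    (hb : T.bounce z < b) : ∀ᶠ w in 𝓝 z, w ∈ T.dom ∧ a < T.bounce w ∧ T.bounce w < b := by
  obtain ⟨s, r⟩ := z
  obtain ⟨h1, h2, h3⟩ := bounce_spec h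
  set u := T.bounce (s, r) with hu
  simp only at h1 h2 h3
  obtain ⟨a', ha1, ha2⟩ := exists_between (max_lt ha h1)
  obtain ⟨b', hb1, hb2⟩ := exists_between (lt_min hb h2)
  rw [max_lt_iff] at ha1
  rw [lt_min_iff] at hb2
  have hA : -T.A s a' < r := by
    rw [h3]; exact neg_lt_neg (T.A_lt ha1.2 ha2 h2)
  have hB : r < -T.A s b' := by
    rw [h3]; exact neg_lt_neg (T.A_lt h1 hb1 hb2.2)
  have t1 : Tendsto (fun w : ℝ × ℝ => -T.A w.1 a') (𝓝 (s, r)) (𝓝 (-T.A s a')) :=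
    (T.tendsto_A (T.curve_ne ha1.2 (ha2.trans h2)) (continuous_fst.tendsto (s, r))
      tendsto_const_nhds).neg
  have t2 : Tendsto (fun w : ℝ × ℝ => -T.A w.1 b') (𝓝 (s, r)) (𝓝 (-T.A s b')) :=
    (T.tendsto_A (T.curve_ne (h1.trans hb1) hb2.2) (continuous_fst.tendsto (s, r))
      tendsto_const_nhds).neg
  have t3 := continuous_snd.tendsto (s, r)
  have t4 := continuous_fst.tendsto (s, r)
  have t5 : Tendsto (fun w : ℝ × ℝ => w.1 + T.L) (𝓝 (s, r)) (𝓝 (s + T.L)) :=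
    t4.add_const T.L
  filter_upwards [t1.eventually_lt t3 hA, t3.eventually_lt t2 hB,
    t4.eventually_lt_const ha1.2, t5.eventually_const_lt hb2.2] with w w1 w2 w3 w4
  obtain ⟨x, y⟩ := w
  simp only at w1 w2 w3 w4
  have hab : a' < b' := ha2.trans hb1
  have d1 : (x, -T.A x a') ∈ T.dom := mem_dom_iff.2 ⟨a', ⟨w3, hab.trans w4⟩, rfl⟩
  have d2 : (x, -T.A x b') ∈ T.dom := mem_dom_iff.2 ⟨b', ⟨w3.trans hab, w4⟩, rfl⟩
  have d3 := dom_vertical d1 d2 w1.le w2.le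
  have e1 := bounce_lt_bounce d1 d3 w1
  have e2 := bounce_lt_bounce d3 d2 w2
  rw [bounce_eq w3 (hab.trans w4) rfl] at e1
  rw [bounce_eq (w3.trans hab) w4 rfl] at e2
  exact ⟨d3, ha1.1.trans e1, e2.trans hb2.1⟩

theorem dom_mem_nhds {z : ℝ × ℝ} (h : z ∈ T.dom) : T.dom ∈ 𝓝 z := by
  filter_upwards [eventually_mem_dom_bounce h (sub_one_lt _) (lt_add_one _)] with w hw using hw.1

theorem continuousAt_bounce {z : ℝ × ℝ} (h : z ∈ T.dom) : ContinuousAt T.bounce z := by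
  refine tendsto_order.2 ⟨fun a ha => ?_, fun b hb => ?_⟩
  · filter_upwards [eventually_mem_dom_bounce h ha (lt_add_one _)] with w hw using hw.2.1
  · filter_upwards [eventually_mem_dom_bounce h (sub_one_lt _) hb] with w hw using hw.2.2

/-! ### Invariant graphs -/

variable (T) in
/-- The dynamics which the billiard map induces on the graph of `f`. -/
noncomputable def dyn (f : ℝ → ℝ) (s : ℝ) : ℝ := T.bounce (s, f s)

namespace IsInvariantGraph

variable {f f₁ f₂ : ℝ → ℝ}

theorem step (hf : T.IsInvariantGraph f) (s : ℝ) :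
    T.Step (s, f s) (T.dyn f s, f (T.dyn f s)) := by
  obtain ⟨s₁, h⟩ := hf.2.2 s
  rw [dyn, bounce_eq_of_step h]
  exact h

theorem mem_dom (hf : T.IsInvariantGraph f) (s : ℝ) : (s, f s) ∈ T.dom := ⟨_, hf.step s⟩

theorem lt_dyn (hf : T.IsInvariantGraph f) (s : ℝ) : s < T.dyn f s := (T.step_iff.1 (hf.step s)).1

theorem dyn_lt (hf : T.IsInvariantGraph f) (s : ℝ) : T.dyn f s < s + T.L :=
  (T.step_iff.1 (hf.step s)).2.1

theorem eq_neg_A (hf : T.IsInvariantGraph f) (s : ℝ) : f s = -T.A s (T.dyn f s) :=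
  (T.step_iff.1 (hf.step s)).2.2.1

theorem dyn_eq_A (hf : T.IsInvariantGraph f) (s : ℝ) : f (T.dyn f s) = T.A (T.dyn f s) s :=
  (T.step_iff.1 (hf.step s)).2.2.2

theorem dyn_ne (hf : T.IsInvariantGraph f) (s : ℝ) : T.γ (T.dyn f s) ≠ T.γ s :=
  T.curve_ne (hf.lt_dyn s) (hf.dyn_lt s)

theorem dyn_eq_of_step (hf : T.IsInvariantGraph f) {s s₁ r₁ : ℝ} (h : T.Step (s, f s) (s₁, r₁)) :
    T.dyn f s = s₁ ∧ f s₁ = r₁ := by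
  have := step_unique (hf.step s) h
  rw [Prod.mk.injEq] at this
  obtain ⟨h1, h2⟩ := this
  rw [h1] at h2
  exact ⟨h1, h2⟩

theorem continuous_dyn (hf : T.IsInvariantGraph f) : Continuous (T.dyn f) :=
  continuous_iff_continuousAt.2 fun s =>
    ContinuousAt.comp (f := fun s => (s, f s)) (continuousAt_bounce (hf.mem_dom s))
      (continuousAt_id.prodMk hf.1.continuousAt)

theorem dyn_add (hf : T.IsInvariantGraph f) (s : ℝ) : T.dyn f (s + T.L) = T.dyn f s + T.L := by
  have h := step_add (hf.step s)
  rw [← hf.2.1 s] at h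
  exact (hf.dyn_eq_of_step h).1

theorem injective_dyn (hf : T.IsInvariantGraph f) : Function.Injective (T.dyn f) := by
  intro a b h
  have h1 := hf.step a
  have h2 := hf.step b
  rw [h] at h1
  exact congrArg Prod.fst (step_unique_left h1 h2)

theorem strictMono_dyn (hf : T.IsInvariantGraph f) : StrictMono (T.dyn f) := by
  rcases hf.continuous_dyn.strictMono_of_inj hf.injective_dyn with h | h
  · exact h
  · have h1 := h (lt_add_of_pos_right 0 T.L_pos)
    rw [hf.dyn_add] at h1
    linarith [T.L_pos]

theorem surjective_dyn (hf : T.IsInvariantGraph f) : Function.Surjective (T.dyn f) := by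
  intro y
  have h1 := hf.dyn_lt (y - T.L)
  have h2 := hf.lt_dyn y
  obtain ⟨x, -, hx⟩ := intermediate_value_Icc (sub_le_self y T.L_pos.le)
    hf.continuous_dyn.continuousOn ⟨by linarith, h2.le⟩
  exact ⟨x, hx⟩

theorem neg_mem_dom (hf : T.IsInvariantGraph f) (s : ℝ) : (s, -f s) ∈ T.dom := by
  obtain ⟨x, rfl⟩ := hf.surjective_dyn s
  exact ⟨_, step_reverse (hf.step x)⟩

theorem abs_lt_one (hf : T.IsInvariantGraph f) (s : ℝ) : |f s| < 1 :=
  abs_lt_one_of_mem_dom (hf.mem_dom s)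

/-- The billiard map preserves the region above an invariant graph and moves its points to the
right of the dynamics on the graph. -/
theorem above_step (hf : T.IsInvariantGraph f) {s r s₁ r₁ : ℝ} (h : T.Step (s, r) (s₁, r₁))
    (hr : f s < r) : T.dyn f s < s₁ ∧ f s₁ < r₁ := by
  have h1 : T.dyn f s < s₁ := by
    have := bounce_lt_bounce (hf.mem_dom s) ⟨_, h⟩ hr
    rwa [bounce_eq_of_step h] at this
  obtain ⟨-, h2, -, h4⟩ := T.step_iff.1 h
  refine ⟨h1, ?_⟩
  -- The graph point over `s₁` comes from some `x > s`, and by the twist a later previous bounce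
  -- means a smaller incoming `r`.
  obtain ⟨x, rfl⟩ := hf.surjective_dyn s₁
  have h5 := hf.strictMono_dyn.lt_iff_lt.1 h1
  rw [hf.dyn_eq_A x, h4]
  exact T.A_lt' (by linarith) h5 (hf.lt_dyn x)

theorem dyn_iterate_add (hf : T.IsInvariantGraph f) (n : ℕ) (s : ℝ) :
    (T.dyn f)^[n] (s + T.L) = (T.dyn f)^[n] s + T.L := by
  induction n generalizing s with
  | zero => rfl
  | succ n ih => rw [Function.iterate_succ_apply, hf.dyn_add, ih, Function.iterate_succ_apply]

theorem dyn_iterate_add_int (hf : T.IsInvariantGraph f) (n : ℕ) (m : ℤ) (s : ℝ) :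
    (T.dyn f)^[n] (s + m * T.L) = (T.dyn f)^[n] s + m * T.L := by
  have h : Function.Periodic (fun s => (T.dyn f)^[n] s - s) T.L := by
    intro s
    simp only [hf.dyn_iterate_add]
    ring
  have := h.int_mul m s
  linarith

theorem dyn_le_dyn (h₁ : T.IsInvariantGraph f₁) (h₂ : T.IsInvariantGraph f₂)
    {s : ℝ} (h : f₁ s ≤ f₂ s) : T.dyn f₁ s ≤ T.dyn f₂ s :=
  bounce_le_bounce (h₁.mem_dom s) (h₂.mem_dom s) h

theorem dyn_eq_dyn_iff (h₁ : T.IsInvariantGraph f₁) (h₂ : T.IsInvariantGraph f₂) {s : ℝ} :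
    T.dyn f₁ s = T.dyn f₂ s ↔ f₁ s = f₂ s := by
  constructor
  · intro h
    rw [h₁.eq_neg_A, h₂.eq_neg_A, h]
  · intro h
    rw [dyn, dyn, h]

theorem iterate_dyn_le (h₁ : T.IsInvariantGraph f₁) (h₂ : T.IsInvariantGraph f₂)
    (h : ∀ s, f₁ s ≤ f₂ s) (n : ℕ) (s : ℝ) : (T.dyn f₁)^[n] s ≤ (T.dyn f₂)^[n] s :=
  h₁.strictMono_dyn.monotone.iterate_le_of_le (fun s => h₁.dyn_le_dyn h₂ (h s)) n s

/-- If `f₁ < f₂` at `s`, then the orbits of `s` separate. -/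
theorem iterate_dyn_lt (h₁ : T.IsInvariantGraph f₁) (h₂ : T.IsInvariantGraph f₂) {s : ℝ}
    (h : f₁ s < f₂ s) (n : ℕ) : (T.dyn f₁)^[n + 1] s < (T.dyn f₂)^[n + 1] s ∧
      f₁ ((T.dyn f₂)^[n + 1] s) < f₂ ((T.dyn f₂)^[n + 1] s) := by
  induction n with
  | zero => exact h₁.above_step (h₂.step s) h
  | succ n ih =>
    rw [Function.iterate_succ_apply' _ (n + 1), Function.iterate_succ_apply' _ (n + 1)]
    obtain ⟨h3, h4⟩ := h₁.above_step (h₂.step _) ih.2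
    exact ⟨(h₁.strictMono_dyn ih.1).trans h3, h4⟩

theorem iterate_dyn_eq (h₁ : T.IsInvariantGraph f₁) (h₂ : T.IsInvariantGraph f₂) {s : ℝ}
    (h : f₁ s = f₂ s) (n : ℕ) : (T.dyn f₁)^[n] s = (T.dyn f₂)^[n] s ∧
      f₁ ((T.dyn f₁)^[n] s) = f₂ ((T.dyn f₁)^[n] s) := by
  induction n with
  | zero => exact ⟨rfl, h⟩
  | succ n ih =>
    rw [Function.iterate_succ_apply', Function.iterate_succ_apply']
    have e := (h₁.dyn_eq_dyn_iff h₂).2 ih.2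
    refine ⟨by rw [e, ih.1], ?_⟩
    rw [h₁.dyn_eq_A, e, h₂.dyn_eq_A]

end IsInvariantGraph

/-! ### The region between two graphs -/

/-- Along a path which avoids the graph, `r - f s` cannot change sign; conversely a vertical segment
joins the point to the top edge. -/
theorem above_graph {f : ℝ → ℝ} (hf : Continuous f) (h1 : ∀ s, |f s| < 1) :
    above (graph f) = {z ∈ strip | f z.1 < z.2} := by
  ext ⟨s, r⟩
  constructor
  · rintro ⟨s', hj⟩
    obtain ⟨hj1, hj2⟩ := hj.source_mem
    refine ⟨hj1, ?_⟩
    obtain ⟨p, hp⟩ := hj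
    by_contra! hc
    have hcont : Continuous fun t => (p t).2 - f (p t).1 := by fun_prop
    have : (0 : ℝ) ∈ (fun t => (p t).2 - f (p t).1) '' univ := by
      refine isPreconnected_univ.intermediate_value (mem_univ 0) (mem_univ 1)
        hcont.continuousOn ⟨?_, ?_⟩
      · simpa using hc
      · simpa using (abs_lt.1 (h1 s')).2.le
    obtain ⟨t, -, ht⟩ := this
    exact (hp t).2 (sub_eq_zero.1 ht)
  · rintro ⟨⟨h2, h3⟩, h4⟩
    simp only at h2 h3 h4
    have hc : Convex ℝ (Icc r 1) := convex_Icc _ _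
    have hj := (hc.isPathConnected ⟨r, le_rfl, h3⟩).joinedIn r ⟨le_rfl, h3⟩ 1 ⟨h3, le_rfl⟩
    obtain ⟨p, hp⟩ := hj
    refine ⟨s, (Path.refl s).prod p, ?_⟩
    intro t
    have := hp t
    refine ⟨⟨?_, ?_⟩, ?_⟩
    · simpa using h2.trans this.1
    · simpa using this.2
    · have h5 := lt_of_lt_of_le h4 this.1
      simpa [graph] using h5.ne'

theorem below_graph {f : ℝ → ℝ} (hf : Continuous f) (h1 : ∀ s, |f s| < 1) :
    below (graph f) = {z ∈ strip | z.2 < f z.1} := by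
  ext ⟨s, r⟩
  constructor
  · rintro ⟨s', hj⟩
    obtain ⟨hj1, hj2⟩ := hj.source_mem
    refine ⟨hj1, ?_⟩
    obtain ⟨p, hp⟩ := hj
    by_contra! hc
    have hcont : Continuous fun t => (p t).2 - f (p t).1 := by fun_prop
    have : (0 : ℝ) ∈ (fun t => (p t).2 - f (p t).1) '' univ := by
      refine isPreconnected_univ.intermediate_value (mem_univ 1) (mem_univ 0)
        hcont.continuousOn ⟨?_, ?_⟩
      · have := (abs_lt.1 (h1 s')).1
        simp only [Path.target]
        linarith
      · simpa using hc
    obtain ⟨t, -, ht⟩ := this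
    exact (hp t).2 (sub_eq_zero.1 ht)
  · rintro ⟨⟨h2, h3⟩, h4⟩
    simp only at h2 h3 h4
    have hc : Convex ℝ (Icc (-1) r) := convex_Icc _ _
    have hj := (hc.isPathConnected ⟨r, h2, le_rfl⟩).joinedIn r ⟨h2, le_rfl⟩ (-1) ⟨le_rfl, h2⟩
    obtain ⟨p, hp⟩ := hj
    refine ⟨s, (Path.refl s).prod p, ?_⟩
    intro t
    have := hp t
    refine ⟨⟨?_, ?_⟩, ?_⟩
    · simpa using this.1
    · simpa using this.2.trans h3
    · have h5 := lt_of_le_of_lt this.2 h4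
      simpa [graph] using h5.ne

theorem mem_between_graph {f₁ f₂ : ℝ → ℝ} (h₁ : T.IsInvariantGraph f₁)
    (h₂ : T.IsInvariantGraph f₂) (z : ℝ × ℝ) :
    z ∈ between (graph f₁) (graph f₂) ↔ f₁ z.1 ≤ z.2 ∧ z.2 ≤ f₂ z.1 := by
  have a1 := abs_lt.1 (h₁.abs_lt_one z.1)
  have a2 := abs_lt.1 (h₂.abs_lt_one z.1)
  unfold between
  rw [below_graph h₁.1 h₁.abs_lt_one, above_graph h₂.1 h₂.abs_lt_one]
  simp only [strip, mem_ofPred_eq, not_and, not_lt]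
  constructor
  · rintro ⟨h3, h4, h5⟩
    exact ⟨h4 h3, h5 h3⟩
  · rintro ⟨h3, h4⟩
    exact ⟨⟨by linarith, by linarith⟩, fun _ => h3, fun _ => h4⟩

/-! ### Rotation curves are graphs -/

/-- The orbits on the graph of `f` have rotation number `ω`, with uniformly bounded deviation. -/
def HasRot (T : ConvexTable k) (f : ℝ → ℝ) (ω : ℝ) : Prop :=
  ∀ (n : ℕ) (s : ℝ), |(T.dyn f)^[n] s - s - n * ω * T.L| ≤ T.L

/-- A rotation curve projects homeomorphically to the boundary of the table. -/
theorem strictMono_of_rotation {h : ℝ → ℝ × ℝ} {ρ : ℝ} (hc : Continuous h)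
    (hi : Function.Injective h) (h1 : ∀ t, h (t + 1) = h t + (T.L, 0))
    (hs : ∀ t, T.Step (h t) (h (t + ρ))) : StrictMono fun t => (h t).1 := by
  set x : ℝ → ℝ := fun t => (h t).1 with hx
  have hxc : Continuous x := continuous_fst.comp hc
  have hx1 : ∀ t, x (t + 1) = x t + T.L := fun t => by simp only [hx, h1]; rfl
  have hst : ∀ t, x t < x (t + ρ) ∧ x (t + ρ) < x t + T.L ∧ (h t).2 = -T.A (x t) (x (t + ρ)) ∧
      (h (t + ρ)).2 = T.A (x (t + ρ)) (x t) := fun t => T.step_iff.1 (hs t)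
  -- The shifts which move every point of the curve strictly to the right. This set contains `1` and
  -- is open, and it is closed relative to `(0, ∞)`; connectedness then gives all positive shifts.
  let D : Set ℝ := {d | ∀ t, x t < x (t + d)}
  have hD : ∀ d, (∀ t ∈ Icc (0 : ℝ) 1, x t < x (t + d)) → d ∈ D := by
    intro d hd t
    have hp : Function.Periodic (fun t => x (t + d) - x t) 1 := by
      intro t
      simp only [hx1, show t + 1 + d = t + d + 1 by ring]
      ring
    obtain ⟨y, hy, hye⟩ := hp.exists_mem_Ico₀ zero_lt_one t
    have := hd y (Ico_subset_Icc_self hy)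
    linarith
  have hDo : IsOpen D := by
    rw [isOpen_iff_mem_nhds]
    intro d hd
    have : ∀ᶠ d' in 𝓝 d, ∀ t ∈ Icc (0 : ℝ) 1, x t < x (t + d') := by
      refine isCompact_Icc.eventually_forall_of_forall_eventually fun t _ => ?_
      have c1 : Continuous fun z : ℝ × ℝ => x z.2 := by fun_prop
      have c2 : Continuous fun z : ℝ × ℝ => x (z.2 + z.1) := by fun_prop
      exact (c1.tendsto (d, t)).eventually_lt (c2.tendsto (d, t)) (hd t)
    filter_upwards [this] with d' hd' using hD d' hd'
  have hne : (Ioi (0 : ℝ) ∩ D).Nonempty := ⟨1, mem_Ioi.2 zero_lt_one, fun t => by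
    rw [hx1]; exact lt_add_of_pos_right _ T.L_pos⟩
  have hcl : closure D ∩ Ioi 0 ⊆ D := by
    rintro d ⟨hd, hd0⟩ t
    have hle : ∀ t, x t ≤ x (t + d) := by
      have hcl' : IsClosed {d | ∀ t, x t ≤ x (t + d)} := by
        simp only [ofPred_forall]
        exact isClosed_iInter fun t => isClosed_le continuous_const (by fun_prop)
      exact closure_minimal (fun d hd t => (hd t).le) hcl' hd
    -- Suppose the curve and its shift touch over one base point. The order of the next bounces and
    -- the order of the previous bounces give opposite inequalities between the `r`-coordinates, so
    -- two phase points agree, against injectivity.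
    refine lt_of_le_of_ne (hle t) fun he => ?_
    obtain ⟨a1, a2, a3, -⟩ := hst t
    obtain ⟨b1, b2, b3, -⟩ := hst (t + d)
    obtain ⟨c1, c2, -, c3⟩ := hst (t - ρ)
    obtain ⟨d1, d2, -, d3⟩ := hst (t + d - ρ)
    rw [sub_add_cancel] at c1 c2 c3 d1 d2 d3
    rw [← he] at b1 b2 b3 d1 d2 d3
    have e1 : x (t + ρ) ≤ x (t + d + ρ) := by
      have := hle (t + ρ); rwa [show t + ρ + d = t + d + ρ by ring] at this
    have e2 : x (t - ρ) ≤ x (t + d - ρ) := by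
      have := hle (t - ρ); rwa [show t - ρ + d = t + d - ρ by ring] at this
    have f1 : (h t).2 ≤ (h (t + d)).2 := by
      rw [a3, b3]
      exact neg_le_neg ((T.A_strictAntiOn _).antitoneOn ⟨a1, a2⟩ ⟨b1, b2⟩ e1)
    have f2 : (h (t + d)).2 ≤ (h t).2 := by
      rw [c3, d3]
      rcases e2.eq_or_lt with e | e
      · rw [e]
      · exact (T.A_lt' (by linarith) e d1).le
    have := hi (Prod.ext he (le_antisymm f1 f2) : h t = h (t + d))
    have hd0' : 0 < d := hd0
    linarith
  have hsub := isPreconnected_Ioi.subset_of_closure_inter_subset hDo hne hcl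
  intro a b hab
  have := hsub (show (0 : ℝ) < b - a by linarith) a
  rwa [add_sub_cancel] at this

theorem surjective_of_add_one {x : ℝ → ℝ} {L : ℝ} (hL : 0 < L) (hx : Continuous x)
    (hx1 : ∀ t, x (t + 1) = x t + L) : Function.Surjective x := by
  intro y
  have hp : Function.Periodic (fun t => x t - t * L) 1 := fun t => by simp only [hx1]; ring
  obtain ⟨n, hn⟩ := exists_nat_gt (|y - x 0| / L)
  rw [div_lt_iff₀ hL, abs_lt] at hn
  have e1 := hp.nat_mul n 0
  have e2 := hp.int_mul (-n) 0
  simp only [zero_add, zero_mul, sub_zero, mul_one] at e1 e2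
  push_cast at e2
  obtain ⟨t, -, ht⟩ := intermediate_value_Icc (a := -(n : ℝ)) (b := n)
    (by linarith [(Nat.cast_nonneg n : (0 : ℝ) ≤ n)]) hx.continuousOn
    (show y ∈ Icc _ _ from ⟨by linarith, by linarith⟩)
  exact ⟨t, ht⟩

theorem abs_sub_le_of_add_one {x : ℝ → ℝ} {L : ℝ} (hL : 0 < L) (hx : Monotone x)
    (hx1 : ∀ t, x (t + 1) = x t + L) (t a : ℝ) : |x (t + a) - x t - a * L| ≤ L := by
  have hp : Function.Periodic (fun t => x t - t * L) 1 := fun t => by simp only [hx1]; ring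
  have e1 := hp.int_mul ⌊a⌋ t
  have e2 := hp.int_mul (⌊a⌋ + 1) t
  simp only [mul_one] at e1 e2
  push_cast at e2
  have f1 := Int.floor_le a
  have f2 := (Int.lt_floor_add_one a).le
  have g1 := hx (show t + ⌊a⌋ ≤ t + a by linarith)
  have g2 := hx (show t + a ≤ t + (⌊a⌋ + 1) by linarith)
  have m1 := mul_le_mul_of_nonneg_right f1 hL.le
  have m2 := mul_le_mul_of_nonneg_right f2 hL.le
  rw [abs_le]
  constructor <;> nlinarith

/-- A rotation curve is an invariant graph, and the dynamics on it is that of a rotation. -/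
theorem IsRotationCurve.exists_graph {Γ : Set (ℝ × ℝ)} {ρ : ℚ} (h : T.IsRotationCurve Γ ρ) :
    ∃ f, T.IsInvariantGraph f ∧ Γ = graph f ∧ T.HasRot f ρ ∧
      ∀ s, (T.dyn f)^[ρ.den] s = s + ρ.num * T.L := by
  obtain ⟨h, hc, hi, hr, h1, hs⟩ := h
  have hmono := strictMono_of_rotation hc hi h1 hs
  set x : ℝ → ℝ := fun t => (h t).1 with hx
  have hxc : Continuous x := continuous_fst.comp hc
  have hx1 : ∀ t, x (t + 1) = x t + T.L := fun t => by simp only [hx, h1]; rfl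
  have hy1 : ∀ t, (h (t + 1)).2 = (h t).2 := fun t => by simp [h1]
  have hsurj := surjective_of_add_one T.L_pos hxc hx1
  let e := hmono.orderIsoOfSurjective x hsurj
  have hex : ∀ t, e.symm (x t) = t := fun t => e.symm_apply_apply t
  have hfx : ∀ t, (fun s => (h (e.symm s)).2) (x t) = (h t).2 := fun t => by
    simp only [hex]
  set f : ℝ → ℝ := fun s => (h (e.symm s)).2 with hf
  have hinv : T.IsInvariantGraph f := by
    refine ⟨continuous_snd.comp (hc.comp e.symm.continuous), ?_, ?_⟩
    · intro s
      obtain ⟨t, rfl⟩ := hsurj s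
      rw [← hx1, hfx, hfx, hy1]
    · intro s
      obtain ⟨t, rfl⟩ := hsurj s
      refine ⟨x (t + ρ), ?_⟩
      rw [hfx, hfx]
      exact hs t
  have hdyn : ∀ t, T.dyn f (x t) = x (t + ρ) := by
    intro t
    have h2 : T.Step (x t, f (x t)) (x (t + ρ), f (x (t + ρ))) := by
      rw [hfx, hfx]; exact hs t
    exact (hinv.dyn_eq_of_step h2).1
  have hit : ∀ (n : ℕ) t, (T.dyn f)^[n] (x t) = x (t + n * ρ) := by
    intro n
    induction n with
    | zero => intro t; simp
    | succ n ih =>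
      intro t
      rw [Function.iterate_succ_apply', ih, hdyn]
      push_cast
      congr 1; ring
  refine ⟨f, hinv, ?_, ?_, ?_⟩
  · rw [← hr]
    ext ⟨s, r⟩
    constructor
    · rintro ⟨t, ht⟩
      have e1 : x t = s := congrArg Prod.fst ht
      have e2 : (h t).2 = r := congrArg Prod.snd ht
      show r = f s
      rw [← e1, hfx, e2]
    · intro hz
      obtain ⟨t, rfl⟩ := hsurj s
      refine ⟨t, Prod.ext rfl ?_⟩
      have : r = f (x t) := hz
      rw [this, hfx]
  · intro n s
    obtain ⟨t, rfl⟩ := hsurj s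
    rw [hit]
    exact abs_sub_le_of_add_one T.L_pos hmono.monotone hx1 t _
  · intro s
    obtain ⟨t, rfl⟩ := hsurj s
    rw [hit]
    have : (ρ.den : ℝ) * (ρ : ℝ) = ρ.num := by
      exact_mod_cast Rat.den_mul_eq_num ρ
    rw [this]
    have hp : Function.Periodic (fun t => x t - t * T.L) 1 := fun t => by simp only [hx1]; ring
    have e1 := hp.int_mul ρ.num t
    simp only [mul_one] at e1
    linarith

end ConvexTable

/-! ### Primitives of periodic functions -/

theorem exists_add_const_of_periodic_deriv {w w' : ℝ → ℝ} {L : ℝ} (hw : ∀ s, HasDerivAt w (w' s) s)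
    (hp : Function.Periodic w' L) : ∃ δ, ∀ s, w (s + L) = w s + δ := by
  have h : ∀ s, HasDerivAt (fun s => w (s + L) - w s) 0 s := by
    intro s
    have h1 : HasDerivAt (fun s => w (s + L)) (w' (s + L)) s := (hw (s + L)).comp_add_const s L
    have h2 := h1.sub (hw s)
    rw [hp s, sub_self] at h2
    exact h2
  have hc := is_const_of_deriv_eq_zero (fun s => (h s).differentiableAt) fun s => (h s).deriv
  refine ⟨w (0 + L) - w 0, fun s => ?_⟩
  have := hc s 0
  linarith

theorem add_int_of_add_const {w : ℝ → ℝ} {L δ : ℝ} (hw : ∀ s, w (s + L) = w s + δ) (m : ℤ) (s : ℝ) :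
    w (s + m * L) = w s + m * δ := by
  rcases eq_or_ne L 0 with rfl | hL
  · have := hw 0
    simp only [add_zero] at this
    have : δ = 0 := by linarith
    simp [this]
  have h : Function.Periodic (fun s => w s - s / L * δ) L := by
    intro s
    simp only [hw]
    field_simp
    ring
  have := h.int_mul m s
  rw [add_div, mul_div_assoc, div_self hL] at this
  linarith

theorem nat_mul_le_of_step {w g : ℝ → ℝ} {κ : ℝ} (h : ∀ s, κ ≤ w (g s) - w s) (n : ℕ) (s : ℝ) :
    n * κ ≤ w (g^[n] s) - w s := by
  induction n with
  | zero => simp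
  | succ n ih =>
    rw [Function.iterate_succ_apply']
    push_cast
    linarith [h (g^[n] s)]

theorem le_nat_mul_of_step {w g : ℝ → ℝ} {κ : ℝ} (h : ∀ s, w (g s) - w s ≤ κ) (n : ℕ) (s : ℝ) :
    w (g^[n] s) - w s ≤ n * κ := by
  have := nat_mul_le_of_step (w := -w) (κ := -κ) (g := g) (fun s => by
    simp only [Pi.neg_apply]; linarith [h s]) n s
  simp only [Pi.neg_apply] at this
  linarith

theorem nonpos_of_forall_nat_mul_le {a C : ℝ} (h : ∀ n : ℕ, n * a ≤ C) : a ≤ 0 := by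
  by_contra! ha
  obtain ⟨n, hn⟩ := exists_nat_gt (C / a)
  rw [div_lt_iff₀ ha] at hn
  linarith [h n]

namespace ConvexTable

variable {k : ℕ∞} {T : ConvexTable k}

/-! ### Invariant graphs minimize the action -/

namespace IsInvariantGraph

variable {f f₁ f₂ : ℝ → ℝ}

/-- The derivative of `H s y - u y` in `y` is `A y s - f y`, and `f y = A y x` for the predecessor
`x` of `y` on the graph. By the twist its sign depends only on the side of `dyn f s` on which `y`
lies. -/
theorem action_lt (hf : T.IsInvariantGraph f) {u : ℝ → ℝ} (hu : ∀ s, HasDerivAt u (f s) s)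
    {s s' : ℝ} (h1 : s < s') (h2 : s' < s + T.L) (hne : s' ≠ T.dyn f s) :
    T.H s (T.dyn f s) - u (T.dyn f s) < T.H s s' - u s' := by
  have hd : ∀ y ∈ Ioo s (s + T.L), HasDerivAt (fun y => T.H s y - u y) (T.A y s - f y) y :=
    fun y hy => (T.hasDerivAt_H_right (T.curve_ne hy.1 hy.2)).sub (hu y)
  have hc : ∀ a b, s < a → b < s + T.L → ContinuousOn (fun y => T.H s y - u y) (Icc a b) :=
    fun a b ha hb y hy => (hd y ⟨lt_of_lt_of_le ha hy.1,
      lt_of_le_of_lt hy.2 hb⟩).continuousAt.continuousWithinAt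
  rcases lt_or_gt_of_ne hne with h | h
  · have : StrictAntiOn (fun y => T.H s y - u y) (Icc s' (T.dyn f s)) := by
      refine strictAntiOn_of_deriv_neg (convex_Icc _ _) (hc _ _ h1 (hf.dyn_lt s)) ?_
      intro y hy
      rw [interior_Icc] at hy
      rw [(hd y ⟨h1.trans hy.1, hy.2.trans (hf.dyn_lt s)⟩).deriv]
      obtain ⟨x, rfl⟩ := hf.surjective_dyn y
      have hx := hf.strictMono_dyn.lt_iff_lt.1 hy.2
      rw [hf.dyn_eq_A, sub_neg]
      exact T.A_lt' (by linarith [hf.dyn_lt x]) hx (h1.trans hy.1)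
    exact this (left_mem_Icc.2 h.le) (right_mem_Icc.2 h.le) h
  · have : StrictMonoOn (fun y => T.H s y - u y) (Icc (T.dyn f s) s') := by
      refine strictMonoOn_of_deriv_pos (convex_Icc _ _) (hc _ _ (hf.lt_dyn s) h2) ?_
      intro y hy
      rw [interior_Icc] at hy
      rw [(hd y ⟨(hf.lt_dyn s).trans hy.1, hy.2.trans h2⟩).deriv]
      obtain ⟨x, rfl⟩ := hf.surjective_dyn y
      have hx := hf.strictMono_dyn.lt_iff_lt.1 hy.1
      rw [hf.dyn_eq_A, sub_pos]
      exact T.A_lt' (by linarith [hy.2]) hx (hf.lt_dyn x)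
    exact this (left_mem_Icc.2 h.le) (right_mem_Icc.2 h.le) h

/-- Since `dyn f` is only known to be continuous, the expression is not differentiated directly.
Freezing the second bounce at `dyn f x` gives, by minimality, a majorant touching at `x`, whose
derivative there is `A x (dyn f x) + f x = 0`. So the right slopes are at most zero in the limit. -/
theorem action_antitone (hf : T.IsInvariantGraph f) {u : ℝ → ℝ} (hu : ∀ s, HasDerivAt u (f s) s) :
    Antitone fun s => T.H s (T.dyn f s) - u (T.dyn f s) + u s := by
  set m : ℝ → ℝ := fun s => T.H s (T.dyn f s) - u (T.dyn f s) + u s with hm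
  have huc : Continuous u := continuous_iff_continuousAt.2 fun s => (hu s).continuousAt
  have hgc := hf.continuous_dyn
  have hγ : Continuous T.γ := T.contDiff.continuous
  have hmc : Continuous m := by
    simp only [hm, H]
    fun_prop
  intro a b hab
  refine image_le_of_liminf_slope_right_le_deriv_boundary (f := m) (a := a) (b := b)
    (B := fun _ => m a) (B' := fun _ => 0) hmc.continuousOn le_rfl continuousOn_const
    (fun x _ => hasDerivWithinAt_const _ _ _) ?_ (right_mem_Icc.2 hab)
  intro x _ r hr
  have hφ : HasDerivAt (fun s => T.H s (T.dyn f x) + u s) 0 x := by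
    have := (T.hasDerivAt_H_left (hf.dyn_ne x)).add (hu x)
    rwa [hf.eq_neg_A x, add_neg_cancel] at this
  have h1 := (hasDerivAt_iff_tendsto_slope.1 hφ).mono_left
    (nhdsWithin_mono x (fun y (hy : x < y) => hy.ne'))
  have h2 : ∀ᶠ z in 𝓝[>] x, z < T.dyn f x :=
    mem_nhdsWithin_of_mem_nhds (Iio_mem_nhds (hf.lt_dyn x))
  refine Eventually.frequently ?_
  filter_upwards [h1.eventually (gt_mem_nhds hr), h2, self_mem_nhdsWithin] with z hz hz2 hz3
  have hz3' : x < z := hz3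
  refine lt_of_le_of_lt ?_ hz
  rw [slope_def_field, slope_def_field]
  refine div_le_div_of_nonneg_right ?_ (sub_pos.2 hz3').le
  have h3 : T.H z (T.dyn f z) - u (T.dyn f z) ≤ T.H z (T.dyn f x) - u (T.dyn f x) := by
    by_cases he : T.dyn f x = T.dyn f z
    · rw [he]
    · exact (hf.action_lt hu hz2 (by linarith [hf.dyn_lt x]) he).le
  simp only [hm]
  linarith

/-- The expression is periodic as well as antitone. -/
theorem action_const (hf : T.IsInvariantGraph f) {u : ℝ → ℝ} (hu : ∀ s, HasDerivAt u (f s) s) :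
    ∃ α, ∀ s, T.H s (T.dyn f s) - u (T.dyn f s) + u s = α := by
  obtain ⟨δ, hδ⟩ := exists_add_const_of_periodic_deriv hu hf.2.1
  have hanti := hf.action_antitone hu
  set m : ℝ → ℝ := fun s => T.H s (T.dyn f s) - u (T.dyn f s) + u s with hm
  have hp : Function.Periodic m T.L := by
    intro s
    simp only [hm, hf.dyn_add, T.H_add, hδ]
    ring
  refine ⟨m 0, fun s => ?_⟩
  obtain ⟨y, hy, hye⟩ := hp.exists_mem_Ico T.L_pos s 0
  obtain ⟨z, hz, hze⟩ := hp.exists_mem_Ico T.L_pos s (-T.L)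
  have h1 := hanti hy.1
  have h2 := hanti (show z ≤ 0 by linarith [hz.2])
  show m s = m 0
  linarith

/-- Here `w` measures the signed area between the graphs and `κ` is the difference of their action
constants. Each bound tests the minimality for one graph with the bounce of the other; strict
minimality gives the equality cases. -/
theorem exists_action (h₁ : T.IsInvariantGraph f₁) (h₂ : T.IsInvariantGraph f₂) :
    ∃ (w : ℝ → ℝ) (κ : ℝ), (∀ s, HasDerivAt w (f₂ s - f₁ s) s) ∧
      (∀ s, κ ≤ w (T.dyn f₂ s) - w s ∧ (w (T.dyn f₂ s) - w s = κ → f₁ s = f₂ s)) ∧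
      ∀ s, w (T.dyn f₁ s) - w s ≤ κ ∧ (w (T.dyn f₁ s) - w s = κ → f₁ s = f₂ s) := by
  have hu : ∀ f : ℝ → ℝ, Continuous f → ∀ s, HasDerivAt (fun s => ∫ x in (0 : ℝ)..s, f x) (f s) s :=
    fun f hf s => hf.integral_hasStrictDerivAt 0 s |>.hasDerivAt
  have hu₁ := hu f₁ h₁.1
  have hu₂ := hu f₂ h₂.1
  set u₁ : ℝ → ℝ := fun s => ∫ x in (0 : ℝ)..s, f₁ x
  set u₂ : ℝ → ℝ := fun s => ∫ x in (0 : ℝ)..s, f₂ x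
  obtain ⟨α₁, hα₁⟩ := h₁.action_const hu₁
  obtain ⟨α₂, hα₂⟩ := h₂.action_const hu₂
  refine ⟨fun s => u₂ s - u₁ s, α₁ - α₂, fun s => (hu₂ s).sub (hu₁ s), fun s => ?_, fun s => ?_⟩
  · have e1 := hα₁ s
    have e2 := hα₂ s
    by_cases he : T.dyn f₂ s = T.dyn f₁ s
    · rw [he] at e2 ⊢
      exact ⟨by linarith, fun _ => (h₁.dyn_eq_dyn_iff h₂).1 he.symm⟩
    · have := h₁.action_lt hu₁ (h₂.lt_dyn s) (h₂.dyn_lt s) he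
      exact ⟨by linarith, fun h => by linarith⟩
  · have e1 := hα₁ s
    have e2 := hα₂ s
    by_cases he : T.dyn f₁ s = T.dyn f₂ s
    · rw [he] at e1 ⊢
      exact ⟨by linarith, fun _ => (h₁.dyn_eq_dyn_iff h₂).1 he⟩
    · have := h₂.action_lt hu₂ (h₁.lt_dyn s) (h₁.dyn_lt s) he
      exact ⟨by linarith, fun h => by linarith⟩

/-! ### Rotation numbers of invariant graphs -/

/-- Disjoint ordered invariant graphs do not both have periodic orbits of the same type. -/
theorem not_both_periodic (h₁ : T.IsInvariantGraph f₁) (h₂ : T.IsInvariantGraph f₂)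
    (hlt : ∀ s, f₁ s < f₂ s) {q : ℕ} (hq : 0 < q) {p : ℤ} {s₁ s₂ : ℝ}
    (hs₁ : (T.dyn f₁)^[q] s₁ = s₁ + p * T.L) (hs₂ : (T.dyn f₂)^[q] s₂ = s₂ + p * T.L) : False := by
  obtain ⟨w, κ, hw, hw₂, hw₁⟩ := h₁.exists_action h₂
  obtain ⟨δ, hδ⟩ := exists_add_const_of_periodic_deriv hw (h₂.2.1.sub h₁.2.1)
  obtain ⟨q, rfl⟩ := Nat.exists_eq_succ_of_ne_zero hq.ne'
  -- Over one period `w` changes by `p δ` along both orbits, while the gains are strictly less than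
  -- `κ` per period step on one graph and strictly more on the other. Strictness at the first step
  -- suffices.
  have a1 : w ((T.dyn f₁)^[q + 1] s₁) - w s₁ < (q + 1 : ℕ) * κ := by
    have h3 := le_nat_mul_of_step (fun s => (hw₁ s).1) q (T.dyn f₁ s₁)
    have h4 : w (T.dyn f₁ s₁) - w s₁ < κ :=
      lt_of_le_of_ne (hw₁ s₁).1 fun he => (hlt s₁).ne ((hw₁ s₁).2 he)
    rw [Function.iterate_succ_apply]
    push_cast
    linarith
  have a2 : (q + 1 : ℕ) * κ < w ((T.dyn f₂)^[q + 1] s₂) - w s₂ := by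
    have h3 := nat_mul_le_of_step (fun s => (hw₂ s).1) q (T.dyn f₂ s₂)
    have h4 : κ < w (T.dyn f₂ s₂) - w s₂ :=
      lt_of_le_of_ne (hw₂ s₂).1 fun he => (hlt s₂).ne ((hw₂ s₂).2 he.symm)
    rw [Function.iterate_succ_apply]
    push_cast
    linarith
  rw [Nat.succ_eq_add_one] at hs₁ hs₂
  rw [hs₁, add_int_of_add_const hδ] at a1
  rw [hs₂, add_int_of_add_const hδ] at a2
  linarith

/-- After `n` periods the deviation from the rotation is `n` times a fixed number, yet bounded. -/
theorem rot_of_periodic (hf : T.IsInvariantGraph f) {ω : ℝ} (hω : T.HasRot f ω) {q : ℕ} {p : ℤ}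
    {s : ℝ} (hs : (T.dyn f)^[q] s = s + p * T.L) : q * ω = p := by
  have hit : ∀ n : ℕ, (T.dyn f)^[q * n] s = s + n * p * T.L := by
    intro n
    induction n with
    | zero => simp
    | succ n ih =>
      rw [Nat.mul_succ, Nat.add_comm, Function.iterate_add_apply, ih]
      have := hf.dyn_iterate_add_int q (n * p) s
      push_cast at this ⊢
      rw [this, hs]
      ring
  have hb : ∀ n : ℕ, |n * (p - q * ω)| ≤ 1 := by
    intro n
    have := hω (q * n) s
    rw [hit] at this
    push_cast at this
    rw [show s + n * p * T.L - s - q * n * ω * T.L = n * (p - q * ω) * T.L by ring, abs_mul,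
      abs_of_pos T.L_pos] at this
    exact le_of_mul_le_mul_right (by rwa [one_mul]) T.L_pos
  have h1 := nonpos_of_forall_nat_mul_le fun n => (abs_le.1 (hb n)).2
  have h2 := nonpos_of_forall_nat_mul_le (a := -(p - q * ω)) (C := 1) fun n => by
    linarith [(abs_le.1 (hb n)).1]
  linarith

/-- The rotation number determines the order of invariant graphs. -/
theorem lt_of_rot_lt (h₁ : T.IsInvariantGraph f₁) (h₂ : T.IsInvariantGraph f₂) {ω₁ ω₂ : ℝ}
    (hω₁ : T.HasRot f₁ ω₁) (hω₂ : T.HasRot f₂ ω₂) (hlt : ω₁ < ω₂) (s : ℝ) : f₁ s < f₂ s := by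
  have key : ∀ s, (∀ n, (T.dyn f₂)^[n] s ≤ (T.dyn f₁)^[n] s) → False := by
    intro s hs
    have := nonpos_of_forall_nat_mul_le (a := (ω₂ - ω₁) * T.L) (C := 2 * T.L) fun n => by
      have e1 := (abs_le.1 (hω₁ n s)).2
      have e2 := (abs_le.1 (hω₂ n s)).1
      have e3 := hs n
      nlinarith
    have := mul_pos (sub_pos.2 hlt) T.L_pos
    linarith
  -- Through a common phase point both graphs have the same orbit, hence the same rotation number.
  have hne : ∀ s, f₁ s ≠ f₂ s := fun s he =>
    key s fun n => ((h₁.iterate_dyn_eq h₂ he n).1).ge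
  by_contra! hc
  have hgt : ∀ x, f₂ x < f₁ x := by
    intro x
    by_contra! hx
    have hcont : Continuous fun x => f₁ x - f₂ x := h₁.1.sub h₂.1
    have : (0 : ℝ) ∈ (fun x => f₁ x - f₂ x) '' univ :=
      isPreconnected_univ.intermediate_value (mem_univ x) (mem_univ s) hcont.continuousOn
        ⟨by simpa using hx, by simpa using hc⟩
    obtain ⟨y, -, hy⟩ := this
    exact hne y (sub_eq_zero.1 hy)
  exact key s fun n => h₂.iterate_dyn_le h₁ (fun x => (hgt x).le) n s

/-- The bounded deviation read in the monotone coordinate `w`, in which one turn has length `δ`. The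
error `2δ` allows one turn for the deviation and one for rounding `nω` to an integer. -/
theorem rot_bounds {w : ℝ → ℝ} {δ ω : ℝ} (hω : T.HasRot f ω) (hw : Monotone w)
    (hδ : ∀ s, w (s + T.L) = w s + δ) (n : ℕ) (s : ℝ) :
    w ((T.dyn f)^[n] s) - w s ≤ n * (ω * δ) + 2 * δ ∧
      n * (ω * δ) - 2 * δ ≤ w ((T.dyn f)^[n] s) - w s := by
  have hδ0 : 0 ≤ δ := by
    have := hw (show (0 : ℝ) ≤ 0 + T.L by linarith [T.L_pos])
    linarith [hδ 0]
  have hL := T.L_pos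
  obtain ⟨b1, b2⟩ := abs_le.1 (hω n s)
  have f1 := Int.floor_le (n * ω)
  have f2 := (Int.lt_floor_add_one (n * ω)).le
  set N := ⌊n * ω⌋
  have c1 : (T.dyn f)^[n] s ≤ s + (N + 2 : ℤ) * T.L := by
    push_cast
    nlinarith [mul_le_mul_of_nonneg_right f2 hL.le]
  have c2 : s + (N - 1 : ℤ) * T.L ≤ (T.dyn f)^[n] s := by
    push_cast
    nlinarith [mul_le_mul_of_nonneg_right f1 hL.le]
  have d1 := hw c1
  have d2 := hw c2
  rw [add_int_of_add_const hδ] at d1 d2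
  push_cast at d1 d2
  have e1 := mul_le_mul_of_nonneg_right f1 hδ0
  have e2 := mul_le_mul_of_nonneg_right f2 hδ0
  constructor <;> nlinarith

/-! ### Rigidity of ordered invariant graphs with equal rotation numbers -/

/-- Set-up for two ordered invariant graphs with the same rotation number. -/
theorem exists_action_of_le (h₁ : T.IsInvariantGraph f₁) (h₂ : T.IsInvariantGraph f₂)
    (hle : ∀ s, f₁ s ≤ f₂ s) {ω : ℝ} (hω₁ : T.HasRot f₁ ω) (hω₂ : T.HasRot f₂ ω) :
    ∃ (w : ℝ → ℝ) (δ : ℝ), (∀ s, HasDerivAt w (f₂ s - f₁ s) s) ∧ Monotone w ∧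
      (∀ s, w (s + T.L) = w s + δ) ∧
      (∀ s, ω * δ ≤ w (T.dyn f₂ s) - w s ∧ (w (T.dyn f₂ s) - w s = ω * δ → f₁ s = f₂ s)) ∧
      ∀ s, w (T.dyn f₁ s) - w s ≤ ω * δ ∧ (w (T.dyn f₁ s) - w s = ω * δ → f₁ s = f₂ s) := by
  obtain ⟨w, κ, hw, hw₂, hw₁⟩ := h₁.exists_action h₂
  obtain ⟨δ, hδ⟩ := exists_add_const_of_periodic_deriv hw (h₂.2.1.sub h₁.2.1)
  have hmono : Monotone w := monotone_of_deriv_nonneg (fun s => (hw s).differentiableAt)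
    fun s => by rw [(hw s).deriv]; exact sub_nonneg.2 (hle s)
  -- On each graph the mean gain of `w` per step is `ω δ`; it is at least `κ` on one graph and at
  -- most `κ` on the other.
  have hκ : κ = ω * δ := by
    refine le_antisymm ?_ ?_
    · have := nonpos_of_forall_nat_mul_le (a := κ - ω * δ) (C := 2 * δ) fun n => by
        have e1 := nat_mul_le_of_step (fun s => (hw₂ s).1) n 0
        have e2 := (rot_bounds hω₂ hmono hδ n 0).1
        linarith
      linarith
    · have := nonpos_of_forall_nat_mul_le (a := ω * δ - κ) (C := 2 * δ) fun n => by
        have e1 := le_nat_mul_of_step (fun s => (hw₁ s).1) n 0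
        have e2 := (rot_bounds hω₁ hmono hδ n 0).2
        linarith
      linarith
  subst hκ
  exact ⟨w, δ, hw, hmono, hδ, hw₂, hw₁⟩

/-- Over a period the gains of `w` along an orbit of `f₂` add up to exactly `p δ = q ω δ`. None is
below `ω δ`, so each is an equality case and the graphs meet everywhere. -/
theorem eq_of_le_of_periodic_right (h₁ : T.IsInvariantGraph f₁) (h₂ : T.IsInvariantGraph f₂)
    (hle : ∀ s, f₁ s ≤ f₂ s) {ω : ℝ} (hω₁ : T.HasRot f₁ ω) (hω₂ : T.HasRot f₂ ω) {q : ℕ}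
    (hq : 0 < q) {p : ℤ} (hp : ∀ s, (T.dyn f₂)^[q] s = s + p * T.L) : f₁ = f₂ := by
  obtain ⟨w, δ, hw, hmono, hδ, hw₂, hw₁⟩ := h₁.exists_action_of_le h₂ hle hω₁ hω₂
  have hpq := h₂.rot_of_periodic hω₂ (hp 0)
  obtain ⟨q, rfl⟩ := Nat.exists_eq_succ_of_ne_zero hq.ne'
  ext s
  refine (hw₂ s).2 (le_antisymm ?_ (hw₂ s).1)
  have h3 := nat_mul_le_of_step (fun s => (hw₂ s).1) q (T.dyn f₂ s)
  rw [← Function.iterate_succ_apply, hp, add_int_of_add_const hδ] at h3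
  rw [← hpq] at h3
  push_cast at h3
  linarith

theorem eq_of_le_of_periodic_left (h₁ : T.IsInvariantGraph f₁) (h₂ : T.IsInvariantGraph f₂)
    (hle : ∀ s, f₁ s ≤ f₂ s) {ω : ℝ} (hω₁ : T.HasRot f₁ ω) (hω₂ : T.HasRot f₂ ω) {q : ℕ}
    (hq : 0 < q) {p : ℤ} (hp : ∀ s, (T.dyn f₁)^[q] s = s + p * T.L) : f₁ = f₂ := by
  obtain ⟨w, δ, hw, hmono, hδ, hw₂, hw₁⟩ := h₁.exists_action_of_le h₂ hle hω₁ hω₂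
  have hpq := h₁.rot_of_periodic hω₁ (hp 0)
  obtain ⟨q, rfl⟩ := Nat.exists_eq_succ_of_ne_zero hq.ne'
  ext s
  refine (hw₁ s).2 (le_antisymm (hw₁ s).1 ?_)
  have h3 := le_nat_mul_of_step (fun s => (hw₁ s).1) q (T.dyn f₁ s)
  rw [← Function.iterate_succ_apply, hp, add_int_of_add_const hδ] at h3
  rw [← hpq] at h3
  push_cast at h3
  linarith

theorem eq_of_iterate_dyn_eq (h₁ : T.IsInvariantGraph f₁) (h₂ : T.IsInvariantGraph f₂) (n : ℕ)
    {s : ℝ} (h : f₁ ((T.dyn f₁)^[n] s) = f₂ ((T.dyn f₁)^[n] s)) : f₁ s = f₂ s := by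
  induction n generalizing s with
  | zero => exact h
  | succ n ih =>
    rw [Function.iterate_succ_apply] at h
    have h3 := ih h
    obtain ⟨x, hx⟩ := h₂.surjective_dyn (T.dyn f₁ s)
    have s1 := h₁.step s
    have s2 := h₂.step x
    rw [hx, ← h3] at s2
    have := step_unique_left s1 s2
    rw [Prod.mk.injEq] at this
    obtain ⟨rfl, h4⟩ := this
    exact h4

/-- Ordered invariant graphs with the same irrational rotation number intersect. -/
theorem exists_eq_of_le (h₁ : T.IsInvariantGraph f₁) (h₂ : T.IsInvariantGraph f₂)
    (hle : ∀ s, f₁ s ≤ f₂ s) {ω : ℝ} (hω₁ : T.HasRot f₁ ω) (hω₂ : T.HasRot f₂ ω) :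
    ∃ s, f₁ s = f₂ s := by
  obtain ⟨w, δ, hw, hmono, hδ, hw₂, hw₁⟩ := h₁.exists_action_of_le h₂ hle hω₁ hω₂
  by_contra! hne
  have hwc : Continuous w := continuous_iff_continuousAt.2 fun s => (hw s).continuousAt
  have hgc := h₂.continuous_dyn
  have hV : Continuous fun s => w (T.dyn f₂ s) - w s := by fun_prop
  have hVp : Function.Periodic (fun s => w (T.dyn f₂ s) - w s) T.L := by
    intro s
    simp only [h₂.dyn_add, hδ]
    ring
  obtain ⟨s₀, -, hs₀⟩ := isCompact_Icc.exists_isMinOn (nonempty_Icc.2 T.L_pos.le) hV.continuousOn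
  -- By compactness the strict inequality becomes a uniform excess over `ω δ` at every step, which
  -- accumulates beyond the bound given by the rotation number.
  have hlt : ω * δ < w (T.dyn f₂ s₀) - w s₀ :=
    lt_of_le_of_ne (hw₂ s₀).1 fun he => hne s₀ ((hw₂ s₀).2 he.symm)
  have hall : ∀ s, w (T.dyn f₂ s₀) - w s₀ ≤ w (T.dyn f₂ s) - w s := by
    intro s
    obtain ⟨y, hy, hye⟩ := hVp.exists_mem_Ico₀ T.L_pos s
    have h3 : w (T.dyn f₂ s₀) - w s₀ ≤ w (T.dyn f₂ y) - w y := hs₀ (Ico_subset_Icc_self hy)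
    exact h3.trans hye.ge
  have := nonpos_of_forall_nat_mul_le (a := w (T.dyn f₂ s₀) - w s₀ - ω * δ) (C := 2 * δ) fun n => by
    have e1 := nat_mul_le_of_step hall n 0
    have e2 := (rot_bounds hω₂ hmono hδ n 0).1
    linarith
  linarith

/-- Ordered invariant graphs with the same irrational rotation number coincide. -/
theorem eq_of_le_of_irrational (h₁ : T.IsInvariantGraph f₁) (h₂ : T.IsInvariantGraph f₂)
    (hle : ∀ s, f₁ s ≤ f₂ s) {ω : ℝ} (hω₁ : T.HasRot f₁ ω) (hω₂ : T.HasRot f₂ ω)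
    (hirr : Irrational ω) : f₁ = f₂ := by
  by_contra hne
  obtain ⟨s₀, hs₀⟩ := Function.ne_iff.1 hne
  obtain ⟨z, hz⟩ := h₁.exists_eq_of_le h₂ hle hω₁ hω₂
  obtain ⟨w, δ, hw, hmono, hδ, hw₂, hw₁⟩ := h₁.exists_action_of_le h₂ hle hω₁ hω₂
  have hwc : Continuous w := continuous_iff_continuousAt.2 fun s => (hw s).continuousAt
  have hL := T.L_pos
  -- The invariant coincidence set. A component `(a, b)` of its complement is mapped to components
  -- again, and these images will be shown to be too many for the finite `w`-mass of one turn.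
  set Z : Set ℝ := {s | f₁ s = f₂ s} with hZ
  have hZc : IsClosed Z := isClosed_eq h₁.1 h₂.1
  have hZp : ∀ (m : ℤ) s, s ∈ Z → s + m * T.L ∈ Z := by
    intro m s hs
    show f₁ (s + m * T.L) = f₂ (s + m * T.L)
    have e1 := h₁.2.1.int_mul m s
    have e2 := h₂.2.1.int_mul m s
    rw [e1, e2]
    exact hs
  have hper : Function.Periodic (fun s => f₁ s - f₂ s) T.L := h₁.2.1.sub h₂.2.1
  obtain ⟨a, haZ, has, hab⟩ : ∃ a ∈ Z, a < s₀ ∧ ∀ x ∈ Z, x ≤ s₀ → x ≤ a := by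
    have hbdd : BddAbove (Z ∩ Iic s₀) := ⟨s₀, fun x hx => hx.2⟩
    have hne : (Z ∩ Iic s₀).Nonempty := by
      obtain ⟨y, hy, hye⟩ := hper.exists_mem_Ico hL z (s₀ - T.L)
      refine ⟨y, ?_, by have := hy.2; show y ≤ s₀; linarith⟩
      have h3 : f₁ y - f₂ y = 0 := by rw [← hye, hz, sub_self]
      exact sub_eq_zero.1 h3
    have hmem := (hZc.inter isClosed_Iic).csSup_mem hne hbdd
    refine ⟨_, hmem.1, lt_of_le_of_ne hmem.2 ?_, fun x hx hxs => le_csSup hbdd ⟨hx, hxs⟩⟩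
    intro he
    exact hs₀ (he ▸ hmem.1)
  obtain ⟨b, hbZ, hbs, hbb⟩ : ∃ b ∈ Z, s₀ < b ∧ ∀ x ∈ Z, s₀ ≤ x → b ≤ x := by
    have hbdd : BddBelow (Z ∩ Ici s₀) := ⟨s₀, fun x hx => hx.2⟩
    have hne : (Z ∩ Ici s₀).Nonempty := by
      obtain ⟨y, hy, hye⟩ := hper.exists_mem_Ico hL z s₀
      refine ⟨y, ?_, hy.1⟩
      have h3 : f₁ y - f₂ y = 0 := by rw [← hye, hz, sub_self]
      exact sub_eq_zero.1 h3
    have hmem := (hZc.inter isClosed_Ici).csInf_mem hne hbdd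
    refine ⟨_, hmem.1, lt_of_le_of_ne hmem.2 ?_, fun x hx hxs => csInf_le hbdd ⟨hx, hxs⟩⟩
    intro he
    exact hs₀ (he ▸ hmem.1)
  have hgap : ∀ x, a < x → x < b → x ∉ Z := by
    intro x hx1 hx2 hxZ
    rcases le_total x s₀ with h | h
    · exact absurd (hab x hxZ h) (not_le.2 hx1)
    · exact absurd (hbb x hxZ h) (not_le.2 hx2)
  have hlt : a < b := has.trans hbs
  obtain ⟨m, hm, hmw⟩ : ∃ m, 0 < m ∧ w b = w a + m := by
    have : StrictMonoOn w (Icc a b) := by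
      refine strictMonoOn_of_deriv_pos (convex_Icc _ _) hwc.continuousOn ?_
      intro x hx
      rw [interior_Icc] at hx
      rw [(hw x).deriv]
      exact sub_pos.2 (lt_of_le_of_ne (hle x) (hgap x hx.1 hx.2))
    exact ⟨w b - w a, sub_pos.2 (this (left_mem_Icc.2 hlt.le) (right_mem_Icc.2 hlt.le) hlt),
      by ring⟩
  have hZit : ∀ s ∈ Z, ∀ n, (T.dyn f₁)^[n] s ∈ Z := fun s hs n => (h₁.iterate_dyn_eq h₂ hs n).2
  -- On `Z` the dynamics agree, so the upper and the lower bound for the gain of `w` apply together.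
  -- Consequently all images of the gap have the same mass `m`.
  have hwit : ∀ s ∈ Z, ∀ n : ℕ, w ((T.dyn f₁)^[n] s) = w s + n * (ω * δ) := by
    intro s hs n
    induction n with
    | zero => simp
    | succ n ih =>
      have h3 : f₁ _ = f₂ _ := hZit s hs n
      have e := (h₁.dyn_eq_dyn_iff h₂).2 h3
      have e1 := (hw₁ ((T.dyn f₁)^[n] s)).1
      have e2 := (hw₂ ((T.dyn f₁)^[n] s)).1
      rw [← e] at e2
      rw [Function.iterate_succ_apply']
      push_cast
      linarith
  have hgapn : ∀ (n : ℕ) x, (T.dyn f₁)^[n] a < x → x < (T.dyn f₁)^[n] b → x ∉ Z := by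
    intro n x hx1 hx2 hxZ
    obtain ⟨y, rfl⟩ := h₁.surjective_dyn.iterate n x
    have hmono := h₁.strictMono_dyn.iterate n
    exact hgap y (hmono.lt_iff_lt.1 hx1) (hmono.lt_iff_lt.1 hx2) (h₁.eq_of_iterate_dyn_eq h₂ n hxZ)
  -- Translation by whole turns that brings the left end of the `n`-th gap into `[0, L]`.
  let N : ℕ → ℤ := fun n => -⌊(T.dyn f₁)^[n] a / T.L⌋
  let a' : ℕ → ℝ := fun n => (T.dyn f₁)^[n] a + N n * T.L
  have ha'0 : ∀ n, 0 ≤ a' n := by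
    intro n
    have := (le_div_iff₀ hL).1 (Int.floor_le ((T.dyn f₁)^[n] a / T.L))
    simp only [a', N]
    push_cast
    linarith
  have ha'L : ∀ n, a' n ≤ T.L := by
    intro n
    have := (div_lt_iff₀ hL).1 (Int.lt_floor_add_one ((T.dyn f₁)^[n] a / T.L))
    simp only [a', N]
    push_cast
    linarith
  have hsep : ∀ i j, a' i < a' j → w (a' i) + m ≤ w (a' j) := by
    intro i j hij
    have h3 : (T.dyn f₁)^[i] b + N i * T.L ≤ a' j := by
      by_contra! hc
      have hmem : a' j + (-N i : ℤ) * T.L ∈ Z := hZp _ _ (hZp _ _ (hZit a haZ j))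
      push_cast at hmem
      refine hgapn i _ ?_ ?_ hmem
      · simp only [a'] at hij ⊢; linarith
      · linarith
    have h4 := hmono h3
    rw [add_int_of_add_const hδ, hwit b hbZ, hmw] at h4
    simp only [a'] at h4 ⊢
    rw [add_int_of_add_const hδ, hwit a haZ]
    linarith
  -- A coincidence modulo whole turns would be a periodic point and make `ω` rational.
  have hlt_ne : ∀ i j, i < j → a' i ≠ a' j := by
    intro i j hij he
    have h3 : (T.dyn f₁)^[j - i] ((T.dyn f₁)^[i] a) = (T.dyn f₁)^[i] a + (N i - N j : ℤ) * T.L := by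
      rw [← Function.iterate_add_apply, Nat.sub_add_cancel hij.le]
      simp only [a'] at he
      push_cast
      linarith
    have h4 := h₁.rot_of_periodic hω₁ h3
    have h5 : ((j - i : ℕ) : ℝ) ≠ 0 := by
      exact_mod_cast (Nat.sub_pos_of_lt hij).ne'
    refine hirr ⟨((N i - N j : ℤ) : ℚ) / ((j - i : ℕ) : ℚ), ?_⟩
    rw [Rat.cast_div, Rat.cast_intCast, Rat.cast_natCast, ← h4, mul_div_cancel_left₀ _ h5]
  -- Left ends are at least `m` apart in the coordinate `w`, so the integer parts of `w / m` are
  -- distinct; only finitely many values fit in one turn.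
  have hinj : Function.Injective fun n => ⌊w (a' n) / m⌋ := by
    have hfl : ∀ i j, a' i < a' j → ⌊w (a' i) / m⌋ < ⌊w (a' j) / m⌋ := by
      intro i j hij
      have h3 := hsep i j hij
      have h4 : w (a' i) / m + 1 ≤ w (a' j) / m := by
        rw [← div_self hm.ne', ← add_div]
        exact div_le_div_of_nonneg_right h3 hm.le
      have h5 := Int.floor_le_floor h4
      rw [Int.floor_add_one] at h5
      omega
    have hne' : ∀ i j, i < j → ⌊w (a' i) / m⌋ ≠ ⌊w (a' j) / m⌋ := by
      intro i j hij
      rcases lt_or_gt_of_ne (hlt_ne i j hij) with h | h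
      · exact (hfl i j h).ne
      · exact (hfl j i h).ne'
    intro i j hij
    by_contra hc
    rcases lt_or_gt_of_ne hc with h | h
    · exact hne' i j h hij
    · exact hne' j i h hij.symm
  refine Set.infinite_range_of_injective hinj
    ((Set.finite_Icc ⌊w 0 / m⌋ ⌊w T.L / m⌋).subset ?_)
  rintro _ ⟨n, rfl⟩
  exact ⟨Int.floor_le_floor (div_le_div_of_nonneg_right (hmono (ha'0 n)) hm.le),
    Int.floor_le_floor (div_le_div_of_nonneg_right (hmono (ha'L n)) hm.le)⟩

end IsInvariantGraph

/-! ### Limits of invariant graphs -/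

variable (T) in
/-- The previous bounce point on the graph of `f`. -/
noncomputable def pre (f : ℝ → ℝ) (s : ℝ) : ℝ := T.bounce (s, -f s) - T.L

namespace IsInvariantGraph

variable {f f₁ f₂ : ℝ → ℝ}

theorem pre_dyn (hf : T.IsInvariantGraph f) (s : ℝ) : T.pre f (T.dyn f s) = s := by
  rw [pre, bounce_eq_of_step (step_reverse (hf.step s)), add_sub_cancel_right]

theorem dyn_pre (hf : T.IsInvariantGraph f) (s : ℝ) : T.dyn f (T.pre f s) = s := by
  obtain ⟨x, rfl⟩ := hf.surjective_dyn s
  rw [hf.pre_dyn]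

theorem pre_lt (hf : T.IsInvariantGraph f) (s : ℝ) : T.pre f s < s := by
  have := hf.lt_dyn (T.pre f s)
  rwa [hf.dyn_pre] at this

theorem lt_pre_add (hf : T.IsInvariantGraph f) (s : ℝ) : s < T.pre f s + T.L := by
  have := hf.dyn_lt (T.pre f s)
  rwa [hf.dyn_pre] at this

theorem eq_A_pre (hf : T.IsInvariantGraph f) (s : ℝ) : f s = T.A s (T.pre f s) := by
  have := hf.dyn_eq_A (T.pre f s)
  rwa [hf.dyn_pre] at this

theorem pre_mono (hf : T.IsInvariantGraph f) {s s' : ℝ} (h : s ≤ s') : T.pre f s ≤ T.pre f s' := by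
  refine hf.strictMono_dyn.le_iff_le.1 ?_
  rwa [hf.dyn_pre, hf.dyn_pre]

/-- A modulus of continuity of an invariant graph, in terms of the three bounces around a point. -/
theorem abs_sub_le (hf : T.IsInvariantGraph f) {s s' : ℝ} (h1 : s' < T.dyn f s)
    (h2 : T.dyn f s < s' + T.L) (h3 : T.pre f s < s') (h4 : s' < T.pre f s + T.L) :
    |f s' - f s| ≤ |T.A s' (T.dyn f s) - T.A s (T.dyn f s)| +
      |T.A s' (T.pre f s) - T.A s (T.pre f s)| := by
  have e1 := hf.eq_neg_A s
  have e2 := hf.eq_A_pre s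
  have e3 := hf.eq_neg_A s'
  have e4 := hf.eq_A_pre s'
  have d1 := hf.lt_dyn s'
  have d2 := hf.dyn_lt s'
  have d3 := hf.pre_lt s'
  have d4 := hf.lt_pre_add s'
  have hanti : ∀ {x y}, s' - T.L < x → x ≤ y → y < s' → T.A s' y ≤ T.A s' x := by
    intro x y hx hxy hy
    rcases hxy.eq_or_lt with h | h
    · rw [h]
    · exact (T.A_lt' hx h hy).le
  have a1 := abs_le.1 (le_refl |T.A s' (T.dyn f s) - T.A s (T.dyn f s)|)
  have a2 := abs_le.1 (le_refl |T.A s' (T.pre f s) - T.A s (T.pre f s)|)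
  have b1 := abs_nonneg (T.A s' (T.dyn f s) - T.A s (T.dyn f s))
  have b2 := abs_nonneg (T.A s' (T.pre f s) - T.A s (T.pre f s))
  -- The next and the previous bounce both depend monotonically on the base point. Since `f` is
  -- minus `A` at the next one and `A` at the previous one, one of them bounds `f s'` from below and
  -- the other from above.
  rcases le_total s s' with h | h
  · have c1 := (T.A_strictAntiOn s').antitoneOn ⟨h1, h2⟩ ⟨d1, d2⟩ (hf.strictMono_dyn.monotone h)
    have c2 := hanti (by linarith) (hf.pre_mono h) d3
    rw [abs_le]
    constructor <;> linarith
  · have c1 := (T.A_strictAntiOn s').antitoneOn ⟨d1, d2⟩ ⟨h1, h2⟩ (hf.strictMono_dyn.monotone h)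
    have c2 := hanti (by linarith) (hf.pre_mono h) h3
    rw [abs_le]
    constructor <;> linarith

/-- A pointwise limit of invariant graphs between two invariant graphs is an invariant graph. -/
theorem of_tendsto {F : ℕ → ℝ → ℝ} (hF : ∀ n, T.IsInvariantGraph (F n))
    (h₁ : T.IsInvariantGraph f₁) (h₂ : T.IsInvariantGraph f₂) (hle₁ : ∀ s, f₁ s ≤ f s)
    (hle₂ : ∀ s, f s ≤ f₂ s) (hlim : ∀ s, Tendsto (fun n => F n s) atTop (𝓝 (f s))) :
    T.IsInvariantGraph f := by
  have hdom : ∀ s, (s, f s) ∈ T.dom := fun s =>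
    dom_vertical (h₁.mem_dom s) (h₂.mem_dom s) (hle₁ s) (hle₂ s)
  have hdom' : ∀ s, (s, -f s) ∈ T.dom := fun s =>
    dom_vertical (h₂.neg_mem_dom s) (h₁.neg_mem_dom s) (neg_le_neg (hle₂ s)) (neg_le_neg (hle₁ s))
  have hg : ∀ s, Tendsto (fun n => T.dyn (F n) s) atTop (𝓝 (T.dyn f s)) := fun s =>
    Tendsto.comp (f := fun n => (s, F n s)) (continuousAt_bounce (hdom s))
      (tendsto_const_nhds.prodMk_nhds (hlim s))
  have hh : ∀ s, Tendsto (fun n => T.pre (F n) s) atTop (𝓝 (T.pre f s)) := fun s =>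
    (Tendsto.comp (f := fun n => (s, -F n s)) (continuousAt_bounce (hdom' s))
      (tendsto_const_nhds.prodMk_nhds (hlim s).neg)).sub_const _
  have g1 : ∀ s, s < T.dyn f s := fun s => (bounce_spec (hdom s)).1
  have g2 : ∀ s, T.dyn f s < s + T.L := fun s => (bounce_spec (hdom s)).2.1
  have p1 : ∀ s, T.pre f s < s := fun s => by
    have := (bounce_spec (hdom' s)).2.1
    simp only [pre]; linarith
  have p2 : ∀ s, s < T.pre f s + T.L := fun s => by
    have := (bounce_spec (hdom' s)).1
    simp only [pre]; linarith
  have ng : ∀ s, T.γ (T.dyn f s) ≠ T.γ s := fun s => T.curve_ne (g1 s) (g2 s)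
  have np : ∀ s, T.γ (T.pre f s) ≠ T.γ s := fun s => (T.curve_ne (p1 s) (p2 s)).symm
  -- The modulus involves only the two neighbours of `s`, which converge, so it survives the limit
  -- and yields continuity of `f`.
  have hmod : ∀ s s', s' < T.dyn f s → T.dyn f s < s' + T.L → T.pre f s < s' →
      s' < T.pre f s + T.L → |f s' - f s| ≤ |T.A s' (T.dyn f s) - T.A s (T.dyn f s)| +
      |T.A s' (T.pre f s) - T.A s (T.pre f s)| := by
    intro s s' c1 c2 c3 c4
    have t1 : Tendsto (fun n => |F n s' - F n s|) atTop (𝓝 |f s' - f s|) :=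
      ((hlim s').sub (hlim s)).abs
    have t2 := (((T.tendsto_A (T.curve_ne c1 c2) tendsto_const_nhds (hg s)).sub
      (T.tendsto_A (ng s) tendsto_const_nhds (hg s))).abs).add
      ((T.tendsto_A (T.curve_ne c3 c4).symm tendsto_const_nhds (hh s)).sub
      (T.tendsto_A (np s) tendsto_const_nhds (hh s))).abs
    refine le_of_tendsto_of_tendsto t1 t2 ?_
    filter_upwards [(hg s).eventually_const_lt c1, (hg s).eventually_lt_const c2,
      (hh s).eventually_lt_const c3, ((hh s).add_const T.L).eventually_const_lt c4]
      with n n1 n2 n3 n4 using (hF n).abs_sub_le n1 n2 n3 n4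
  refine ⟨?_, ?_, ?_⟩
  · refine continuous_iff_continuousAt.2 fun s => ?_
    have t : Tendsto (fun s' => |T.A s' (T.dyn f s) - T.A s (T.dyn f s)| +
        |T.A s' (T.pre f s) - T.A s (T.pre f s)|) (𝓝 s) (𝓝 (|T.A s (T.dyn f s) -
        T.A s (T.dyn f s)| + |T.A s (T.pre f s) - T.A s (T.pre f s)|)) :=
      (((T.tendsto_A (ng s) tendsto_id tendsto_const_nhds).sub_const _).abs).add
        (((T.tendsto_A (np s) tendsto_id tendsto_const_nhds).sub_const _).abs)
    simp only [sub_self, abs_zero, add_zero] at t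
    rw [ContinuousAt, tendsto_iff_dist_tendsto_zero]
    refine squeeze_zero' (Eventually.of_forall fun _ => dist_nonneg) ?_ t
    have hid : Tendsto (fun x : ℝ => x) (𝓝 s) (𝓝 s) := tendsto_id
    filter_upwards [hid.eventually_lt_const (g1 s),
      (hid.add_const T.L).eventually_const_lt (g2 s), hid.eventually_const_lt (p1 s),
      hid.eventually_lt_const (p2 s)] with s' n1 n2 n3 n4
    rw [Real.dist_eq]
    exact hmod s s' n1 n2 n3 n4
  · intro s
    have t := hlim (s + T.L)
    simp only [fun n => (hF n).2.1 s] at t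
    exact tendsto_nhds_unique t (hlim s)
  · intro s
    refine ⟨T.dyn f s, ?_⟩
    set x := T.dyn f s with hx
    have t1 : Tendsto (fun n => F n (T.dyn (F n) s)) atTop (𝓝 (T.A x s)) := by
      simp only [fun n => (hF n).dyn_eq_A s]
      exact T.tendsto_A (ng s).symm (hg s) tendsto_const_nhds
    have t2 := (((T.tendsto_A (ng x) (hg s) (hg x)).sub
      (T.tendsto_A (ng x) tendsto_const_nhds (hg x))).abs).add
      ((T.tendsto_A (np x) (hg s) (hh x)).sub (T.tendsto_A (np x) tendsto_const_nhds (hh x))).abs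
    simp only [sub_self, abs_zero, add_zero] at t2
    -- Invariance must be passed through the moving point `dyn (F n) s`; the modulus centred at `x`
    -- allows it to be replaced by `x`.
    have t3 : Tendsto (fun n => F n (T.dyn (F n) s) - F n x) atTop (𝓝 0) := by
      rw [tendsto_zero_iff_abs_tendsto_zero]
      refine squeeze_zero' (Eventually.of_forall fun _ => abs_nonneg _) ?_ t2
      filter_upwards [(hg s).eventually_lt (hg x) (g1 x),
        (hg x).eventually_lt ((hg s).add_const T.L) (g2 x),
        (hh x).eventually_lt (hg s) (p1 x),
        (hg s).eventually_lt ((hh x).add_const T.L) (p2 x)] with n n1 n2 n3 n4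
      exact (hF n).abs_sub_le n1 n2 n3 n4
    have t4 := t1.sub t3
    simp only [sub_sub_cancel, sub_zero] at t4
    have := tendsto_nhds_unique (hlim x) t4
    rw [this]
    exact step_bounce (hdom s)

end IsInvariantGraph

/-! ### Families of invariant graphs with rational rotation numbers -/

/-- The approximation is strict whenever `a < ω`. The alternative `u n = a` covers the end `ω = a`,
below which the family has no members. -/
theorem exists_rat_seq_le {a b : ℚ} {ω : ℝ} (ha : a ≤ ω) (hb : ω ≤ b) :
    ∃ u : ℕ → ℚ, Monotone u ∧ (∀ n, a ≤ u n ∧ u n ≤ b ∧ (u n : ℝ) ≤ ω ∧ (u n < ω ∨ u n = a)) ∧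
      Tendsto (fun n => (u n : ℝ)) atTop (𝓝 ω) := by
  rcases ha.eq_or_lt with h | h
  · refine ⟨fun _ => a, monotone_const, fun n => ⟨le_rfl, ?_, ha, Or.inr rfl⟩, ?_⟩
    · exact_mod_cast ha.trans hb
    · rw [← h]; exact tendsto_const_nhds
  · obtain ⟨u, hu, hlt, hlim⟩ := Real.exists_seq_rat_strictMono_tendsto ω
    refine ⟨fun n => max a (u n), monotone_const.max hu.monotone, fun n => ⟨le_max_left _ _, ?_, ?_, ?_⟩, ?_⟩
    · have h1 : (a : ℝ) ≤ b := ha.trans hb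
      have h2 : (u n : ℝ) ≤ b := (hlt n).le.trans hb
      exact max_le (by exact_mod_cast h1) (by exact_mod_cast h2)
    · push_cast; exact max_le ha (hlt n).le
    · left; push_cast; exact max_lt h (hlt n)
    · have := (tendsto_const_nhds (x := (a : ℝ))).max hlim
      rw [max_eq_right ha] at this
      simpa using this

theorem exists_rat_seq_ge {a b : ℚ} {ω : ℝ} (ha : a ≤ ω) (hb : ω ≤ b) :
    ∃ u : ℕ → ℚ, Antitone u ∧ (∀ n, a ≤ u n ∧ u n ≤ b ∧ ω ≤ (u n : ℝ) ∧ (ω < u n ∨ u n = b)) ∧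
      Tendsto (fun n => (u n : ℝ)) atTop (𝓝 ω) := by
  obtain ⟨u, h1, h2, h3⟩ := exists_rat_seq_le (a := -b) (b := -a) (ω := -ω)
    (by push_cast; linarith) (by push_cast; linarith)
  refine ⟨fun n => -u n, h1.neg, fun n => ?_, ?_⟩
  · obtain ⟨c1, c2, c3, c4⟩ := h2 n
    refine ⟨by linarith, by linarith, by push_cast; linarith, ?_⟩
    rcases c4 with c | c
    · left; push_cast; linarith
    · right; linarith
  · simpa using h3.neg

/-- A family of invariant graphs with periodic dynamics for all rational rotation numbers in
`[a, b]`. -/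
def IsRationalFamily (T : ConvexTable k) (a b : ℚ) (F : ℚ → ℝ → ℝ) : Prop :=
  ∀ ρ, a ≤ ρ → ρ ≤ b → T.IsInvariantGraph (F ρ) ∧ T.HasRot (F ρ) ρ ∧
    ∀ s, (T.dyn (F ρ))^[ρ.den] s = s + ρ.num * T.L

/-- The graph of `f` separates the members of the family according to their rotation numbers. -/
def IsCut (a b : ℚ) (F : ℚ → ℝ → ℝ) (f : ℝ → ℝ) (ω : ℝ) : Prop :=
  ∀ ρ : ℚ, a ≤ ρ → ρ ≤ b → ((ρ : ℝ) ≤ ω → ∀ s, F ρ s ≤ f s) ∧ (ω ≤ ρ → ∀ s, f s ≤ F ρ s)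

namespace IsRationalFamily

variable {a b : ℚ} {F : ℚ → ℝ → ℝ}

theorem mono (hF : T.IsRationalFamily a b F) {ρ ρ' : ℚ} (h1 : a ≤ ρ) (h2 : ρ ≤ ρ') (h3 : ρ' ≤ b)
    (s : ℝ) : F ρ s ≤ F ρ' s := by
  rcases h2.eq_or_lt with h | h
  · rw [h]
  · obtain ⟨i1, r1, -⟩ := hF ρ h1 (h2.trans h3)
    obtain ⟨i2, r2, -⟩ := hF ρ' (h1.trans h2) h3
    exact (i1.lt_of_rot_lt i2 r1 r2 (by exact_mod_cast h) s).le

theorem strictMono (hF : T.IsRationalFamily a b F) {ρ ρ' : ℚ} (h1 : a ≤ ρ) (h2 : ρ < ρ')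
    (h3 : ρ' ≤ b) (s : ℝ) : F ρ s < F ρ' s := by
  obtain ⟨i1, r1, -⟩ := hF ρ h1 (h2.le.trans h3)
  obtain ⟨i2, r2, -⟩ := hF ρ' (h1.trans h2.le) h3
  exact i1.lt_of_rot_lt i2 r1 r2 (by exact_mod_cast h2) s

theorem hasRot_of_seq (hF : T.IsRationalFamily a b F) {f : ℝ → ℝ} (hf : T.IsInvariantGraph f)
    {ω : ℝ} {u v : ℕ → ℚ} (hu : ∀ n, a ≤ u n ∧ u n ≤ b) (hv : ∀ n, a ≤ v n ∧ v n ≤ b)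
    (hul : Tendsto (fun n => (u n : ℝ)) atTop (𝓝 ω)) (hvl : Tendsto (fun n => (v n : ℝ)) atTop (𝓝 ω))
    (huf : ∀ n s, F (u n) s ≤ f s) (hvf : ∀ n s, f s ≤ F (v n) s) : T.HasRot f ω := by
  intro n s
  rw [abs_le]
  constructor
  · have t : Tendsto (fun j => (T.dyn f)^[n] s - s - n * (u j : ℝ) * T.L) atTop
        (𝓝 ((T.dyn f)^[n] s - s - n * ω * T.L)) := ((hul.const_mul _).mul_const _).const_sub _
    refine ge_of_tendsto' t fun j => ?_
    obtain ⟨i, r, -⟩ := hF (u j) (hu j).1 (hu j).2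
    have e1 := (abs_le.1 (r n s)).1
    have e2 := i.iterate_dyn_le hf (huf j) n s
    linarith
  · have t : Tendsto (fun j => (T.dyn f)^[n] s - s - n * (v j : ℝ) * T.L) atTop
        (𝓝 ((T.dyn f)^[n] s - s - n * ω * T.L)) := ((hvl.const_mul _).mul_const _).const_sub _
    refine le_of_tendsto' t fun j => ?_
    obtain ⟨i, r, -⟩ := hF (v j) (hv j).1 (hv j).2
    have e1 := (abs_le.1 (r n s)).2
    have e2 := hf.iterate_dyn_le i (hvf j) n s
    linarith

theorem hasRot_of_isCut (hF : T.IsRationalFamily a b F) {f : ℝ → ℝ} (hf : T.IsInvariantGraph f)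
    {ω : ℝ} (ha : a ≤ ω) (hb : ω ≤ b) (hc : IsCut a b F f ω) : T.HasRot f ω := by
  obtain ⟨u, -, hu, hul⟩ := exists_rat_seq_le ha hb
  obtain ⟨v, -, hv, hvl⟩ := exists_rat_seq_ge ha hb
  exact hF.hasRot_of_seq hf (fun n => ⟨(hu n).1, (hu n).2.1⟩) (fun n => ⟨(hv n).1, (hv n).2.1⟩)
    hul hvl (fun n => (hc _ (hu n).1 (hu n).2.1).1 (hu n).2.2.1)
    (fun n => (hc _ (hv n).1 (hv n).2.1).2 (hv n).2.2.1)

/-- The limit of the family from below at `ω`. -/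
theorem exists_lower (hF : T.IsRationalFamily a b F) {ω : ℝ} (ha : a ≤ ω) (hb : ω ≤ b) :
    ∃ f, T.IsInvariantGraph f ∧ T.HasRot f ω ∧ IsCut a b F f ω ∧
      ∀ s r, (∀ ρ : ℚ, a ≤ ρ → ρ ≤ b → (ρ < ω ∨ ρ = a) → F ρ s ≤ r) → f s ≤ r := by
  obtain ⟨u, hum, hu, hul⟩ := exists_rat_seq_le ha hb
  obtain ⟨v, -, hv, hvl⟩ := exists_rat_seq_ge ha hb
  have hab : a ≤ b := by exact_mod_cast ha.trans hb
  have hbdd : ∀ s, BddAbove (range fun n => F (u n) s) := fun s =>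
    ⟨F b s, by rintro _ ⟨n, rfl⟩; exact hF.mono (hu n).1 (hu n).2.1 le_rfl s⟩
  set f : ℝ → ℝ := fun s => ⨆ n, F (u n) s with hf
  have hlim : ∀ s, Tendsto (fun n => F (u n) s) atTop (𝓝 (f s)) := fun s =>
    tendsto_atTop_ciSup (fun i j hij => hF.mono (hu i).1 (hum hij) (hu j).2.1 s) (hbdd s)
  have hge : ∀ n s, F (u n) s ≤ f s := fun n s => le_ciSup (hbdd s) n
  have hle : ∀ s r, (∀ n, F (u n) s ≤ r) → f s ≤ r := fun s r h => ciSup_le h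
  have hleF : ∀ ρ : ℚ, a ≤ ρ → ρ ≤ b → ω ≤ ρ → ∀ s, f s ≤ F ρ s := fun ρ h1 h2 h3 s =>
    hle s _ fun n => hF.mono (hu n).1 (by exact_mod_cast (hu n).2.2.1.trans h3) h2 s
  have hinv : T.IsInvariantGraph f :=
    IsInvariantGraph.of_tendsto (fun n => (hF (u n) (hu n).1 (hu n).2.1).1)
      (hF a le_rfl hab).1 (hF b hab le_rfl).1
      (fun s => (hF.mono le_rfl (hu 0).1 (hu 0).2.1 s).trans (hge 0 s))
      (hleF b hab le_rfl hb) hlim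
  have hrot : T.HasRot f ω := hF.hasRot_of_seq hinv (fun n => ⟨(hu n).1, (hu n).2.1⟩)
    (fun n => ⟨(hv n).1, (hv n).2.1⟩) hul hvl hge
    (fun n => hleF _ (hv n).1 (hv n).2.1 (hv n).2.2.1)
  refine ⟨f, hinv, hrot, fun ρ h1 h2 => ⟨fun h3 s => ?_, hleF ρ h1 h2⟩, fun s r h => ?_⟩
  · rcases h3.eq_or_lt with h | h
    -- If `ω` is itself the rational `ρ`, the limit from below could a priori miss `F ρ`; rigidity
    -- for periodic graphs identifies them.
    · obtain ⟨i, ri, pi⟩ := hF ρ h1 h2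
      rw [h] at ri
      rw [hinv.eq_of_le_of_periodic_right i (hleF ρ h1 h2 h.ge) hrot ri ρ.den_pos pi]
    · obtain ⟨n, hn⟩ := (hul.eventually_const_lt h).exists
      exact (hF.mono h1 (by exact_mod_cast hn.le) (hu n).2.1 s).trans (hge n s)
  · exact hle s r fun n => h _ (hu n).1 (hu n).2.1 (hu n).2.2.2

/-- The limit of the family from above at `ω`. -/
theorem exists_upper (hF : T.IsRationalFamily a b F) {ω : ℝ} (ha : a ≤ ω) (hb : ω ≤ b) :
    ∃ f, T.IsInvariantGraph f ∧ T.HasRot f ω ∧ IsCut a b F f ω ∧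
      ∀ s r, (∀ ρ : ℚ, a ≤ ρ → ρ ≤ b → (ω < ρ ∨ ρ = b) → r ≤ F ρ s) → r ≤ f s := by
  obtain ⟨u, -, hu, hul⟩ := exists_rat_seq_le ha hb
  obtain ⟨v, hvm, hv, hvl⟩ := exists_rat_seq_ge ha hb
  have hab : a ≤ b := by exact_mod_cast ha.trans hb
  have hbdd : ∀ s, BddBelow (range fun n => F (v n) s) := fun s =>
    ⟨F a s, by rintro _ ⟨n, rfl⟩; exact hF.mono le_rfl (hv n).1 (hv n).2.1 s⟩
  set f : ℝ → ℝ := fun s => ⨅ n, F (v n) s with hf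
  have hlim : ∀ s, Tendsto (fun n => F (v n) s) atTop (𝓝 (f s)) := fun s =>
    tendsto_atTop_ciInf (fun i j hij => hF.mono (hv j).1 (hvm hij) (hv i).2.1 s) (hbdd s)
  have hge : ∀ n s, f s ≤ F (v n) s := fun n s => ciInf_le (hbdd s) n
  have hle : ∀ s r, (∀ n, r ≤ F (v n) s) → r ≤ f s := fun s r h => le_ciInf h
  have hleF : ∀ ρ : ℚ, a ≤ ρ → ρ ≤ b → ρ ≤ ω → ∀ s, F ρ s ≤ f s := fun ρ h1 h2 h3 s =>
    hle s _ fun n => hF.mono h1 (by exact_mod_cast h3.trans (hv n).2.2.1) (hv n).2.1 s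
  have hinv : T.IsInvariantGraph f :=
    IsInvariantGraph.of_tendsto (fun n => (hF (v n) (hv n).1 (hv n).2.1).1)
      (hF a le_rfl hab).1 (hF b hab le_rfl).1 (hleF a le_rfl hab ha)
      (fun s => (hge 0 s).trans (hF.mono (hv 0).1 (hv 0).2.1 le_rfl s)) hlim
  have hrot : T.HasRot f ω := hF.hasRot_of_seq hinv (fun n => ⟨(hu n).1, (hu n).2.1⟩)
    (fun n => ⟨(hv n).1, (hv n).2.1⟩) hul hvl
    (fun n => hleF _ (hu n).1 (hu n).2.1 (hu n).2.2.1) hge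
  refine ⟨f, hinv, hrot, fun ρ h1 h2 => ⟨hleF ρ h1 h2, fun h3 s => ?_⟩, fun s r h => ?_⟩
  · rcases h3.eq_or_lt with h | h
    · obtain ⟨i, ri, pi⟩ := hF ρ h1 h2
      rw [← h] at ri
      rw [← i.eq_of_le_of_periodic_left hinv (hleF ρ h1 h2 h.ge) ri hrot ρ.den_pos pi]
    · obtain ⟨n, hn⟩ := (hvl.eventually_lt_const h).exists
      exact (hge n s).trans (hF.mono (hv n).1 (by exact_mod_cast hn.le) h2 s)
  · exact hle s r fun n => h _ (hv n).1 (hv n).2.1 (hv n).2.2.2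

/-- There is only one invariant graph at each rotation number. -/
theorem cut_unique (hF : T.IsRationalFamily a b F) {ω : ℝ} (ha : a ≤ ω) (hb : ω ≤ b) {f f' : ℝ → ℝ}
    (hf : T.IsInvariantGraph f) (hf' : T.IsInvariantGraph f') (hc : IsCut a b F f ω)
    (hc' : IsCut a b F f' ω) : f = f' := by
  by_cases hirr : Irrational ω
  · obtain ⟨g, gi, gr, -, gl⟩ := hF.exists_lower ha hb
    -- The lower limit lies below every cut at `ω`, so irrational rigidity for ordered graphs
    -- applies, although two cuts need not be ordered with respect to each other a priori.
    have key : ∀ f, T.IsInvariantGraph f → IsCut a b F f ω → g = f := by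
      intro f hf hc
      refine gi.eq_of_le_of_irrational hf (fun s => gl s _ fun ρ h1 h2 h3 => ?_) gr
        (hF.hasRot_of_isCut hf ha hb hc) hirr
      refine (hc ρ h1 h2).1 ?_ s
      rcases h3 with h | h
      · exact h.le
      · rw [h]; exact ha
    rw [← key f hf hc, ← key f' hf' hc']
  · obtain ⟨ρ, rfl⟩ := not_not.1 hirr
    have h1 : a ≤ ρ := by exact_mod_cast ha
    have h2 : ρ ≤ b := by exact_mod_cast hb
    ext s
    have e1 := (hc ρ h1 h2).1 le_rfl s
    have e2 := (hc ρ h1 h2).2 le_rfl s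
    have e3 := (hc' ρ h1 h2).1 le_rfl s
    have e4 := (hc' ρ h1 h2).2 le_rfl s
    linarith

/-- The invariant graphs of all rotation numbers in `[a, b]` foliate the region between the extreme
ones. -/
theorem c0Integrable (hF : T.IsRationalFamily a b F) (hab : a ≤ b) :
    T.C0IntegrableBetween (graph (F a)) (graph (F b)) := by
  have ia := (hF a le_rfl hab).1
  have ib := (hF b hab le_rfl).1
  refine ⟨{f | T.IsInvariantGraph f ∧ ∃ ω : ℝ, a ≤ ω ∧ ω ≤ b ∧ IsCut a b F f ω}, ?_, ?_⟩
  · rintro f ⟨hf, ω, h1, h2, hc⟩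
    refine ⟨hf, ?_⟩
    rintro ⟨s, r⟩ (hz : r = f s)
    rw [mem_between_graph ia ib, hz]
    exact ⟨(hc a le_rfl hab).1 h1 s, (hc b hab le_rfl).2 h2 s⟩
  · rintro ⟨s, r⟩ hz
    rw [mem_between_graph ia ib] at hz
    obtain ⟨hz1, hz2⟩ := hz
    simp only at hz1 hz2
    -- The Dedekind cut which the phase point makes in the rational family; its supremum is the
    -- rotation number of the leaf through the point.
    let S : Set ℝ := {x | ∃ ρ : ℚ, (ρ : ℝ) = x ∧ a ≤ ρ ∧ ρ ≤ b ∧ F ρ s ≤ r}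
    have haS : (a : ℝ) ∈ S := ⟨a, rfl, le_rfl, hab, hz1⟩
    have hSb : BddAbove S := ⟨b, by rintro _ ⟨ρ, rfl, -, h, -⟩; exact_mod_cast h⟩
    have hω1 : (a : ℝ) ≤ sSup S := le_csSup hSb haS
    have hω2 : sSup S ≤ b :=
      csSup_le ⟨_, haS⟩ (by rintro _ ⟨ρ, rfl, -, h, -⟩; exact_mod_cast h)
    have hlow : ∀ ρ : ℚ, a ≤ ρ → ρ ≤ b → (ρ < sSup S ∨ ρ = a) → F ρ s ≤ r := by
      intro ρ h1 h2 h3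
      rcases h3 with h | h
      · obtain ⟨_, ⟨ρ', rfl, h4, h5, h6⟩, h7⟩ := exists_lt_of_lt_csSup ⟨_, haS⟩ h
        exact (hF.mono h1 (by exact_mod_cast h7.le) h5 s).trans h6
      · rw [h]; exact hz1
    have hupp : ∀ ρ : ℚ, a ≤ ρ → ρ ≤ b → (sSup S < ρ ∨ ρ = b) → r ≤ F ρ s := by
      intro ρ h1 h2 h3
      rcases h3 with h | h
      · by_contra! hc
        exact absurd (le_csSup hSb ⟨ρ, rfl, h1, h2, hc.le⟩) (not_le.2 h)
      · rw [h]; exact hz2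
    obtain ⟨f, fi, -, fc, fl⟩ := hF.exists_lower hω1 hω2
    obtain ⟨f', fi', -, fc', fu⟩ := hF.exists_upper hω1 hω2
    -- The point lies between the lower and the upper limit at this rotation number, which coincide.
    have e := hF.cut_unique hω1 hω2 fi fi' fc fc'
    subst e
    have hfs : r = f s := le_antisymm (fu s r hupp) (fl s r hlow)
    refine ⟨f, ⟨⟨fi, _, hω1, hω2, fc⟩, hfs⟩, ?_⟩
    -- Two rationals between distinct rotation numbers give two strictly ordered members of the
    -- family separating the cuts over every `s`, so leaves are disjoint.
    have key : ∀ {f g : ℝ → ℝ} {ω ω' : ℝ}, a ≤ ω → ω' ≤ b → IsCut a b F f ω → IsCut a b F g ω' →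
        f s = g s → ¬ ω < ω' := by
      intro f g ω ω' h1 h2 h3 h4 h5 h6
      obtain ⟨ρ, hρ1, hρ2⟩ := exists_rat_btwn h6
      obtain ⟨ρ', hρ3, hρ4⟩ := exists_rat_btwn hρ2
      have l1 : a ≤ ρ := by exact_mod_cast h1.trans hρ1.le
      have l2 : ρ < ρ' := by exact_mod_cast hρ3
      have l3 : ρ' ≤ b := by exact_mod_cast hρ4.le.trans h2
      have m1 := (h3 ρ l1 (l2.le.trans l3)).2 hρ1.le s
      have m2 := (h4 ρ' (l1.trans l2.le) l3).1 hρ4.le s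
      have m3 := hF.strictMono l1 l2 l3 s
      linarith
    rintro g ⟨⟨gi, ω, h1, h2, gc⟩, hgs⟩
    have hgs' : r = g s := hgs
    have hfg : f s = g s := hfs.symm.trans hgs'
    have : ω = sSup S := by
      rcases lt_trichotomy ω (sSup S) with h | h | h
      · exact absurd h (key h1 hω2 gc fc hfg.symm)
      · exact h
      · exact absurd h (key hω1 h2 fc gc hfg)
    subst this
    exact hF.cut_unique hω1 hω2 gi fi gc fc

end IsRationalFamily

/-- An invariant graph is determined by the type of its periodic orbits if all its orbits are
periodic. -/
theorem IsInvariantGraph.eq_of_periodic {f₁ f₂ : ℝ → ℝ} (h₁ : T.IsInvariantGraph f₁)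
    (h₂ : T.IsInvariantGraph f₂) {q : ℕ} (hq : 0 < q) {p : ℤ}
    (hp₁ : ∀ s, (T.dyn f₁)^[q] s = s + p * T.L) (hp₂ : ∀ s, (T.dyn f₂)^[q] s = s + p * T.L) :
    f₁ = f₂ := by
  obtain ⟨q, rfl⟩ := Nat.exists_eq_succ_of_ne_zero hq.ne'
  ext s
  rcases lt_trichotomy (f₁ s) (f₂ s) with h | h | h
  · have := (h₁.iterate_dyn_lt h₂ h q).1
    rw [hp₁, hp₂] at this
    exact absurd this (lt_irrefl _)
  · exact h
  · have := (h₂.iterate_dyn_lt h₁ h q).1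
    rw [hp₁, hp₂] at this
    exact absurd this (lt_irrefl _)

theorem RationallyIntegrableOn.c0Integrable {a b : ℚ} (hab : a ≤ b)
    (hR : T.RationallyIntegrableOn a b) {Γ₁ Γ₂ : Set (ℝ × ℝ)} (h₁ : T.IsRotationCurve Γ₁ (a : ℝ))
    (h₂ : T.IsRotationCurve Γ₂ (b : ℝ)) : T.C0IntegrableBetween Γ₁ Γ₂ := by
  have hfam : ∀ ρ : ℚ, ∃ f : ℝ → ℝ, a ≤ ρ → ρ ≤ b → T.IsInvariantGraph f ∧ T.HasRot f ρ ∧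
      ∀ s, (T.dyn f)^[ρ.den] s = s + ρ.num * T.L := by
    intro ρ
    by_cases h : a ≤ ρ ∧ ρ ≤ b
    · obtain ⟨f, -, hf, -, hr⟩ := hR ρ h.1 h.2
      obtain ⟨g, hg, he, hrot, hper⟩ := hr.exists_graph
      exact ⟨g, fun _ _ => ⟨hg, hrot, hper⟩⟩
    · exact ⟨0, fun h1 h2 => absurd ⟨h1, h2⟩ h⟩
  choose F hF using hfam
  obtain ⟨f₁, i₁, rfl, -, p₁⟩ := h₁.exists_graph
  obtain ⟨f₂, i₂, rfl, -, p₂⟩ := h₂.exists_graph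
  obtain ⟨ja, -, pa⟩ := hF a le_rfl hab
  obtain ⟨jb, -, pb⟩ := hF b hab le_rfl
  -- The prescribed boundary curves must be the extreme members of the family: both are fully
  -- periodic of the same type.
  rw [i₁.eq_of_periodic ja a.den_pos p₁ pa, i₂.eq_of_periodic jb b.den_pos p₂ pb]
  exact IsRationalFamily.c0Integrable hF hab

/-! ### Periodic leaves of a foliation by invariant graphs -/

variable (T) in
/-- The billiard map on the phase points which have an image. -/
noncomputable def map (z : ℝ × ℝ) : ℝ × ℝ := (T.bounce z, T.A (T.bounce z) z.1)

theorem bounce_curve_ne {z : ℝ × ℝ} (h : z ∈ T.dom) : T.γ (T.bounce z) ≠ T.γ z.1 :=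
  T.curve_ne (bounce_spec h).1 (bounce_spec h).2.1

theorem continuousAt_map {z : ℝ × ℝ} (h : z ∈ T.dom) : ContinuousAt T.map z :=
  (continuousAt_bounce h).prodMk
    (T.tendsto_A (bounce_curve_ne h).symm (continuousAt_bounce h) continuousAt_fst)

namespace IsInvariantGraph

variable {f f₁ f₂ : ℝ → ℝ}

theorem map_iterate (hf : T.IsInvariantGraph f) (n : ℕ) (s : ℝ) :
    T.map^[n] (s, f s) = ((T.dyn f)^[n] s, f ((T.dyn f)^[n] s)) := by
  induction n with
  | zero => rfl
  | succ n ih =>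
    rw [Function.iterate_succ_apply', ih, Function.iterate_succ_apply', hf.dyn_eq_A]
    rfl

theorem continuousAt_map_iterate (hf : T.IsInvariantGraph f) (n : ℕ) (s : ℝ) :
    ContinuousAt T.map^[n] (s, f s) := by
  induction n with
  | zero => exact continuousAt_id
  | succ n ih =>
    rw [Function.iterate_succ']
    refine ContinuousAt.comp ?_ ih
    rw [hf.map_iterate]
    exact continuousAt_map (hf.mem_dom _)

theorem iterate_mul_gt (hf : T.IsInvariantGraph f) {q : ℕ} {p : ℤ} {s : ℝ}
    (h : s + p * T.L < (T.dyn f)^[q] s) (n : ℕ) :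
    s + (n + 1 : ℕ) * p * T.L < (T.dyn f)^[q * (n + 1)] s := by
  induction n with
  | zero => simpa using h
  | succ n ih =>
    rw [Nat.mul_succ, Function.iterate_add_apply]
    have h1 := (hf.strictMono_dyn.iterate (q * (n + 1))) h
    rw [hf.dyn_iterate_add_int] at h1
    refine lt_trans ?_ h1
    push_cast at ih ⊢
    linarith

theorem iterate_mul_lt (hf : T.IsInvariantGraph f) {q : ℕ} {p : ℤ} {s : ℝ}
    (h : (T.dyn f)^[q] s < s + p * T.L) (n : ℕ) :
    (T.dyn f)^[q * (n + 1)] s < s + (n + 1 : ℕ) * p * T.L := by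
  induction n with
  | zero => simpa using h
  | succ n ih =>
    rw [Nat.mul_succ, Function.iterate_add_apply]
    have h1 := (hf.strictMono_dyn.iterate (q * (n + 1))) h
    rw [hf.dyn_iterate_add_int] at h1
    refine lt_trans h1 ?_
    push_cast at ih ⊢
    linarith

theorem iterate_of_periodic {q : ℕ} {p : ℤ}
    (hp : ∀ s, (T.dyn f)^[q] s = s + p * T.L) (n : ℕ) (s : ℝ) :
    (T.dyn f)^[q * n] s = s + n * p * T.L := by
  induction n with
  | zero => simp
  | succ n ih =>
    rw [Nat.mul_succ, Nat.add_comm, Function.iterate_add_apply, ih, hp]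
    push_cast
    ring

/-- An excess at `s` would persist under iteration by monotonicity. After `ρ.den * ρ'.den` steps it
would contradict the displacement known from the periodicity of type `ρ`. -/
theorem iterate_le_of_periodic (hf : T.IsInvariantGraph f) {ρ ρ' : ℚ}
    (hp : ∀ s, (T.dyn f)^[ρ.den] s = s + ρ.num * T.L) (h : ρ ≤ ρ') (s : ℝ) :
    (T.dyn f)^[ρ'.den] s ≤ s + ρ'.num * T.L := by
  by_contra! hc
  obtain ⟨n, hn⟩ := Nat.exists_eq_succ_of_ne_zero ρ.den_ne_zero
  have h1 := hf.iterate_mul_gt hc n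
  rw [← Nat.succ_eq_add_one, ← hn, mul_comm ρ'.den, iterate_of_periodic hp] at h1
  have h2 : (ρ.num : ℝ) * ρ'.den ≤ ρ'.num * ρ.den := by exact_mod_cast ((Rat.le_iff _ _).1 h)
  have h3 := mul_le_mul_of_nonneg_right h2 T.L_pos.le
  linarith

theorem le_iterate_of_periodic (hf : T.IsInvariantGraph f) {ρ ρ' : ℚ}
    (hp : ∀ s, (T.dyn f)^[ρ.den] s = s + ρ.num * T.L) (h : ρ' ≤ ρ) (s : ℝ) :
    s + ρ'.num * T.L ≤ (T.dyn f)^[ρ'.den] s := by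
  by_contra! hc
  obtain ⟨n, hn⟩ := Nat.exists_eq_succ_of_ne_zero ρ.den_ne_zero
  have h1 := hf.iterate_mul_lt hc n
  rw [← Nat.succ_eq_add_one, ← hn, mul_comm ρ'.den, iterate_of_periodic hp] at h1
  have h2 : (ρ'.num : ℝ) * ρ.den ≤ ρ.num * ρ'.den := by exact_mod_cast ((Rat.le_iff _ _).1 h)
  have h3 := mul_le_mul_of_nonneg_right h2 T.L_pos.le
  linarith

theorem lt_or_gt_of_forall_ne (h₁ : T.IsInvariantGraph f₁) (h₂ : T.IsInvariantGraph f₂)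
    (hne : ∀ s, f₁ s ≠ f₂ s) : (∀ s, f₁ s < f₂ s) ∨ ∀ s, f₂ s < f₁ s := by
  by_contra! hc
  obtain ⟨⟨x, hx⟩, y, hy⟩ := hc
  have hcont : Continuous fun x => f₁ x - f₂ x := h₁.1.sub h₂.1
  have : (0 : ℝ) ∈ (fun x => f₁ x - f₂ x) '' univ :=
    isPreconnected_univ.intermediate_value (mem_univ y) (mem_univ x) hcont.continuousOn
      ⟨by simpa using hy, by simpa using hx⟩
  obtain ⟨z, -, hz⟩ := this
  exact hne z (sub_eq_zero.1 hz)

end IsInvariantGraph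

/-- In a foliation by invariant graphs there is a leaf of periodic orbits for each rational rotation
number. -/
theorem C0IntegrableBetween.exists_periodic_leaf {f₁ f₂ : ℝ → ℝ} {ρ₁ ρ₂ ρ : ℚ}
    (hC : T.C0IntegrableBetween (graph f₁) (graph f₂))
    (h₁ : T.IsInvariantGraph f₁) (h₂ : T.IsInvariantGraph f₂) (hle : ∀ s, f₁ s ≤ f₂ s)
    (hp₁ : ∀ s, (T.dyn f₁)^[ρ₁.den] s = s + ρ₁.num * T.L)
    (hp₂ : ∀ s, (T.dyn f₂)^[ρ₂.den] s = s + ρ₂.num * T.L) (hρ₁ : ρ₁ ≤ ρ) (hρ₂ : ρ ≤ ρ₂) :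
    ∃ f, T.IsInvariantGraph f ∧ ∀ s, (T.dyn f)^[ρ.den] s = s + ρ.num * T.L := by
  obtain ⟨leaves, hl, hu⟩ := hC
  have hleaf : ∀ s r, f₁ s ≤ r → r ≤ f₂ s → ∃ f ∈ leaves, f s = r := by
    intro s r hr1 hr2
    obtain ⟨f, ⟨hf, hfz⟩, -⟩ := hu (s, r) ((mem_between_graph h₁ h₂ _).2 ⟨hr1, hr2⟩)
    exact ⟨f, hf, Eq.symm hfz⟩
  have hper : ∀ s, ∃ f ∈ leaves, (T.dyn f)^[ρ.den] s = s + ρ.num * T.L := by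
    intro s
    -- Shooting along the vertical fibre. Every point between the extreme graphs lies on a leaf, so
    -- all iterates are defined and continuous there.
    have hc : ContinuousOn (fun r => (T.map^[ρ.den] (s, r)).1) (Icc (f₁ s) (f₂ s)) := by
      intro r hr
      obtain ⟨f, hf, rfl⟩ := hleaf s r hr.1 hr.2
      refine (ContinuousAt.comp (f := fun r => T.map^[ρ.den] (s, r)) continuousAt_fst
        (ContinuousAt.comp (f := fun r => (s, r)) ?_ ?_)).continuousWithinAt
      · exact (hl f hf).1.continuousAt_map_iterate _ s
      · fun_prop
    have hmem : s + ρ.num * T.L ∈ Icc (T.map^[ρ.den] (s, f₁ s)).1 (T.map^[ρ.den] (s, f₂ s)).1 := by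
      rw [h₁.map_iterate, h₂.map_iterate]
      exact ⟨h₁.iterate_le_of_periodic hp₁ hρ₁ s, h₂.le_iterate_of_periodic hp₂ hρ₂ s⟩
    obtain ⟨r, hr, hre⟩ := intermediate_value_Icc (hle s) hc hmem
    obtain ⟨f, hf, rfl⟩ := hleaf s r hr.1 hr.2
    simp only [(hl f hf).1.map_iterate] at hre
    exact ⟨f, hf, hre⟩
  obtain ⟨f, hf, hf0⟩ := hper 0
  refine ⟨f, (hl f hf).1, fun s => ?_⟩
  obtain ⟨g, hg, hgs⟩ := hper s
  have hfi := (hl f hf).1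
  have hgi := (hl g hg).1
  -- The leaf found over `s` is the one found over `0`: disjoint leaves are ordered and cannot both
  -- have periodic points of this type, and leaves which meet are equal.
  by_cases hne : ∀ x, f x ≠ g x
  · exfalso
    rcases hfi.lt_or_gt_of_forall_ne hgi hne with h | h
    · exact hfi.not_both_periodic hgi h ρ.den_pos hf0 hgs
    · exact hgi.not_both_periodic hfi h ρ.den_pos hgs hf0
  · push Not at hne
    obtain ⟨x, hx⟩ := hne
    have hz : (x, f x) ∈ graph f := rfl
    have he : f = g := (hu (x, f x) ((hl f hf).2 hz)).unique ⟨hf, hz⟩ ⟨hg, hx⟩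
    rw [he]
    exact hgs

/-- The dynamics on an invariant graph which consists of periodic orbits is conjugate to a
rotation. -/
theorem IsInvariantGraph.isRotationCurve {f : ℝ → ℝ} (hf : T.IsInvariantGraph f) {ρ : ℚ}
    (hp : ∀ s, (T.dyn f)^[ρ.den] s = s + ρ.num * T.L) : T.IsRotationCurve (graph f) (ρ : ℝ) := by
  have hL := T.L_pos
  have hq : (0 : ℝ) < ρ.den := by exact_mod_cast ρ.den_pos
  have hmono := hf.strictMono_dyn
  set g := T.dyn f with hg
  -- The conjugacy: the normalized position, corrected by the rotation and averaged over a period.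
  -- Averaging preserves monotonicity, and in `τ ∘ g` the sum only exchanges its first term for one
  -- `ρ.num` turns further.
  set τ : ℝ → ℝ := fun s => (∑ j ∈ Finset.range ρ.den, (g^[j] s / T.L - j * ρ)) / ρ.den with hτ
  have hτc : Continuous τ := by
    refine Continuous.div_const (continuous_finsetSum _ fun j _ => ?_) _
    exact ((hf.continuous_dyn.iterate j).div_const _).sub continuous_const
  have hτm : StrictMono τ := by
    intro x y hxy
    refine div_lt_div_of_pos_right (Finset.sum_lt_sum_of_nonempty ?_ fun j _ => ?_) hq
    · exact Finset.nonempty_range_iff.2 ρ.den_ne_zero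
    · exact sub_lt_sub_right (div_lt_div_of_pos_right ((hmono.iterate j) hxy) hL) _
  have hτL : ∀ s, τ (s + T.L) = τ s + 1 := by
    intro s
    simp only [hτ]
    have : ∀ j ∈ Finset.range ρ.den, g^[j] (s + T.L) / T.L - j * ρ = (g^[j] s / T.L - j * ρ) + 1 := by
      intro j _
      rw [hf.dyn_iterate_add, add_div, div_self hL.ne']
      ring
    rw [Finset.sum_congr rfl this, Finset.sum_add_distrib]
    simp only [Finset.sum_const, Finset.card_range, nsmul_eq_mul, mul_one]
    rw [add_div, div_self hq.ne']
  have hτg : ∀ s, τ (g s) = τ s + ρ := by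
    intro s
    have e1 := Finset.sum_range_succ (fun j => g^[j] s / T.L) ρ.den
    have e2 := Finset.sum_range_succ' (fun j => g^[j] s / T.L) ρ.den
    simp only [hτ, Finset.sum_sub_distrib, ← Function.iterate_succ_apply]
    simp only [Function.iterate_zero, id] at e2
    rw [e1, hp s] at e2
    have e3 : (s + ρ.num * T.L) / T.L = s / T.L + ρ.num := by field_simp
    rw [e3] at e2
    have e4 : (ρ.den : ℝ) * (ρ : ℝ) = ρ.num := by exact_mod_cast Rat.den_mul_eq_num ρ
    rw [div_eq_iff hq.ne', add_mul, div_mul_cancel₀ _ hq.ne']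
    linarith
  have hsurj : Function.Surjective τ := by
    have := surjective_of_add_one (x := fun t => τ (t * T.L)) zero_lt_one (by fun_prop)
      (fun t => by rw [add_mul, one_mul, hτL])
    intro y
    obtain ⟨t, ht⟩ := this y
    exact ⟨_, ht⟩
  let e := hτm.orderIsoOfSurjective τ hsurj
  have hτe : ∀ t, τ (e.symm t) = t := fun t => e.apply_symm_apply t
  refine ⟨fun t => (e.symm t, f (e.symm t)), ?_, ?_, ?_, ?_, ?_⟩
  · exact e.symm.continuous.prodMk (hf.1.comp e.symm.continuous)
  · intro a b hab
    exact e.symm.injective (congrArg Prod.fst hab)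
  · ext ⟨s, r⟩
    constructor
    · rintro ⟨t, ht⟩
      rw [Prod.mk.injEq] at ht
      show r = f s
      rw [← ht.2, ht.1]
    · intro hz
      have hr : r = f s := hz
      refine ⟨τ s, ?_⟩
      have : e.symm (τ s) = s := e.symm_apply_apply s
      simp only [this, hr]
  · intro t
    have : e.symm (t + 1) = e.symm t + T.L := hτm.injective (by rw [hτe, hτL, hτe])
    simp only [this, hf.2.1 (e.symm t), Prod.mk_add_mk, add_zero]
  · intro t
    have : e.symm (t + ρ) = g (e.symm t) := hτm.injective (by rw [hτe, hτg, hτe])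
    simp only [this]
    exact hf.step _

end ConvexTable

/-- A continuous solution of an implicit equation is smooth. -/
theorem ContDiffAt.of_implicit {E : Type*} [NormedAddCommGroup E] [NormedSpace ℝ E]
    [CompleteSpace E] {φ : E × ℝ → ℝ} {Y : E → ℝ} {x₀ : E} {n : WithTop ℕ∞} (hn : n ≠ 0) {d : ℝ}
    (hφ : ContDiffAt ℝ n φ (x₀, Y x₀)) (hd : HasDerivAt (fun y => φ (x₀, y)) d (Y x₀))
    (hd0 : d ≠ 0) (hY : ContinuousAt Y x₀) (he : ∀ᶠ x in 𝓝 x₀, φ (x, Y x) = φ (x₀, Y x₀)) :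
    ContDiffAt ℝ n Y x₀ := by
  have hinv : (fderiv ℝ φ (x₀, Y x₀) ∘L .inr ℝ E ℝ).IsInvertible := by
    refine ⟨ContinuousLinearEquiv.unitsEquivAut ℝ (Units.mk0 d hd0), ?_⟩
    have h1 : HasDerivAt (fun y => φ (x₀, y)) (fderiv ℝ φ (x₀, Y x₀) (0, 1)) (Y x₀) :=
      ((hφ.differentiableAt hn).hasFDerivAt).comp_hasDerivAt (Y x₀)
        ((hasDerivAt_const (Y x₀) x₀).prodMk (hasDerivAt_id (Y x₀)))
    ext
    simp [hd.unique h1]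
  refine (hφ.contDiffAt_implicitFunction hn hinv).congr_of_eventuallyEq ?_
  have h2 : Tendsto (fun x => (x, Y x)) (𝓝 x₀) (𝓝 (x₀, Y x₀)) := continuousAt_id.prodMk hY
  filter_upwards [he, h2.eventually (hφ.eventually_apply_eq_iff_implicitFunction hn hinv)]
    with x h3 h4
  exact (h4.1 h3).symm

namespace ConvexTable

variable {k : ℕ∞} {T : ConvexTable k}

/-! ### Smoothness of periodic invariant graphs -/

theorem contDiffAt_bounce {z : ℝ × ℝ} (h : z ∈ T.dom) :
    ContDiffAt ℝ ((k + 1 : ℕ∞) : WithTop ℕ∞) T.bounce z := by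
  have hb := bounce_spec h
  have hne := bounce_curve_ne h
  have hA : ContDiffAt ℝ ((k + 1 : ℕ∞) : WithTop ℕ∞)
      (fun p : (ℝ × ℝ) × ℝ => T.A p.1.1 p.2) (z, T.bounce z) :=
    ContDiffAt.comp (g := fun p : ℝ × ℝ => T.A p.1 p.2) (f := fun p : (ℝ × ℝ) × ℝ => (p.1.1, p.2))
      (z, T.bounce z) (T.contDiffAt_A hne) (by fun_prop)
  refine ContDiffAt.of_implicit (φ := fun p : (ℝ × ℝ) × ℝ => T.A p.1.1 p.2 + p.1.2) order_ne_zero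
    (hA.add (by fun_prop)) ((T.hasDerivAt_A_right hne).add_const z.2)
    (T.A_deriv_neg hb.1 hb.2.1).ne (continuousAt_bounce h) ?_
  filter_upwards [dom_mem_nhds h] with w hw
  rw [(bounce_spec hw).2.2, hb.2.2, add_neg_cancel, add_neg_cancel]

theorem contDiffAt_map {z : ℝ × ℝ} (h : z ∈ T.dom) :
    ContDiffAt ℝ ((k + 1 : ℕ∞) : WithTop ℕ∞) T.map z := by
  refine (contDiffAt_bounce h).prodMk ?_
  exact ContDiffAt.comp (g := fun p : ℝ × ℝ => T.A p.1 p.2)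
    (f := fun z : ℝ × ℝ => (T.bounce z, z.1)) z
    (T.contDiffAt_A (bounce_curve_ne h).symm) ((contDiffAt_bounce h).prodMk contDiffAt_fst)

/-- Near a chord, `A` is Lipschitz. -/
theorem exists_lipschitz_A {p : ℝ × ℝ} (h : T.γ p.2 ≠ T.γ p.1) : ∃ K : ℝ, 0 < K ∧ ∃ t ∈ 𝓝 p,
    ∀ x ∈ t, ∀ y ∈ t, |T.A x.1 x.2 - T.A y.1 y.2| ≤ K * dist x y := by
  obtain ⟨K, t, ht, hK⟩ := ((T.contDiffAt_A h).of_le one_le_order).exists_lipschitzOnWith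
  refine ⟨K + 1, by positivity, t, ht, fun x hx y hy => ?_⟩
  have := hK.dist_le_mul x hx y hy
  rw [Real.dist_eq] at this
  refine this.trans ?_
  have := dist_nonneg (x := x) (y := y)
  linarith

namespace IsInvariantGraph

variable {f : ℝ → ℝ}

theorem contDiffAt_map_iterate (hf : T.IsInvariantGraph f) (n : ℕ) (s : ℝ) :
    ContDiffAt ℝ ((k + 1 : ℕ∞) : WithTop ℕ∞) T.map^[n] (s, f s) := by
  induction n with
  | zero => exact contDiffAt_id
  | succ n ih =>
    rw [Function.iterate_succ']
    refine ContDiffAt.comp _ ?_ ih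
    rw [hf.map_iterate]
    exact contDiffAt_map (hf.mem_dom _)

/-- The dynamics on an invariant graph expands at least linearly to the right. -/
theorem exists_expansion (hf : T.IsInvariantGraph f) (x : ℝ) :
    ∃ c : ℝ, 0 < c ∧ ∀ᶠ δ in 𝓝[>] (0 : ℝ), T.dyn f x + c * δ ≤ T.dyn f (x + δ) := by
  set g := T.dyn f with hg
  set y := g x with hy
  have hx1 : x < y := hf.lt_dyn x
  have hx2 : y < x + T.L := hf.dyn_lt x
  have hn1 : T.γ x ≠ T.γ y := (hf.dyn_ne x).symm
  have hn2 : T.γ (g y) ≠ T.γ y := hf.dyn_ne y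
  obtain ⟨K₁, hK₁, t₁, ht₁, hl₁⟩ := exists_lipschitz_A (T := T) (p := (y, x)) hn1
  obtain ⟨K₂, hK₂, t₂, ht₂, hl₂⟩ := exists_lipschitz_A (T := T) (p := (y, g y)) hn2
  set d := -(T.cr y x * T.cr x y) / ‖T.γ x - T.γ y‖ ^ 3 with hd
  have hdneg : d < 0 := by
    have hnn : 0 < ‖T.γ x - T.γ y‖ := norm_pos_iff.2 (sub_ne_zero.2 hn1)
    exact div_neg_of_neg_of_pos (neg_neg_of_pos (mul_pos (T.cr_pos' hx1 hx2) (T.cr_pos hx1 hx2)))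
      (pow_pos hnn 3)
  have hder : HasDerivAt (fun u => T.A y u) d x := T.hasDerivAt_A_right hn1
  have hid : Tendsto (fun δ : ℝ => x + δ) (𝓝[>] 0) (𝓝[>] x) := by
    refine tendsto_nhdsWithin_iff.2 ⟨?_, ?_⟩
    · have : Tendsto (fun δ : ℝ => x + δ) (𝓝 0) (𝓝 (x + 0)) := (continuous_const.add continuous_id).tendsto 0
      rw [add_zero] at this
      exact this.mono_left nhdsWithin_le_nhds
    · filter_upwards [self_mem_nhdsWithin] with δ hδ
      have : (0 : ℝ) < δ := hδ
      show x < x + δ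
      linarith
  have hid' : Tendsto (fun δ : ℝ => x + δ) (𝓝[>] 0) (𝓝 x) := hid.mono_right nhdsWithin_le_nhds
  have hgt : Tendsto (fun δ : ℝ => g (x + δ)) (𝓝[>] 0) (𝓝 y) :=
    (hf.continuous_dyn.tendsto x).comp hid'
  have hslope := ((hasDerivAt_iff_tendsto_slope.1 hder).mono_left
    (nhdsWithin_mono x (fun z (hz : x < z) => hz.ne'))).comp hid
  have hyy : y < g y := hf.lt_dyn y
  -- At `y = g x` the reflection law reads `A y x + A y (g y) = 0`. Moving `x` by `δ` lowers the
  -- first term by at least `|d| δ / 2`; moving `y` must compensate, at a rate of at most `K₁ + K₂`.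
  -- No derivative of `f` is needed.
  refine ⟨-(d / 2) / (K₁ + K₂), div_pos (by linarith) (by linarith), ?_⟩
  filter_upwards [hslope.eventually (gt_mem_nhds (show d < d / 2 by linarith)),
    (hgt.prodMk_nhds hid').eventually ht₁, (tendsto_const_nhds.prodMk_nhds hid').eventually ht₁,
    (hgt.prodMk_nhds tendsto_const_nhds).eventually ht₂, hgt.eventually_lt_const hyy,
    self_mem_nhdsWithin] with δ h1 h2 h3 h4 h5 h6
  have hδ : 0 < δ := h6
  have hη : y < g (x + δ) := hf.strictMono_dyn (by linarith)
  have e1 := hf.dyn_eq_A x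
  have e2 := hf.dyn_eq_A (x + δ)
  have e3 := hf.eq_neg_A y
  have e4 := hf.eq_neg_A (g (x + δ))
  have m1 := hl₁ _ h2 _ h3
  have m2 := hl₂ _ h4 _ (mem_of_mem_nhds ht₂)
  simp only [Prod.dist_eq, dist_self, Real.dist_eq] at m1 m2
  rw [abs_of_pos (sub_pos.2 hη), max_eq_left (sub_pos.2 hη).le] at m1 m2
  have m1' := (abs_le.1 m1).2
  have m2' := (abs_le.1 m2).2
  have m3 : T.A (g (x + δ)) (g (g (x + δ))) < T.A (g (x + δ)) (g y) :=
    T.A_lt h5 (hf.strictMono_dyn hη) (hf.dyn_lt _)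
  simp only [Function.comp_apply, slope_def_field, add_sub_cancel_left] at h1
  rw [div_lt_iff₀ hδ] at h1
  have h7 : -(d / 2) * δ ≤ (K₁ + K₂) * (g (x + δ) - y) := by
    linarith
  rw [div_mul_eq_mul_div, ← le_sub_iff_add_le', div_le_iff₀ (by linarith)]
  linarith

/-- Vertical displacements from an invariant graph are carried to the right by all iterates. -/
theorem exists_twist (hf : T.IsInvariantGraph f) (n : ℕ) (s : ℝ) :
    ∃ c : ℝ, 0 < c ∧ ∀ᶠ ε in 𝓝[>] (0 : ℝ),
      f (T.map^[n + 1] (s, f s + ε)).1 < (T.map^[n + 1] (s, f s + ε)).2 ∧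
      (T.dyn f)^[n + 1] s + c * ε ≤ (T.map^[n + 1] (s, f s + ε)).1 := by
  have hvert : Tendsto (fun ε : ℝ => (s, f s + ε)) (𝓝[>] 0) (𝓝 (s, f s)) := by
    have : Tendsto (fun ε : ℝ => (s, f s + ε)) (𝓝 0) (𝓝 (s, f s + 0)) :=
      (by fun_prop : Continuous fun ε : ℝ => (s, f s + ε)).tendsto 0
    rw [add_zero] at this
    exact this.mono_left nhdsWithin_le_nhds
  induction n with
  | zero =>
    set y := T.dyn f s with hy
    set d := -(T.cr s y * T.cr y s) / ‖T.γ y - T.γ s‖ ^ 3 with hd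
    have hdneg : d < 0 := T.A_deriv_neg (hf.lt_dyn s) (hf.dyn_lt s)
    have hder : HasDerivAt (fun u => T.A s u) d y := T.hasDerivAt_A_right (hf.dyn_ne s)
    have hb : Tendsto (fun ε : ℝ => T.bounce (s, f s + ε)) (𝓝[>] 0) (𝓝[>] y) := by
      refine tendsto_nhdsWithin_iff.2 ⟨?_, ?_⟩
      · exact (continuousAt_bounce (hf.mem_dom s)).tendsto.comp hvert
      · filter_upwards [hvert.eventually (dom_mem_nhds (hf.mem_dom s)), self_mem_nhdsWithin]
          with ε h1 h2
        have : (0 : ℝ) < ε := h2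
        exact bounce_lt_bounce (hf.mem_dom s) h1 (by linarith)
    have hslope := ((hasDerivAt_iff_tendsto_slope.1 hder).mono_left
      (nhdsWithin_mono y (fun z (hz : y < z) => hz.ne'))).comp hb
    -- Raising `r` by `ε` lowers `A s` by `ε` at the bounce. Its slope near `y` exceeds `2d`, hence
    -- is less than `2|d|` in size, so the bounce moves by at least `ε / (2|d|)`.
    refine ⟨1 / -(2 * d), one_div_pos.2 (by linarith), ?_⟩
    filter_upwards [hslope.eventually (lt_mem_nhds (show 2 * d < d by linarith)),
      hvert.eventually (dom_mem_nhds (hf.mem_dom s)), self_mem_nhdsWithin] with ε h1 h2 h3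
    have hε : (0 : ℝ) < ε := h3
    obtain ⟨a1, a2⟩ := hf.above_step (step_bounce h2) (by linarith : f s < f s + ε)
    refine ⟨a2, ?_⟩
    have e1 := hf.eq_neg_A s
    have e2 := (bounce_spec h2).2.2
    simp only [Function.comp_apply, slope_def_field] at h1 e2
    have a1' : 0 < T.bounce (s, f s + ε) - y := sub_pos.2 a1
    rw [lt_div_iff₀ a1'] at h1
    show y + 1 / -(2 * d) * ε ≤ T.bounce (s, f s + ε)
    rw [div_mul_eq_mul_div, one_mul, ← le_sub_iff_add_le', div_le_iff₀ (by linarith)]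
    linarith
  | succ n ih =>
    obtain ⟨c, hc, ih⟩ := ih
    obtain ⟨c', hc', hexp⟩ := hf.exists_expansion ((T.dyn f)^[n + 1] s)
    have hcε : Tendsto (fun ε : ℝ => c * ε) (𝓝[>] 0) (𝓝[>] 0) := by
      refine tendsto_nhdsWithin_iff.2 ⟨?_, ?_⟩
      · have : Tendsto (fun ε : ℝ => c * ε) (𝓝 0) (𝓝 (c * 0)) := (continuous_const_mul c).tendsto 0
        rw [mul_zero] at this
        exact this.mono_left nhdsWithin_le_nhds
      · filter_upwards [self_mem_nhdsWithin] with ε hε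
        exact mul_pos hc hε
    have hdom : ∀ᶠ ε in 𝓝[>] (0 : ℝ), T.map^[n + 1] (s, f s + ε) ∈ T.dom := by
      have h1 := (hf.continuousAt_map_iterate (n + 1) s).tendsto.comp hvert
      refine h1.eventually ?_
      rw [hf.map_iterate]
      exact dom_mem_nhds (hf.mem_dom _)
    -- The displaced orbit stays above the graph, so each step takes it at least as far as the graph
    -- dynamics, which expands the horizontal lead by the factor `c'`.
    refine ⟨c' * c, mul_pos hc' hc, ?_⟩
    filter_upwards [ih, hcε.eventually hexp, hdom] with ε h1 h2 h3
    rw [Function.iterate_succ_apply' _ (n + 1), Function.iterate_succ_apply' _ (n + 1)]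
    generalize T.map^[n + 1] (s, f s + ε) = z at h1 h3 ⊢
    obtain ⟨a1, a2⟩ := hf.above_step (step_bounce h3) h1.1
    refine ⟨a2, ?_⟩
    have a3 := hf.strictMono_dyn.monotone h1.2
    have a4 : T.bounce z = (T.map z).1 := rfl
    rw [← a4]
    linarith

theorem pos_of_eventually_le {u : ℝ → ℝ} {u' c x : ℝ} (hu : HasDerivAt u u' x) (hc : 0 < c)
    (h : ∀ᶠ δ in 𝓝[>] (0 : ℝ), u x + c * δ ≤ u (x + δ)) : 0 < u' := by
  have h1 : Tendsto (fun δ : ℝ => δ⁻¹ • (u (x + δ) - u x)) (𝓝[>] 0) (𝓝 u') :=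
    (hasDerivAt_iff_tendsto_slope_zero.1 hu).mono_left
      (nhdsWithin_mono 0 (fun z (hz : 0 < z) => hz.ne'))
  refine lt_of_lt_of_le hc (ge_of_tendsto h1 ?_)
  filter_upwards [h, self_mem_nhdsWithin] with δ h2 h3
  have hδ : (0 : ℝ) < δ := h3
  rw [smul_eq_mul, inv_mul_eq_div, le_div_iff₀ hδ]
  linarith

/-- An invariant graph which consists of periodic orbits is smooth. -/
theorem contDiff_of_periodic (hf : T.IsInvariantGraph f) {q : ℕ} (hq : 0 < q) {p : ℤ}
    (hp : ∀ s, (T.dyn f)^[q] s = s + p * T.L) :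
    ContDiff ℝ ((k + 1 : ℕ∞) : WithTop ℕ∞) f := by
  obtain ⟨n, rfl⟩ := Nat.exists_eq_succ_of_ne_zero hq.ne'
  refine contDiff_iff_contDiffAt.2 fun s => ?_
  have hcd : ContDiffAt ℝ ((k + 1 : ℕ∞) : WithTop ℕ∞)
      (fun z : ℝ × ℝ => (T.map^[n + 1] z).1 - z.1) (s, f s) :=
    (contDiffAt_fst.comp (s, f s) (hf.contDiffAt_map_iterate (n + 1) s)).sub contDiffAt_fst
  have hdiff : HasDerivAt (fun r => (T.map^[n + 1] (s, r)).1 - s)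
      (deriv (fun r => (T.map^[n + 1] (s, r)).1 - s) (f s)) (f s) := by
    refine DifferentiableAt.hasDerivAt ?_
    exact (hcd.differentiableAt order_ne_zero).comp (f s)
      (f := fun r => (s, r)) (by fun_prop)
  -- The graph solves `(map^q (s, r)).1 - s = p L`, and the twist of the iterate makes the
  -- derivative in `r` positive.
  refine ContDiffAt.of_implicit order_ne_zero hcd hdiff ?_ hf.1.continuousAt ?_
  · obtain ⟨c, hc, h⟩ := hf.exists_twist n s
    refine (pos_of_eventually_le hdiff hc ?_).ne'
    filter_upwards [h] with ε hε
    rw [hf.map_iterate]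
    linarith [hε.2]
  · refine Eventually.of_forall fun x => ?_
    simp only [hf.map_iterate]
    rw [Nat.succ_eq_add_one] at hp
    rw [hp, hp]
    ring

theorem contDiff_dyn (hf : T.IsInvariantGraph f)
    (hs : ContDiff ℝ ((k + 1 : ℕ∞) : WithTop ℕ∞) f) :
    ContDiff ℝ ((k + 1 : ℕ∞) : WithTop ℕ∞) (T.dyn f) :=
  contDiff_iff_contDiffAt.2 fun s => ContDiffAt.comp (f := fun s => (s, f s)) s
    (contDiffAt_bounce (hf.mem_dom s)) (contDiffAt_id.prodMk hs.contDiffAt)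

/-! ### The caustic as an envelope of rays -/

/-- A smooth invariant graph has a caustic. -/
theorem exists_caustic (hf : T.IsInvariantGraph f) (hk : 1 ≤ k)
    (hs : ContDiff ℝ ((k + 1 : ℕ∞) : WithTop ℕ∞) f) : ∃ c, T.IsCaustic f c := by
  have hg := hf.contDiff_dyn hs
  set g := T.dyn f with hgdef
  have hk0 : (k : WithTop ℕ∞) ≠ 0 := by
    have : k ≠ 0 := by rintro rfl; simp at hk
    exact_mod_cast this
  have hkk : (k : WithTop ℕ∞) ≤ ((k + 1 : ℕ∞) : WithTop ℕ∞) := by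
    exact_mod_cast (le_self_add : k ≤ k + 1)
  have hg' : ContDiff ℝ (k : WithTop ℕ∞) (deriv g) := by
    have e : ((k + 1 : ℕ∞) : WithTop ℕ∞) = (k : WithTop ℕ∞) + 1 := by push_cast; rfl
    rw [e] at hg
    exact (contDiff_succ_iff_deriv.1 hg).2.2
  have hgd : ∀ s, HasDerivAt g (deriv g s) s := fun s =>
    ((hg.differentiable order_ne_zero) s).hasDerivAt
  -- Strict positivity of `g'` is what puts the tangency point strictly inside the chord.
  have hgpos : ∀ s, 0 < deriv g s := fun s => by
    obtain ⟨c, hc, h⟩ := hf.exists_expansion s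
    exact pos_of_eventually_le (hgd s) hc h
  have ha : ∀ s, 0 < T.cr s (g s) := fun s => T.cr_pos (hf.lt_dyn s) (hf.dyn_lt s)
  have hb : ∀ s, 0 < T.cr (g s) s := fun s => T.cr_pos' (hf.lt_dyn s) (hf.dyn_lt s)
  have hden : ∀ s, 0 < T.cr s (g s) + deriv g s * T.cr (g s) s := fun s =>
    add_pos (ha s) (mul_pos (hgpos s) (hb s))
  -- For the point at fraction `μ` of the chord, the cross product of its velocity with the chord is
  -- `(1 - μ) cr s (g s) - μ g' cr (g s) s`; this is the `μ` that makes it vanish.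
  set μ : ℝ → ℝ := fun s => T.cr s (g s) / (T.cr s (g s) + deriv g s * T.cr (g s) s) with hμ
  have hμ0 : ∀ s, 0 < μ s := fun s => div_pos (ha s) (hden s)
  have hμ1 : ∀ s, μ s < 1 := fun s =>
    (div_lt_one (hden s)).2 (lt_add_of_pos_right _ (mul_pos (hgpos s) (hb s)))
  have sγ : ContDiff ℝ (k : WithTop ℕ∞) T.γ := T.contDiff_curve.of_le hkk
  have sτ : ContDiff ℝ (k : WithTop ℕ∞) (deriv T.γ) := T.contDiff_deriv.of_le hkk
  have sg : ContDiff ℝ (k : WithTop ℕ∞) g := hg.of_le hkk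
  have sγg : ContDiff ℝ (k : WithTop ℕ∞) fun s => T.γ (g s) := sγ.comp sg
  have sτg : ContDiff ℝ (k : WithTop ℕ∞) fun s => deriv T.γ (g s) := sτ.comp sg
  have hcoord : ∀ {v : ℝ → EuclideanSpace ℝ (Fin 2)}, ContDiff ℝ (k : WithTop ℕ∞) v →
      ∀ i, ContDiff ℝ (k : WithTop ℕ∞) fun s => v s i := fun hv i =>
    (contDiff_euclidean.1 hv) i
  have sa : ContDiff ℝ (k : WithTop ℕ∞) fun s => T.cr s (g s) :=
    ((hcoord sτ 0).mul ((hcoord sγg 1).sub (hcoord sγ 1))).sub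
      ((hcoord sτ 1).mul ((hcoord sγg 0).sub (hcoord sγ 0)))
  have sb : ContDiff ℝ (k : WithTop ℕ∞) fun s => T.cr (g s) s :=
    ((hcoord sτg 0).mul ((hcoord sγ 1).sub (hcoord sγg 1))).sub
      ((hcoord sτg 1).mul ((hcoord sγ 0).sub (hcoord sγg 0)))
  have sμ : ContDiff ℝ (k : WithTop ℕ∞) μ := sa.div (sa.add (hg'.mul sb)) fun s => (hden s).ne'
  refine ⟨fun s => T.γ s + μ s • (T.γ (g s) - T.γ s), sγ.add (sμ.smul (sγg.sub sγ)), ?_, ?_⟩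
  · intro s
    have e1 : g (s + T.L) = g s + T.L := hf.dyn_add s
    have e2 : deriv g (s + T.L) = deriv g s := by
      have h1 : HasDerivAt (fun s => g (s + T.L)) (deriv g (s + T.L)) s :=
        (hgd (s + T.L)).comp_add_const s T.L
      have h2 : (fun s => g (s + T.L)) = fun s => g s + T.L := funext hf.dyn_add
      rw [h2] at h1
      exact h1.unique ((hgd s).add_const T.L)
    simp only [hμ, e1, e2, cr, T.periodic s, T.periodic (g s), T.tangent_periodic s,
      T.tangent_periodic (g s)]
  · intro s s₁ hst
    obtain ⟨rfl, -⟩ := hf.dyn_eq_of_step hst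
    rw [← hgdef]
    refine ⟨⟨1 - μ s, μ s, by linarith [hμ1 s], hμ0 s, by ring, ?_⟩, ?_⟩
    · simp only [sub_smul, one_smul, smul_sub]
      abel
    · have hμd := ((sμ.differentiable hk0) s).hasDerivAt
      have hγgd : HasDerivAt (fun s => T.γ (g s)) (deriv g s • deriv T.γ (g s)) s :=
        (T.hasDerivAt_curve (g s)).scomp s (hgd s)
      have hγd := T.hasDerivAt_curve s
      have hcd := hγd.add (hμd.smul (hγgd.sub hγd))
      have hcd' : deriv (fun s => T.γ s + μ s • (T.γ (g s) - T.γ s)) s = _ := hcd.deriv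
      rw [hcd']
      have hμe : μ s * (T.cr s (g s) + deriv g s * T.cr (g s) s) = T.cr s (g s) :=
        div_mul_cancel₀ _ (hden s).ne'
      set D := T.γ (g s) - T.γ s with hD
      have hpar : ∀ v : EuclideanSpace ℝ (Fin 2), v 0 * D 1 - v 1 * D 0 = 0 → ∃ a : ℝ, v = a • D := by
        intro v hv
        have hD0 : D ≠ 0 := sub_ne_zero.2 (hf.dyn_ne s)
        have hne : D 0 ≠ 0 ∨ D 1 ≠ 0 := by
          by_contra! h
          refine hD0 ?_
          ext i; fin_cases i
          · exact h.1
          · exact h.2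
        rcases hne with h | h
        · refine ⟨v 0 / D 0, ?_⟩
          ext i; fin_cases i
          · simp [h]
          · simp only [Fin.mk_one, PiLp.smul_apply, smul_eq_mul]
            field_simp
            linarith
        · refine ⟨v 1 / D 1, ?_⟩
          ext i; fin_cases i
          · simp only [Fin.zero_eta, PiLp.smul_apply, smul_eq_mul]
            field_simp
            linarith
          · simp [h]
      refine hpar _ ?_
      simp only [Pi.sub_apply, PiLp.add_apply, PiLp.smul_apply, PiLp.sub_apply, smul_eq_mul, hD, cr] at hμe ⊢
      linear_combination -hμe

end IsInvariantGraph

theorem C0IntegrableBetween.rationallyIntegrable {a b : ℚ} (hab : a < b) (hk : 1 ≤ k)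
    {Γ₁ Γ₂ : Set (ℝ × ℝ)} (hC : T.C0IntegrableBetween Γ₁ Γ₂) (h₁ : T.IsRotationCurve Γ₁ (a : ℝ))
    (h₂ : T.IsRotationCurve Γ₂ (b : ℝ)) : T.RationallyIntegrableOn a b := by
  intro ρ hρ₁ hρ₂
  obtain ⟨f₁, i₁, rfl, r₁, p₁⟩ := h₁.exists_graph
  obtain ⟨f₂, i₂, rfl, r₂, p₂⟩ := h₂.exists_graph
  have hlt := i₁.lt_of_rot_lt i₂ r₁ r₂ (by exact_mod_cast hab)
  obtain ⟨f, hf, hp⟩ := hC.exists_periodic_leaf i₁ i₂ (fun s => (hlt s).le) p₁ p₂ hρ₁ hρ₂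
  obtain ⟨c, hc⟩ := hf.exists_caustic hk (hf.contDiff_of_periodic ρ.den_pos hp)
  exact ⟨f, c, hf, hc, hf.isRotationCurve hp⟩

end ConvexTable

theorem mainTheorem3 (k : ℕ∞) (hk : 1 ≤ k) (T : ConvexTable k) (ρ₁ ρ₂ : ℚ) (hρ : ρ₁ < ρ₂)
    (Γ₁ Γ₂ : Set (ℝ × ℝ)) (h₁ : T.IsRotationCurve Γ₁ (ρ₁ : ℝ))
    (h₂ : T.IsRotationCurve Γ₂ (ρ₂ : ℝ)) :
    T.RationallyIntegrableOn ρ₁ ρ₂ ↔ T.C0IntegrableBetween Γ₁ Γ₂ :=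
  ⟨fun h => h.c0Integrable hρ.le h₁ h₂, fun h => h.rationallyIntegrable hρ hk h₁ h₂⟩
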